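/- All vector spaces are over $\mathbb C$. Let $K$ and $T$ be complex linear (affine) algebraic groups with Lie algebras $\mathfrak k$, $\mathfrak t$, and let $\gamma:T\to K$ be a morphism of algebraic groups whose differential $\mathfrak t\to\mathfrak k$ (again denoted $\gamma$) is injective. Let $(\mathcal A,K)$ be a Harish-Chandra pair: $\mathcal A$ is an associative unital algebra with an algebraic action $\phi:K\to\operatorname{Aut}(\mathcal A)$ and a Lie algebra homomorphism $\psi:\mathfrak k\to\mathcal A$ which is $K$-equivariant and such that the differential of $\phi$ is $\xi\mapsto[\psi(\xi),-]$. Then $(\mathcal A,T)$, with $\phi\circ\gamma$ and $\psi\circ\gamma$, is also a Harish-Chandra pair. For a Lie algebra $\mathfrak l$, let $N(\mathfrak l)$ be its standard complex with its DG algebra structure, that is, the enveloping DG algebra of the DG Lie algebra $\mathfrak l\xrightarrow{\,1\,}\mathfrak l$ in degrees $-1$ and $0$: it is generated by $X$ in degree $0$ and $i_\xi$ in degree $-1$ ($X,\xi\in\mathfrak l$, linearly), with relations $XY-YX=[X,Y]$, $Xi_\xi-i_\xi X=i_{[X,\xi]}$, $i_\xi i_\eta+i_\eta i_\xi=0$,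 and differential $d\,i_\xi=\xi$, $dX=0$. Let $\iota$ be its principal antiautomorphism: $\iota(X)=-X$, $\iota(i_\xi)=-i_\xi$, $\iota(uv)=(-1)^{\deg u\deg v}\,\iota(v)\,\iota(u)$. The group $K$ acts on $N(\mathfrak k)$ by $\operatorname{Ad}$, and $\gamma$ induces $N(\mathfrak t)\to N(\mathfrak k)$. An $(\mathcal A,K,N(\mathfrak k))$-module is a complex $V$ of vector spaces with an action $\pi$ of $\mathcal A$ by chain maps, an algebraic action $\nu$ of $K$ by chain maps and a DG action $\omega$ of $N(\mathfrak k)$, such that $\pi$ and $\omega$ are $K$-equivariant and commute with each other, and $\pi(\psi(\xi))+\omega(\xi)=d\nu(\xi)$ for $\xi\in\mathfrak k$. Morphisms are the chain maps which preserve all the actions. Denote the category by $\mathcal M(\mathcal A,K,N(\mathfrak k))$, and define $\mathcal M(\mathcal A,T,N(\mathfrak t))$ likewise. Restriction of the actions along $\gamma$ gives the forgetful functor $\operatorname{For}:\mathcal M(\mathcal A,K,N(\mathfrak k))\to\mathcal M(\mathcal A,T,N(\mathfrak t))$. For $V$ in $\mathcal M(\mathcal A,T,N(\mathfrak t))$,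 let $R(K,V)=R(K)\otimes V$ be the complex of $V$-valued regular functions on $K$, with the actions $$(\lambda(X)F)(k)=\pi_V(\psi(X))F(k)+\tfrac{d}{ds}\Big|_{s=0}F(\exp(-sX)k),\quad (\lambda(t)F)(k)=\nu_V(t)F(\gamma(t)^{-1}k),\quad (\lambda(m)F)(k)=\omega_V(m)F(k)$$ of $X\in\mathfrak k$, $t\in T$, $m\in N(\mathfrak t)$. Let $\mathfrak k$ act on $N(\mathfrak k)$ by left multiplication, $T$ by $\operatorname{Ad}\circ\gamma$, and $N(\mathfrak t)$ by $\omega_N(m)n=(-1)^{\deg m\deg n}\,n\,\iota(m)$. Define $$\Gamma^{eq}_{K,T}(V)=\operatorname{Hom}^\cdot_{(\mathfrak k,T,N(\mathfrak t))}(N(\mathfrak k),R(K,V)),$$ the complex whose component of degree $i$ consists of the linear maps $f$ of degree $i$ which commute with $\mathfrak k$ and $T$ and satisfy $f(\omega_N(m)n)=(-1)^{i\deg m}\lambda(m)f(n)$, with differential $df=d\circ f-(-1)^{i}f\circ d$. Let $\mathcal A$, $K$ and $N(\mathfrak k)$ act on it by $$(\pi(a)f)(n)(k)=\pi_V(\phi(k)a)\big(f(n)(k)\big),\qquad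 (\nu(g)f)(n)(k)=f(n)(kg),$$ $$(\omega(n)f)(m)(k)=(-1)^{\deg n\deg f}f(\operatorname{Ad}k(\iota(n))\,m)(k),$$ and for a morphism $\varphi$ put $(\Gamma^{eq}_{K,T}(\varphi)f)(n)(k)=\varphi(f(n)(k))$. **Theorem.** These formulas define a functor $\Gamma^{eq}_{K,T}:\mathcal M(\mathcal A,T,N(\mathfrak t))\to\mathcal M(\mathcal A,K,N(\mathfrak k))$, and it is right adjoint to $\operatorname{For}$. More precisely, there is an adjunction whose unit and counit are $$\Phi_V:V\to\Gamma^{eq}_{K,T}(\operatorname{For}V),\qquad (\Phi_V(v)(n))(k)=(-1)^{\deg v\deg n}\,\omega_V(\iota(n))\,\nu_V(k)v,$$ $$\Psi_W:\operatorname{For}\Gamma^{eq}_{K,T}(W)\to W,\qquad \Psi_W(f)=f(1)(1),$$ for homogeneous $v\in V$, $n\in N(\mathfrak k)$, and $k\in K$. -/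

import Mathlib

open CategoryTheory TensorProduct

universe u t w v

noncomputable section

namespace EqZuckerman

/-! ### Affine algebraic groups over the complex numbers, as groups with regular functions -/

/-- The structure of a complex affine algebraic group on an abstract group `K`, in classical terms:
a finitely generated algebra `R(K)` of complex functions on `K` whose algebra homomorphisms to `ℂ`
are exactly the evaluations at the points of `K` (so that `K` is an affine variety with
coordinate ring `R(K)`), such that multiplication `K × K → K` and inversion `K → K` are regular. -/
class AffineAlgebraicGroup (K : Type u) [Group K] where
  regular : Subalgebra ℂ (K → ℂ)
  finiteType : Algebra.FiniteType ℂ regular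
  points : ∀ χ : regular →ₐ[ℂ] ℂ, ∃! k : K, ∀ f : regular, χ f = (f : K → ℂ) k
  mul_regular : ∀ f ∈ regular, (fun p : K × K => f (p.1 * p.2)) ∈
    Submodule.span ℂ {h : K × K → ℂ | ∃ g₁ ∈ regular, ∃ g₂ ∈ regular, h = fun p => g₁ p.1 * g₂ p.2}
  inv_regular : ∀ f ∈ regular, (fun k => f k⁻¹) ∈ regular

section Group

variable (K : Type u) [Group K] [AffineAlgebraicGroup K]

/-- The regular functions on `K`, as a set of functions. -/
abbrev regularFns : Subalgebra ℂ (K → ℂ) := AffineAlgebraicGroup.regular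

/-- The algebra `R(K)` of regular functions on `K`. -/
def Reg : Type u := ↥(regularFns K)

instance : CommRing (Reg K) := inferInstanceAs (CommRing ↥(regularFns K))

instance : Algebra ℂ (Reg K) := inferInstanceAs (Algebra ℂ ↥(regularFns K))

instance : FunLike (Reg K) K ℂ where
  coe f := f.1
  coe_injective := Subtype.val_injective

variable {K}

/-- A function that belongs to `R(K)`, as an element of `R(K)`. -/
def Reg.mk (f : K → ℂ) (hf : f ∈ regularFns K) : Reg K := ⟨f, hf⟩

theorem Reg.mem (f : Reg K) : (f : K → ℂ) ∈ regularFns K := f.2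

@[simp] theorem Reg.mk_apply (f : K → ℂ) (hf : f ∈ regularFns K) (k : K) : Reg.mk f hf k = f k := rfl

@[simp] theorem Reg.add_apply (f g : Reg K) (k : K) : (f + g) k = f k + g k := rfl

@[simp] theorem Reg.sub_apply (f g : Reg K) (k : K) : (f - g) k = f k - g k := rfl

@[simp] theorem Reg.mul_apply (f g : Reg K) (k : K) : (f * g) k = f k * g k := rfl

@[simp] theorem Reg.smul_apply (c : ℂ) (f : Reg K) (k : K) : (c • f) k = c * f k := rfl

@[simp] theorem Reg.zero_apply (k : K) : (0 : Reg K) k = 0 := rfl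

@[simp] theorem Reg.one_apply (k : K) : (1 : Reg K) k = 1 := rfl

theorem reg_ext {f g : Reg K} (h : ∀ k, f k = g k) : f = g := DFunLike.ext f g h

theorem comul_aux {f : K → ℂ} (hf : f ∈ regularFns K) (δ : Reg K →ₗ[ℂ] ℂ) :
    ∃ G : K → Reg K, (∀ k x, G k x = f (k * x)) ∧ (fun k => δ (G k)) ∈ regularFns K := by
  suffices H : ∀ h ∈ Submodule.span ℂ {h : K × K → ℂ | ∃ g₁ ∈ regularFns K, ∃ g₂ ∈ regularFns K,
      h = fun p => g₁ p.1 * g₂ p.2},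
      ∃ G : K → Reg K, (∀ k x, G k x = h (k, x)) ∧ (fun k => δ (G k)) ∈ regularFns K from
    H _ (AffineAlgebraicGroup.mul_regular f hf)
  intro h hh
  induction hh using Submodule.span_induction with
  | mem h hh =>
    obtain ⟨g₁, h₁, g₂, h₂, rfl⟩ := hh
    refine ⟨fun k => g₁ k • Reg.mk g₂ h₂, fun k x => rfl, ?_⟩
    have : (fun k => δ (g₁ k • (Reg.mk g₂ h₂ : Reg K))) = δ (Reg.mk g₂ h₂) • g₁ := by
      funext k
      rw [map_smul]
      exact mul_comm _ _
    rw [this]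
    exact (regularFns K).smul_mem h₁ _
  | zero =>
    refine ⟨0, fun k x => rfl, ?_⟩
    have : (fun k => δ ((0 : K → Reg K) k)) = 0 := by
      funext k; exact map_zero δ
    rw [this]
    exact (regularFns K).zero_mem
  | add h₁ h₂ _ _ i₁ i₂ =>
    obtain ⟨G₁, e₁, m₁⟩ := i₁
    obtain ⟨G₂, e₂, m₂⟩ := i₂
    refine ⟨G₁ + G₂, fun k x => ?_, ?_⟩
    · simp [e₁, e₂]
    · have : (fun k => δ ((G₁ + G₂) k)) = (fun k => δ (G₁ k)) + fun k => δ (G₂ k) := by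
        funext k; simp
      rw [this]
      exact (regularFns K).add_mem m₁ m₂
  | smul c h _ i =>
    obtain ⟨G, e, m⟩ := i
    refine ⟨c • G, fun k x => ?_, ?_⟩
    · simp [e]
    · have : (fun k => δ ((c • G) k)) = c • fun k => δ (G k) := by
        funext k; simp
      rw [this]
      exact (regularFns K).smul_mem m c

theorem leftTr_mem (g : K) {f : K → ℂ} (hf : f ∈ regularFns K) : (fun x => f (g * x)) ∈ regularFns K := by
  obtain ⟨G, e, _⟩ := comul_aux hf 0
  have : (fun x => f (g * x)) = (G g : K → ℂ) := by
    funext x; exact (e g x).symm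
  rw [this]
  exact (G g).mem

theorem rightTr_mem (g : K) {f : K → ℂ} (hf : f ∈ regularFns K) : (fun x => f (x * g)) ∈ regularFns K := by
  have h := AffineAlgebraicGroup.inv_regular _
    (leftTr_mem g⁻¹ (AffineAlgebraicGroup.inv_regular f hf))
  simpa using h

/-- `f ↦ (x ↦ f (g x))`. -/
def leftTr (g : K) : Reg K →ₐ[ℂ] Reg K where
  toFun f := Reg.mk (fun x => f (g * x)) (leftTr_mem g f.mem)
  map_one' := rfl
  map_mul' _ _ := rfl
  map_zero' := rfl
  map_add' _ _ := rfl
  commutes' _ := rfl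

/-- `f ↦ (x ↦ f (x g))`. -/
def rightTr (g : K) : Reg K →ₐ[ℂ] Reg K where
  toFun f := Reg.mk (fun x => f (x * g)) (rightTr_mem g f.mem)
  map_one' := rfl
  map_mul' _ _ := rfl
  map_zero' := rfl
  map_add' _ _ := rfl
  commutes' _ := rfl

@[simp] theorem leftTr_apply (g x : K) (f : Reg K) :
    (leftTr g f) x = f (g * x) := rfl

@[simp] theorem rightTr_apply (g x : K) (f : Reg K) :
    (rightTr g f) x = f (x * g) := rfl

/-- Evaluation of regular functions at a point. -/
def evalAt (k : K) : Reg K →ₗ[ℂ] ℂ where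
  toFun f := f k
  map_add' _ _ := rfl
  map_smul' _ _ := rfl

@[simp] theorem evalAt_apply (k : K) (f : Reg K) : evalAt k f = f k := rfl

/-! ### The Lie algebra, the adjoint action, differentials of group morphisms -/

variable (K) in
/-- The Lie algebra `𝔨` of `K`: the left invariant derivations of `R(K)`, with the commutator. -/
def lieAlgebra : LieSubalgebra ℂ (Derivation ℂ (Reg K) (Reg K)) where
  carrier := {D | ∀ (g : K) (f : Reg K), D (leftTr g f) = leftTr g (D f)}
  add_mem' := by
    intro D E hD hE g f
    simp [hD g f, hE g f]
  zero_mem' := by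
    intro g f
    simp
  smul_mem' := by
    intro c D hD g f
    simp [hD g f]
  lie_mem' := by
    intro D E hD hE g f
    have hD' : ∀ (g : K) (f : Reg K), D (leftTr g f) = leftTr g (D f) := hD
    have hE' : ∀ (g : K) (f : Reg K), E (leftTr g f) = leftTr g (E f) := hE
    simp [Derivation.commutator_apply, hD', hE']

variable (K) in
/-- The Lie algebra of `K`, as a type. -/
abbrev LieAlg : Type u := ↥(lieAlgebra K)

theorem LieAlg.leftTr (X : LieAlg K) (g : K) (f : Reg K) :
    X.1 (EqZuckerman.leftTr g f) = EqZuckerman.leftTr g (X.1 f) := X.2 g f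

/-- A left invariant derivation is determined by its tangent vector at `1`. -/
theorem LieAlg.ext_one {X Y : LieAlg K}
    (h : ∀ f : Reg K, (X.1 f) 1 = (Y.1 f) 1) : X = Y := by
  apply Subtype.ext
  ext1 f
  apply reg_ext
  intro k
  have := h (EqZuckerman.leftTr k f)
  rw [X.leftTr, Y.leftTr] at this
  simpa using this

/-- The adjoint action: `Ad k` is the differential at `1` of `x ↦ k x k⁻¹`; on left invariant
derivations it is conjugation by right translations. -/
def Ad (k : K) : LieAlg K →ₗ⁅ℂ⁆ LieAlg K where
  toFun X := ⟨Derivation.mk'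
      ((rightTr k).toLinearMap ∘ₗ (X.1 : Reg K →ₗ[ℂ] Reg K) ∘ₗ (rightTr k⁻¹).toLinearMap) (by
        intro f g
        apply reg_ext
        intro x
        simp), by
      intro g f
      have h : rightTr k⁻¹ (leftTr g f) = leftTr g (rightTr k⁻¹ f) := by
        apply reg_ext; intro x; simp [mul_assoc]
      change rightTr k (X.1 (rightTr k⁻¹ (leftTr g f))) = leftTr g (rightTr k (X.1 (rightTr k⁻¹ f)))
      rw [h, X.leftTr]
      apply reg_ext; intro x; simp [mul_assoc]⟩
  map_add' X Y := by
    apply Subtype.ext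
    ext1 f
    simp
  map_smul' c X := by
    apply Subtype.ext
    ext1 f
    simp
  map_lie' := by
    intro X Y
    apply Subtype.ext
    ext1 f
    have h : ∀ f : Reg K, rightTr k⁻¹ (rightTr k f) = f := by
      intro f; apply reg_ext; intro x; simp [mul_assoc]
    change rightTr k (⁅X.1, Y.1⁆ (rightTr k⁻¹ f)) =
      rightTr k (X.1 (rightTr k⁻¹ (rightTr k (Y.1 (rightTr k⁻¹ f))))) -
        rightTr k (Y.1 (rightTr k⁻¹ (rightTr k (X.1 (rightTr k⁻¹ f)))))
    rw [h, h, Derivation.commutator_apply, map_sub]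

theorem Ad_apply (k : K) (X : LieAlg K) (f : Reg K) :
    (Ad k X).1 f = rightTr k (X.1 (rightTr k⁻¹ f)) := rfl

/-- The value at `1` of `Ad k X` on `f` is the value at `1` of `X` on `x ↦ f (k x k⁻¹)`. -/
theorem Ad_apply_one (k : K) (X : LieAlg K) (f : Reg K) :
    ((Ad k X).1 f) 1 = (X.1 (leftTr k (rightTr k⁻¹ f))) 1 := by
  rw [X.leftTr, Ad_apply]
  simp

end Group

/-- A morphism of algebraic groups: a group homomorphism pulling regular functions back to
regular functions. -/
structure AlgGroupHom (T : Type t) (K : Type u) [Group T] [AffineAlgebraicGroup T]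
    [Group K] [AffineAlgebraicGroup K] where
  toHom : T →* K
  regular_comp : ∀ f ∈ regularFns K, (fun x => f (toHom x)) ∈ regularFns T

section Morphism

variable {T : Type t} {K : Type u} [Group T] [AffineAlgebraicGroup T]
  [Group K] [AffineAlgebraicGroup K]

/-- Pullback of regular functions. -/
def AlgGroupHom.pull (γ : AlgGroupHom T K) : Reg K →ₐ[ℂ] Reg T where
  toFun f := Reg.mk (fun x => f (γ.toHom x)) (γ.regular_comp _ f.mem)
  map_one' := rfl
  map_mul' _ _ := rfl
  map_zero' := rfl
  map_add' _ _ := rfl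
  commutes' _ := rfl

@[simp] theorem AlgGroupHom.pull_apply (γ : AlgGroupHom T K) (f : Reg K) (x : T) :
    (γ.pull f) x = f (γ.toHom x) := rfl

theorem AlgGroupHom.pull_leftTr (γ : AlgGroupHom T K) (f : Reg K) (x : T) :
    γ.pull (leftTr (γ.toHom x) f) = leftTr x (γ.pull f) := by
  apply reg_ext; intro y; simp

/-- The tangent functional at `1` of `K` obtained by pushing forward a tangent vector of `T`. -/
def AlgGroupHom.push (γ : AlgGroupHom T K) (X : LieAlg T) : Reg K →ₗ[ℂ] ℂ :=
  evalAt (1 : T) ∘ₗ (X.1 : Reg T →ₗ[ℂ] Reg T) ∘ₗ γ.pull.toLinearMap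

theorem AlgGroupHom.push_apply (γ : AlgGroupHom T K) (X : LieAlg T) (f : Reg K) :
    γ.push X f = (X.1 (γ.pull f)) 1 := rfl

theorem push_mem (δ : Reg K →ₗ[ℂ] ℂ) (f : Reg K) : (fun k => δ (leftTr k f)) ∈ regularFns K := by
  obtain ⟨G, e, m⟩ := comul_aux f.mem δ
  have : G = fun k => leftTr k f := by
    funext k; apply reg_ext; intro x; exact e k x
  rw [this] at m
  exact m

/-- The left invariant derivation of `R(K)` whose tangent vector at `1` is the push-forward of that
of `X`. -/
def AlgGroupHom.lieFun (γ : AlgGroupHom T K) (X : LieAlg T) : LieAlg K :=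
  ⟨Derivation.mk'
    { toFun := fun f => Reg.mk (fun k => γ.push X (leftTr k f)) (push_mem _ f)
      map_add' := by
        intro f g; apply reg_ext; intro k; simp
      map_smul' := by
        intro c f; apply reg_ext; intro k; simp }
    (by
      intro f g
      apply reg_ext
      intro k
      simp [AlgGroupHom.push_apply]), by
    intro g f
    apply reg_ext
    intro k
    change γ.push X (leftTr k (leftTr g f)) = γ.push X (leftTr (g * k) f)
    congr 1
    apply reg_ext; intro x; simp [mul_assoc]⟩

theorem AlgGroupHom.lieFun_apply (γ : AlgGroupHom T K) (X : LieAlg T) (f : Reg K) (k : K) :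
    ((γ.lieFun X).1 f) k = (X.1 (γ.pull (leftTr k f))) 1 := rfl

theorem AlgGroupHom.lieFun_apply_one (γ : AlgGroupHom T K) (X : LieAlg T) (f : Reg K) :
    ((γ.lieFun X).1 f) 1 = (X.1 (γ.pull f)) 1 := by
  rw [γ.lieFun_apply]
  have h : leftTr 1 f = f := by
    apply reg_ext; intro x; simp
  rw [h]

theorem AlgGroupHom.pull_lieFun (γ : AlgGroupHom T K) (X : LieAlg T) (f : Reg K) :
    γ.pull ((γ.lieFun X).1 f) = X.1 (γ.pull f) := by
  apply reg_ext
  intro x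
  rw [γ.pull_apply, γ.lieFun_apply, γ.pull_leftTr, X.leftTr]
  simp

/-- The differential of a morphism of algebraic groups. -/
def AlgGroupHom.lieMap (γ : AlgGroupHom T K) : LieAlg T →ₗ⁅ℂ⁆ LieAlg K where
  toFun := γ.lieFun
  map_add' X Y := by
    apply LieAlg.ext_one
    intro f
    simp [AlgGroupHom.lieFun_apply_one]
  map_smul' c X := by
    apply LieAlg.ext_one
    intro f
    simp [AlgGroupHom.lieFun_apply_one]
  map_lie' := by
    intro X Y
    apply LieAlg.ext_one
    intro f
    simp [AlgGroupHom.lieFun_apply_one, Derivation.commutator_apply, AlgGroupHom.pull_lieFun]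

theorem AlgGroupHom.lieMap_apply_one (γ : AlgGroupHom T K) (X : LieAlg T) (f : Reg K) :
    ((γ.lieMap X).1 f) 1 = (X.1 (γ.pull f)) 1 := γ.lieFun_apply_one X f

theorem AlgGroupHom.lieMap_Ad (γ : AlgGroupHom T K) (x : T) :
    γ.lieMap.comp (Ad x) = (Ad (γ.toHom x)).comp γ.lieMap := by
  ext1 X
  apply LieAlg.ext_one
  intro f
  simp only [LieHom.comp_apply]
  rw [γ.lieMap_apply_one, Ad_apply_one, Ad_apply_one, γ.lieMap_apply_one]
  have h : leftTr x (rightTr x⁻¹ (γ.pull f)) =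
      γ.pull (leftTr (γ.toHom x) (rightTr (γ.toHom x)⁻¹ f)) := by
    apply reg_ext; intro y; simp
  rw [h]

end Morphism

/-! ### Vector valued regular functions, algebraic representations and their differentials -/

open Classical in
theorem tensor_ext_dual {M : Type u} {V : Type v} [AddCommGroup M] [Module ℂ M] [AddCommGroup V]
    [Module ℂ V] {z z' : M ⊗[ℂ] V}
    (h : ∀ l : V →ₗ[ℂ] ℂ, TensorProduct.rid ℂ M (l.lTensor M z) =
      TensorProduct.rid ℂ M (l.lTensor M z')) : z = z' := by
  let b := Module.Basis.ofVectorSpace ℂ V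
  apply (TensorProduct.equivFinsuppOfBasisRight (M := M) b).injective
  have h2 : ∀ (z : M ⊗[ℂ] V) i, TensorProduct.equivFinsuppOfBasisRight (M := M) b z i
      = TensorProduct.rid ℂ M ((b.coord i).lTensor M z) := by
    intro z i
    induction z using TensorProduct.induction_on with
    | zero => simp
    | tmul f x => simp
    | add a b ha hb => simp [ha, hb]
  ext1 i
  rw [h2, h2, h]

section RegFun

variable (K : Type u) [Group K] [AffineAlgebraicGroup K]
variable (V : Type v) [AddCommGroup V] [Module ℂ V]

/-- The natural map `R(K) ⊗ V → (K → V)`. -/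
def evalTensor : Reg K ⊗[ℂ] V →ₗ[ℂ] (K → V) :=
  LinearMap.pi fun k => (TensorProduct.lid ℂ V).toLinearMap ∘ₗ (evalAt k).rTensor V

@[simp] theorem evalTensor_tmul (f : Reg K) (x : V) (k : K) :
    evalTensor K V (f ⊗ₜ x) k = f k • x := by
  simp [evalTensor]

theorem evalTensor_dual (l : V →ₗ[ℂ] ℂ) (z : Reg K ⊗[ℂ] V) (k : K) :
    ((TensorProduct.rid ℂ (Reg K)) (l.lTensor (Reg K) z)) k = l (evalTensor K V z k) := by
  induction z using TensorProduct.induction_on with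
  | zero => simp
  | tmul f x => simp [mul_comm]
  | add a b ha hb => simp [ha, hb]

theorem evalTensor_injective : Function.Injective (evalTensor K V) := by
  intro z z' hz
  refine tensor_ext_dual fun l => reg_ext fun k => ?_
  rw [evalTensor_dual, evalTensor_dual, hz]

/-- The space `R(K, V)` of `V`-valued regular functions on `K`, i.e. the image of `R(K) ⊗ V` in the
space of all functions `K → V`. -/
def RegFun : Submodule ℂ (K → V) := LinearMap.range (evalTensor K V)

/-- `R(K) ⊗ V = R(K, V)`. -/
def regEquiv : Reg K ⊗[ℂ] V ≃ₗ[ℂ] RegFun K V :=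
  LinearEquiv.ofInjective _ (evalTensor_injective K V)

variable {K V}

theorem regEquiv_apply (z : Reg K ⊗[ℂ] V) (k : K) :
    (regEquiv K V z : K → V) k = evalTensor K V z k := rfl

theorem smul_mem_regFun {f : K → ℂ} (hf : f ∈ regularFns K) (x : V) : (fun k => f k • x) ∈ RegFun K V :=
  ⟨Reg.mk f hf ⊗ₜ x, by funext k; simp⟩

/-- The derivative at `1` of `V`-valued regular functions along `X ∈ 𝔨`, i.e. the linear map
`R(K, V) → V` sending `f • x` to `(X f)(1) • x`. -/
def derivOne (X : LieAlg K) : RegFun K V →ₗ[ℂ] V :=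
  ((TensorProduct.lid ℂ V).toLinearMap ∘ₗ
    (evalAt (1 : K) ∘ₗ (X.1 : Reg K →ₗ[ℂ] Reg K)).rTensor V) ∘ₗ (regEquiv K V).symm.toLinearMap

theorem rightTr_mem_regFun (g : K) {F : K → V} (hF : F ∈ RegFun K V) :
    (fun x => F (x * g)) ∈ RegFun K V := by
  obtain ⟨z, rfl⟩ := hF
  refine ⟨(rightTr g).toLinearMap.rTensor V z, ?_⟩
  funext k
  induction z using TensorProduct.induction_on with
  | zero => simp
  | tmul f x => simp
  | add a b ha hb => simp [ha, hb]

/-- Right translation on `R(K, V)`: `F ↦ (x ↦ F (x g))`. -/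
def rightTrV (g : K) : RegFun K V →ₗ[ℂ] RegFun K V where
  toFun F := ⟨fun x => (F : K → V) (x * g), rightTr_mem_regFun g F.2⟩
  map_add' _ _ := rfl
  map_smul' _ _ := rfl

/-- Algebraic representations: `V` is the union of finite dimensional invariant subspaces on each
of which the action has regular matrix coefficients. -/
def IsAlgebraic (ν : Representation ℂ K V) : Prop :=
  ∀ x : V, ∃ W : Submodule ℂ V, x ∈ W ∧ FiniteDimensional ℂ W ∧ (∀ k, ∀ y ∈ W, ν k y ∈ W) ∧
    ∀ y ∈ W, ∀ l : V →ₗ[ℂ] ℂ, (fun k => l (ν k y)) ∈ regularFns K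

theorem IsAlgebraic.orbit_mem {ν : Representation ℂ K V} (h : IsAlgebraic ν) (x : V) :
    (fun k => ν k x) ∈ RegFun K V := by
  obtain ⟨W, hx, hfin, hinv, hreg⟩ := h x
  obtain ⟨p, hp⟩ := W.subtype.exists_leftInverse_of_injective (Submodule.ker_subtype W)
  let b := Module.finBasis ℂ W
  have key : (fun k => ν k x) = ∑ i, fun k => (b.coord i ∘ₗ p) (ν k x) • (b i : V) := by
    funext k
    have h1 : p (ν k x) = ⟨ν k x, hinv k x hx⟩ :=
      LinearMap.congr_fun hp (⟨ν k x, hinv k x hx⟩ : W)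
    have h2 := congrArg (Submodule.subtype W) (b.sum_repr (p (ν k x)))
    rw [map_sum] at h2
    simp only [h1] at h2
    simp [h1]
    simpa using h2.symm
  rw [key]
  exact Submodule.sum_mem _ fun i _ => smul_mem_regFun (hreg x hx _) _

/-- The differential of an algebraic representation: `X ∈ 𝔨` sends `x` to the derivative at `1`
along `X` of the regular function `k ↦ ν k x`. -/
def differential (ν : Representation ℂ K V) (h : IsAlgebraic ν) (X : LieAlg K) (x : V) : V :=
  derivOne X ⟨fun k => ν k x, h.orbit_mem x⟩

variable {T : Type t} [Group T] [AffineAlgebraicGroup T]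

theorem AlgGroupHom.evalTensor_pull (γ : AlgGroupHom T K) (z : Reg K ⊗[ℂ] V) (x : T) :
    evalTensor T V (γ.pull.toLinearMap.rTensor V z) x = evalTensor K V z (γ.toHom x) := by
  induction z using TensorProduct.induction_on with
  | zero => simp
  | tmul f x => simp
  | add a b ha hb => rw [map_add, map_add, map_add, Pi.add_apply, Pi.add_apply, ha, hb]

theorem AlgGroupHom.regFun_comp (γ : AlgGroupHom T K) {F : K → V} (hF : F ∈ RegFun K V) :
    (fun x => F (γ.toHom x)) ∈ RegFun T V := by
  obtain ⟨z, rfl⟩ := hF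
  exact ⟨γ.pull.toLinearMap.rTensor V z, funext (γ.evalTensor_pull z)⟩

theorem derivOne_regEquiv (X : LieAlg K) (z : Reg K ⊗[ℂ] V) :
    derivOne X (regEquiv K V z) = TensorProduct.lid ℂ V
      ((evalAt (1 : K) ∘ₗ (X.1 : Reg K →ₗ[ℂ] Reg K)).rTensor V z) := by
  simp only [derivOne, LinearMap.comp_apply, LinearEquiv.coe_coe, LinearEquiv.symm_apply_apply]

theorem AlgGroupHom.derivOne_comp (γ : AlgGroupHom T K) (X : LieAlg T) (F : RegFun K V) :
    derivOne X ⟨fun x => (F : K → V) (γ.toHom x), γ.regFun_comp F.2⟩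
      = derivOne (γ.lieMap X) F := by
  obtain ⟨z, rfl⟩ := (regEquiv K V).surjective F
  have h : (⟨fun x => (regEquiv K V z : K → V) (γ.toHom x), γ.regFun_comp (regEquiv K V z).2⟩ :
      RegFun T V) = regEquiv T V (γ.pull.toLinearMap.rTensor V z) :=
    Subtype.ext (funext fun x => (γ.evalTensor_pull z x).symm)
  rw [h, derivOne_regEquiv, derivOne_regEquiv, ← LinearMap.rTensor_comp_apply]
  congr 2
  congr 1
  ext f
  exact (γ.lieMap_apply_one X f).symm

theorem IsAlgebraic.comp {ν : Representation ℂ K V} (h : IsAlgebraic ν) (γ : AlgGroupHom T K) :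
    IsAlgebraic (ν.comp γ.toHom) := by
  intro x
  obtain ⟨W, hx, hfin, hinv, hreg⟩ := h x
  exact ⟨W, hx, hfin, fun k => hinv _, fun y hy l => γ.regular_comp _ (hreg y hy l)⟩

theorem differential_comp {ν : Representation ℂ K V} (h : IsAlgebraic ν) (γ : AlgGroupHom T K)
    (X : LieAlg T) (x : V) :
    differential (ν.comp γ.toHom) (h.comp γ) X x = differential ν h (γ.lieMap X) x :=
  γ.derivOne_comp X ⟨fun k => ν k x, h.orbit_mem x⟩

end RegFun

/-! ### The standard complex of a Lie algebra as a DG algebra -/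

section StdComplex

variable (L : Type u) [LieRing L] [LieAlgebra ℂ L]

/-- The relations of the enveloping algebra of the DG Lie algebra `L → L` (degrees `-1` and `0`);
`(X, 0)` is `X` in degree `0` and `(0, ξ)` is `ξ` in degree `-1`. -/
inductive StdRel : TensorAlgebra ℂ (L × L) → TensorAlgebra ℂ (L × L) → Prop
  | zero_zero (X Y : L) : StdRel
      (TensorAlgebra.ι ℂ (X, 0) * TensorAlgebra.ι ℂ (Y, 0))
      (TensorAlgebra.ι ℂ (Y, 0) * TensorAlgebra.ι ℂ (X, 0) + TensorAlgebra.ι ℂ (⁅X, Y⁆, 0))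
  | zero_one (X ξ : L) : StdRel
      (TensorAlgebra.ι ℂ (X, 0) * TensorAlgebra.ι ℂ (0, ξ))
      (TensorAlgebra.ι ℂ (0, ξ) * TensorAlgebra.ι ℂ (X, 0) + TensorAlgebra.ι ℂ (0, ⁅X, ξ⁆))
  | one_one (ξ η : L) : StdRel
      (TensorAlgebra.ι ℂ (0, ξ) * TensorAlgebra.ι ℂ (0, η) +
        TensorAlgebra.ι ℂ (0, η) * TensorAlgebra.ι ℂ (0, ξ)) 0

/-- The algebra `N(L)`: the standard complex of `L` with its algebra structure, i.e. the
enveloping algebra of the DG Lie algebra `L → L`. -/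
def StdComplex : Type u := RingQuot (StdRel L)

instance : Ring (StdComplex L) := inferInstanceAs (Ring (RingQuot (StdRel L)))

instance : Algebra ℂ (StdComplex L) := inferInstanceAs (Algebra ℂ (RingQuot (StdRel L)))

namespace StdComplex

variable {L}

/-- The quotient map from the tensor algebra. -/
def mkHom : TensorAlgebra ℂ (L × L) →ₐ[ℂ] StdComplex L := RingQuot.mkAlgHom ℂ (StdRel L)

/-- The inclusion of `L` as generators of degree `0`. -/
def gen0 : L →ₗ[ℂ] StdComplex L :=
  mkHom.toLinearMap ∘ₗ TensorAlgebra.ι ℂ ∘ₗ LinearMap.inl ℂ L L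

/-- The inclusion of `L` as generators of degree `-1`. -/
def gen1 : L →ₗ[ℂ] StdComplex L :=
  mkHom.toLinearMap ∘ₗ TensorAlgebra.ι ℂ ∘ₗ LinearMap.inr ℂ L L

theorem gen0_gen0 (X Y : L) : gen0 X * gen0 Y = gen0 Y * gen0 X + gen0 ⁅X, Y⁆ := by
  have h := RingQuot.mkAlgHom_rel ℂ (StdRel.zero_zero X Y)
  rwa [map_mul, map_add, map_mul] at h

theorem gen0_gen1 (X ξ : L) : gen0 X * gen1 ξ = gen1 ξ * gen0 X + gen1 ⁅X, ξ⁆ := by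
  have h := RingQuot.mkAlgHom_rel ℂ (StdRel.zero_one X ξ)
  rwa [map_mul, map_add, map_mul] at h

theorem gen1_gen1 (ξ η : L) : gen1 ξ * gen1 η + gen1 η * gen1 ξ = 0 := by
  have h := RingQuot.mkAlgHom_rel ℂ (StdRel.one_one ξ η)
  rwa [map_add, map_mul, map_mul, map_zero] at h

section Lift

variable {B : Type*} [Ring B] [Algebra ℂ B]

/-- The universal property of `N(L)`. -/
def lift (f₀ f₁ : L →ₗ[ℂ] B)
    (h₀₀ : ∀ X Y, f₀ X * f₀ Y = f₀ Y * f₀ X + f₀ ⁅X, Y⁆)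
    (h₀₁ : ∀ X ξ, f₀ X * f₁ ξ = f₁ ξ * f₀ X + f₁ ⁅X, ξ⁆)
    (h₁₁ : ∀ ξ η, f₁ ξ * f₁ η + f₁ η * f₁ ξ = 0) : StdComplex L →ₐ[ℂ] B :=
  RingQuot.liftAlgHom ℂ ⟨TensorAlgebra.lift ℂ (f₀.coprod f₁), by
    intro x y h
    induction h with
    | zero_zero X Y => simpa using h₀₀ X Y
    | zero_one X ξ => simpa using h₀₁ X ξ
    | one_one ξ η => simpa using h₁₁ ξ η⟩

variable (f₀ f₁ : L →ₗ[ℂ] B)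
    (h₀₀ : ∀ X Y, f₀ X * f₀ Y = f₀ Y * f₀ X + f₀ ⁅X, Y⁆)
    (h₀₁ : ∀ X ξ, f₀ X * f₁ ξ = f₁ ξ * f₀ X + f₁ ⁅X, ξ⁆)
    (h₁₁ : ∀ ξ η, f₁ ξ * f₁ η + f₁ η * f₁ ξ = 0)

@[simp] theorem lift_gen0 (X : L) : lift f₀ f₁ h₀₀ h₀₁ h₁₁ (gen0 X) = f₀ X := by
  have h := RingQuot.liftAlgHom_mkAlgHom_apply ℂ (TensorAlgebra.lift ℂ (f₀.coprod f₁))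
    (s := StdRel L) (w := by
      intro x y h
      induction h with
      | zero_zero X Y => simpa using h₀₀ X Y
      | zero_one X ξ => simpa using h₀₁ X ξ
      | one_one ξ η => simpa using h₁₁ ξ η) (TensorAlgebra.ι ℂ (X, 0))
  exact h.trans (by simp)

@[simp] theorem lift_gen1 (X : L) : lift f₀ f₁ h₀₀ h₀₁ h₁₁ (gen1 X) = f₁ X := by
  have h := RingQuot.liftAlgHom_mkAlgHom_apply ℂ (TensorAlgebra.lift ℂ (f₀.coprod f₁))
    (s := StdRel L) (w := by
      intro x y h
      induction h with
      | zero_zero X Y => simpa using h₀₀ X Y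
      | zero_one X ξ => simpa using h₀₁ X ξ
      | one_one ξ η => simpa using h₁₁ ξ η) (TensorAlgebra.ι ℂ (0, X))
  exact h.trans (by simp)

theorem hom_ext {f g : StdComplex L →ₐ[ℂ] B} (h0 : ∀ X, f (gen0 X) = g (gen0 X))
    (h1 : ∀ X, f (gen1 X) = g (gen1 X)) : f = g := by
  refine RingQuot.ringQuot_ext' (s := StdRel L) ℂ f g ?_
  apply TensorAlgebra.hom_ext
  ext X
  · exact h0 X
  · exact h1 X

end Lift

theorem induction {C : StdComplex L → Prop} (halg : ∀ c : ℂ, C (algebraMap ℂ _ c))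
    (h0 : ∀ X, C (gen0 X)) (h1 : ∀ X, C (gen1 X)) (hmul : ∀ a b, C a → C b → C (a * b))
    (hadd : ∀ a b, C a → C b → C (a + b)) (n : StdComplex L) : C n := by
  obtain ⟨x, rfl⟩ := RingQuot.mkAlgHom_surjective ℂ (StdRel L) n
  change C (mkHom x)
  induction x using TensorAlgebra.induction with
  | algebraMap c => rw [AlgHom.commutes]; exact halg c
  | ι z =>
    have : mkHom (TensorAlgebra.ι ℂ z) = gen0 z.1 + gen1 z.2 := by
      change _ = mkHom (TensorAlgebra.ι ℂ (z.1, 0)) + mkHom (TensorAlgebra.ι ℂ (0, z.2))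
      rw [← map_add, ← map_add]
      simp
    rw [this]
    exact hadd _ _ (h0 _) (h1 _)
  | mul a b ha hb => rw [map_mul]; exact hmul _ _ ha hb
  | add a b ha hb => rw [map_add]; exact hadd _ _ ha hb

/-- The generators, indexed by `L ⊕ L`. -/
def gen : L ⊕ L → StdComplex L := Sum.elim gen0 gen1

/-- The degree of a word in the generators: minus the number of letters of degree `-1`. -/
def wordDeg (l : List (L ⊕ L)) : ℤ := -(l.countP Sum.isRight : ℤ)

variable (L) in
/-- The homogeneous component `N^p(L)`, spanned by the words of degree `p` in the generators. -/
def deg (p : ℤ) : Submodule ℂ (StdComplex L) :=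
  Submodule.span ℂ {x | ∃ l : List (L ⊕ L), wordDeg l = p ∧ x = (l.map gen).prod}

/-- The parity automorphism, equal to `(-1) ^ p` on `N^p(L)`. -/
def parity : StdComplex L →ₐ[ℂ] StdComplex L :=
  lift gen0 (-gen1) gen0_gen0
    (by intro X ξ; simp [gen0_gen1]; abel)
    (by intro ξ η; simpa using gen1_gen1 ξ η)

@[simp] theorem parity_gen0 (X : L) : parity (gen0 X) = gen0 X := by simp [parity]

@[simp] theorem parity_gen1 (ξ : L) : parity (gen1 ξ) = -gen1 ξ := by simp [parity]

set_option linter.unusedSectionVars false in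
theorem wordDeg_nil : wordDeg ([] : List (L ⊕ L)) = 0 := by simp [wordDeg]

set_option linter.unusedSectionVars false in
theorem wordDeg_inl (X : L) (l : List (L ⊕ L)) : wordDeg (Sum.inl X :: l) = wordDeg l := by
  simp [wordDeg]

set_option linter.unusedSectionVars false in
theorem wordDeg_inr (ξ : L) (l : List (L ⊕ L)) : wordDeg (Sum.inr ξ :: l) = wordDeg l - 1 := by
  have : (Sum.inr ξ :: l).countP Sum.isRight = l.countP Sum.isRight + 1 :=
    List.countP_cons_of_pos rfl
  simp only [wordDeg, this]
  push_cast
  ring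

theorem parity_of_mem {p : ℤ} {n : StdComplex L} (hn : n ∈ deg L p) :
    parity n = (-1 : ℂ) ^ p • n := by
  induction hn using Submodule.span_induction with
  | zero => simp
  | add a b _ _ ha hb => rw [map_add, ha, hb, smul_add]
  | smul c a _ ha => rw [map_smul, ha, smul_comm]
  | mem x hx =>
    obtain ⟨l, rfl, rfl⟩ := hx
    induction l with
    | nil => simp [wordDeg]
    | cons a l ih =>
      rcases a with X | ξ
      · rw [wordDeg_inl, List.map_cons, List.prod_cons, map_mul, ih]
        simp [gen]
      · rw [wordDeg_inr, List.map_cons, List.prod_cons, map_mul, ih]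
        simp [gen, zpow_sub_one₀]

/-- The algebra homomorphism `n ↦ (parity n, d n; 0, n)` into two by two matrices. -/
def dMatrix : StdComplex L →ₐ[ℂ] Matrix (Fin 2) (Fin 2) (StdComplex L) :=
  lift
    { toFun := fun X => !![gen0 X, 0; 0, gen0 X]
      map_add' := by intro X Y; ext i j; fin_cases i <;> fin_cases j <;> simp
      map_smul' := by intro c X; ext i j; fin_cases i <;> fin_cases j <;> simp }
    { toFun := fun ξ => !![-gen1 ξ, gen0 ξ; 0, gen1 ξ]
      map_add' := by
        intro X Y; ext i j; fin_cases i <;> fin_cases j <;> simp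
        abel
      map_smul' := by intro c X; ext i j; fin_cases i <;> fin_cases j <;> simp }
    (by
      intro X Y
      ext i j; fin_cases i <;> fin_cases j <;> simp [gen0_gen0 X Y])
    (by
      intro X ξ
      ext i j; fin_cases i <;> fin_cases j <;> simp [gen0_gen1 X ξ, gen0_gen0 X ξ]
      abel)
    (by
      intro ξ η
      ext i j; fin_cases i <;> fin_cases j <;> simp
      · exact gen1_gen1 ξ η
      · have h1 := gen0_gen1 ξ η
        have h2 := gen0_gen1 η ξ
        rw [h1, h2, ← lie_skew ξ η, map_neg]
        abel
      · exact gen1_gen1 ξ η)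

theorem dMatrix_diag (n : StdComplex L) :
    dMatrix n 1 0 = 0 ∧ dMatrix n 1 1 = n ∧ dMatrix n 0 0 = parity n := by
  induction n using StdComplex.induction with
  | halg c => simp [Algebra.algebraMap_eq_smul_one]
  | h0 X => simp [dMatrix]
  | h1 ξ => simp [dMatrix]
  | hmul a b ha hb =>
    obtain ⟨a1, a2, a3⟩ := ha
    obtain ⟨b1, b2, b3⟩ := hb
    simp [Matrix.mul_apply, Fin.sum_univ_two, a1, a2, a3, b1, b2, b3]
  | hadd a b ha hb =>
    obtain ⟨a1, a2, a3⟩ := ha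
    obtain ⟨b1, b2, b3⟩ := hb
    simp [a1, a2, a3, b1, b2, b3]

/-- The differential of `N(L)`: the superderivation with `d ξ = ξ` (from degree `-1` to degree `0`)
and `d X = 0` for generators `X` of degree `0`. -/
def diff : StdComplex L →ₗ[ℂ] StdComplex L where
  toFun n := dMatrix n 0 1
  map_add' := by intro a b; simp
  map_smul' := by intro c a; simp

@[simp] theorem diff_gen0 (X : L) : diff (gen0 X) = 0 := by simp [diff, dMatrix]

@[simp] theorem diff_gen1 (ξ : L) : diff (gen1 ξ) = gen0 ξ := by simp [diff, dMatrix]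

theorem diff_mul_parity (m n : StdComplex L) : diff (m * n) = diff m * n + parity m * diff n := by
  change dMatrix (m * n) 0 1 = dMatrix m 0 1 * n + parity m * dMatrix n 0 1
  rw [map_mul, Matrix.mul_apply, Fin.sum_univ_two, (dMatrix_diag m).2.2, (dMatrix_diag n).2.1,
    add_comm]

theorem diff_mul {p : ℤ} {m : StdComplex L} (hm : m ∈ deg L p) (n : StdComplex L) :
    diff (m * n) = diff m * n + (-1 : ℂ) ^ p • (m * diff n) := by
  rw [diff_mul_parity, parity_of_mem hm, smul_mul_assoc]

@[simp] theorem diff_algebraMap (c : ℂ) : diff (algebraMap ℂ (StdComplex L) c) = 0 := by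
  have h : diff (1 : StdComplex L) = 0 := by
    have h := diff_mul_parity (1 : StdComplex L) 1
    simpa using h
  rw [Algebra.algebraMap_eq_smul_one, map_smul, h, smul_zero]

/-- The algebra homomorphism of `N(L)` into its endomorphisms which sends `X` of degree `0` to
`n ↦ -n X` and `ξ` of degree `-1` to `n ↦ -(-1) ^ (deg n) n ξ`. -/
def twistedRight : StdComplex L →ₐ[ℂ] Module.End ℂ (StdComplex L) :=
  lift
    { toFun := fun X => -LinearMap.mulRight ℂ (gen0 X)
      map_add' := by intro X Y; ext n; simp [mul_add]; abel
      map_smul' := by intro c X; ext n; simp }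
    { toFun := fun ξ => -(LinearMap.mulRight ℂ (gen1 ξ) ∘ₗ parity.toLinearMap)
      map_add' := by intro X Y; ext n; simp [mul_add]; abel
      map_smul' := by intro c X; ext n; simp }
    (by
      intro X Y
      ext n
      simp [mul_assoc, gen0_gen0 X Y, mul_add])
    (by
      intro X ξ
      ext n
      simp [mul_assoc, gen0_gen1 X ξ, mul_add, parity])
    (by
      intro ξ η
      ext n
      have h := gen1_gen1 ξ η
      simp only [LinearMap.coe_mk, AddHom.coe_mk, LinearMap.add_apply, Module.End.mul_apply,
        LinearMap.neg_apply, LinearMap.comp_apply, LinearMap.mulRight_apply,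
        AlgHom.toLinearMap_apply, map_neg, map_mul, LinearMap.zero_apply]
      rw [parity_gen1, parity_gen1]
      have e : ∀ a : StdComplex L, - -(a * -gen1 η * gen1 ξ) + - -(a * -gen1 ξ * gen1 η) =
          -(a * (gen1 ξ * gen1 η + gen1 η * gen1 ξ)) := by
        intro a; noncomm_ring
      rw [e, h, mul_zero, neg_zero])

theorem twistedRight_gen0 (X : L) (n : StdComplex L) :
    twistedRight (gen0 X) n = -(n * gen0 X) := by simp [twistedRight]

theorem twistedRight_gen1 (ξ : L) (n : StdComplex L) :
    twistedRight (gen1 ξ) n = -(parity n * gen1 ξ) := by simp [twistedRight]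

/-- The principal antiautomorphism of `N(L)`: minus the identity on generators, and
`ι (m n) = (-1) ^ (deg m * deg n) ι n ι m`. -/
def iota : StdComplex L →ₗ[ℂ] StdComplex L where
  toFun n := twistedRight n 1
  map_add' := by intro a b; simp
  map_smul' := by intro c a; simp

@[simp] theorem iota_one : iota (1 : StdComplex L) = 1 := by simp [iota]

@[simp] theorem iota_gen0 (X : L) : iota (gen0 X) = -gen0 X := by
  simp [iota, twistedRight_gen0]

@[simp] theorem iota_gen1 (ξ : L) : iota (gen1 ξ) = -gen1 ξ := by
  simp [iota, twistedRight_gen1]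

theorem mul_mem {p q : ℤ} {m n : StdComplex L} (hm : m ∈ deg L p) (hn : n ∈ deg L q) :
    m * n ∈ deg L (p + q) := by
  induction hm using Submodule.span_induction with
  | zero => rw [zero_mul]; exact Submodule.zero_mem _
  | add a b _ _ ha hb => rw [add_mul]; exact Submodule.add_mem _ ha hb
  | smul c a _ ha => rw [smul_mul_assoc]; exact Submodule.smul_mem _ c ha
  | mem x hx =>
    obtain ⟨l, rfl, rfl⟩ := hx
    induction hn using Submodule.span_induction with
    | zero => rw [mul_zero]; exact Submodule.zero_mem _
    | add a b _ _ ha hb => rw [mul_add]; exact Submodule.add_mem _ ha hb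
    | smul c a _ ha => rw [mul_smul_comm]; exact Submodule.smul_mem _ c ha
    | mem y hy =>
      obtain ⟨l', rfl, rfl⟩ := hy
      refine Submodule.subset_span ⟨l ++ l', ?_, by simp⟩
      simp [wordDeg, List.countP_append]
      ring

theorem one_mem : (1 : StdComplex L) ∈ deg L 0 :=
  Submodule.subset_span ⟨[], wordDeg_nil, by simp⟩

theorem gen0_mem (X : L) : gen0 X ∈ deg L 0 :=
  Submodule.subset_span ⟨[Sum.inl X], by simp [wordDeg], by simp [gen]⟩

theorem gen1_mem (ξ : L) : gen1 ξ ∈ deg L (-1) :=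
  Submodule.subset_span ⟨[Sum.inr ξ], by rw [wordDeg_inr, wordDeg_nil]; rfl, by simp [gen]⟩

/-- The operator `twistedRight m` is `n ↦ (-1) ^ (deg m * deg n) n ι m`. -/
theorem twistedRight_apply {p q : ℤ} {m n : StdComplex L} (hm : m ∈ deg L p) (hn : n ∈ deg L q) :
    twistedRight m n = (-1 : ℂ) ^ (p * q) • (n * iota m) := by
  induction hm using Submodule.span_induction with
  | zero => simp
  | add a b _ _ ha hb => rw [map_add, map_add, LinearMap.add_apply, ha, hb, mul_add, smul_add]
  | smul c a _ ha =>
    rw [map_smul, map_smul, LinearMap.smul_apply, ha, mul_smul_comm, smul_comm]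
  | mem x hx =>
    obtain ⟨l, rfl, rfl⟩ := hx
    induction l with
    | nil => simp [wordDeg]
    | cons a l ih =>
      rcases a with X | ξ
      · rw [wordDeg_inl, List.map_cons, List.prod_cons, map_mul, Module.End.mul_apply, ih]
        change twistedRight (gen0 X) _ = _ • (n * twistedRight (gen0 X * _) 1)
        rw [map_mul, Module.End.mul_apply, twistedRight_gen0, twistedRight_gen0]
        simp [iota, mul_assoc]
      · rw [wordDeg_inr, List.map_cons, List.prod_cons, map_mul, Module.End.mul_apply, ih]
        change twistedRight (gen1 ξ) _ = _ • (n * twistedRight (gen1 ξ * _) 1)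
        rw [map_mul, Module.End.mul_apply, twistedRight_gen1, twistedRight_gen1, map_smul, map_mul,
          parity_of_mem hn, sub_mul, zpow_sub₀ (by norm_num), one_mul]
        have h : ((-1 : ℂ) ^ q)⁻¹ = (-1 : ℂ) ^ q := by
          rw [← inv_zpow]; norm_num
        rw [div_eq_mul_inv, h]
        simp [iota, mul_assoc, mul_smul]

theorem iota_mem {p : ℤ} {m : StdComplex L} (hm : m ∈ deg L p) : iota m ∈ deg L p := by
  induction hm using Submodule.span_induction with
  | zero => rw [map_zero]; exact Submodule.zero_mem _
  | add a b _ _ ha hb => rw [map_add]; exact Submodule.add_mem _ ha hb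
  | smul c a _ ha => rw [map_smul]; exact Submodule.smul_mem _ c ha
  | mem x hx =>
    obtain ⟨l, rfl, rfl⟩ := hx
    induction l with
    | nil => simpa [wordDeg_nil] using one_mem
    | cons a l ih =>
      rcases a with X | ξ
      · rw [wordDeg_inl, List.map_cons, List.prod_cons]
        change twistedRight (gen0 X * _) 1 ∈ _
        rw [map_mul, Module.End.mul_apply, twistedRight_gen0]
        have h := mul_mem ih (gen0_mem X)
        rw [add_zero] at h
        exact Submodule.neg_mem _ h
      · rw [wordDeg_inr, List.map_cons, List.prod_cons]
        change twistedRight (gen1 ξ * _) 1 ∈ _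
        rw [map_mul, Module.End.mul_apply, twistedRight_gen1]
        have h := mul_mem ih (gen1_mem ξ)
        change -(parity (iota _) * _) ∈ _
        rw [parity_of_mem ih, smul_mul_assoc]
        exact Submodule.neg_mem _ (Submodule.smul_mem _ _ h)

theorem iota_mul {p q : ℤ} {m n : StdComplex L} (hm : m ∈ deg L p) (hn : n ∈ deg L q) :
    iota (m * n) = (-1 : ℂ) ^ (p * q) • (iota n * iota m) := by
  change twistedRight (m * n) 1 = _
  rw [map_mul, Module.End.mul_apply]
  exact twistedRight_apply hm (iota_mem hn)

section Map

variable {L' : Type t} [LieRing L'] [LieAlgebra ℂ L']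

/-- Functoriality of `N(L)` in `L`. -/
def map (φ : L →ₗ⁅ℂ⁆ L') : StdComplex L →ₐ[ℂ] StdComplex L' :=
  lift (gen0 ∘ₗ (φ : L →ₗ[ℂ] L')) (gen1 ∘ₗ (φ : L →ₗ[ℂ] L'))
    (by intro X Y; simpa using gen0_gen0 (φ X) (φ Y))
    (by intro X ξ; simpa using gen0_gen1 (φ X) (φ ξ))
    (by intro ξ η; simpa using gen1_gen1 (φ ξ) (φ η))

@[simp] theorem map_gen0 (φ : L →ₗ⁅ℂ⁆ L') (X : L) : map φ (gen0 X) = gen0 (φ X) := by simp [map]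

@[simp] theorem map_gen1 (φ : L →ₗ⁅ℂ⁆ L') (X : L) : map φ (gen1 X) = gen1 (φ X) := by simp [map]

theorem map_mem (φ : L →ₗ⁅ℂ⁆ L') {p : ℤ} {n : StdComplex L} (hn : n ∈ deg L p) :
    map φ n ∈ deg L' p := by
  induction hn using Submodule.span_induction with
  | zero => rw [map_zero]; exact Submodule.zero_mem _
  | add a b _ _ ha hb => rw [map_add]; exact Submodule.add_mem _ ha hb
  | smul c a _ ha => rw [map_smul]; exact Submodule.smul_mem _ c ha
  | mem x hx =>
    obtain ⟨l, rfl, rfl⟩ := hx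
    induction l with
    | nil => simpa [wordDeg_nil] using one_mem
    | cons a l ih =>
      rw [List.map_cons, List.prod_cons, map_mul]
      rcases a with X | ξ
      · rw [wordDeg_inl]
        simpa [gen] using mul_mem (gen0_mem (φ X)) ih
      · rw [wordDeg_inr, sub_eq_neg_add]
        simpa [gen] using mul_mem (gen1_mem (φ ξ)) ih

theorem map_parity (φ : L →ₗ⁅ℂ⁆ L') (n : StdComplex L) :
    map φ (parity n) = parity (map φ n) := by
  have h : (map φ).comp parity = parity.comp (map φ) := by
    apply hom_ext <;> intro X <;> simp
  exact DFunLike.congr_fun h n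

theorem map_diff (φ : L →ₗ⁅ℂ⁆ L') (n : StdComplex L) : map φ (diff n) = diff (map φ n) := by
  induction n using StdComplex.induction with
  | halg c => simp
  | h0 X => simp
  | h1 ξ => simp
  | hmul a b ha hb =>
    rw [diff_mul_parity, map_add, map_mul, map_mul, map_mul, diff_mul_parity, ha, hb, map_parity]
  | hadd a b ha hb => rw [map_add, map_add, map_add, map_add, ha, hb]

theorem map_comp_apply {L'' : Type*} [LieRing L''] [LieAlgebra ℂ L''] (χ : L' →ₗ⁅ℂ⁆ L'')
    (φ : L →ₗ⁅ℂ⁆ L') (n : StdComplex L) : map χ (map φ n) = map (χ.comp φ) n := by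
  have h : (map χ).comp (map φ) = map (χ.comp φ) := by
    apply hom_ext <;> intro X <;> simp
  exact DFunLike.congr_fun h n

end Map

end StdComplex

end StdComplex

/-! ### Harish-Chandra pairs and equivariant complexes -/

section Pair

variable {A : Type w} [Ring A] [Algebra ℂ A]
variable {K : Type u} [Group K] [AffineAlgebraicGroup K]
variable {T : Type t} [Group T] [AffineAlgebraicGroup T]

/-- An action by algebra automorphisms, as a representation. -/
def autRep (φ : K →* (A ≃ₐ[ℂ] A)) : Representation ℂ K A where
  toFun k := (φ k).toLinearMap
  map_one' := by rw [map_one]; rfl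
  map_mul' k k' := by rw [map_mul]; rfl

variable (A K) in
/-- A Harish-Chandra pair `(A, K)`. -/
structure HarishChandraPair where
  φ : K →* (A ≃ₐ[ℂ] A)
  φ_algebraic : IsAlgebraic (autRep φ)
  ψ : LieAlg K →ₗ[ℂ] A
  ψ_lie : ∀ X Y, ψ ⁅X, Y⁆ = ψ X * ψ Y - ψ Y * ψ X
  ψ_equivariant : ∀ k X, ψ (Ad k X) = φ k (ψ X)
  differential_φ : ∀ X a, differential (autRep φ) φ_algebraic X a = ψ X * a - a * ψ X

/-- The Harish-Chandra pair `(A, T)` obtained from `(A, K)` and a morphism `γ : T → K`, with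
`φ_T = φ_K ∘ γ` and `ψ_T = ψ_K ∘ dγ`. -/
def HarishChandraPair.restrict (P : HarishChandraPair A K) (γ : AlgGroupHom T K) :
    HarishChandraPair A T where
  φ := P.φ.comp γ.toHom
  φ_algebraic := P.φ_algebraic.comp γ
  ψ := P.ψ ∘ₗ (γ.lieMap : LieAlg T →ₗ[ℂ] LieAlg K)
  ψ_lie X Y := by simpa using P.ψ_lie (γ.lieMap X) (γ.lieMap Y)
  ψ_equivariant x X := by
    have h := LieHom.congr_fun (γ.lieMap_Ad x) X
    simp only [LieHom.comp_apply] at h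
    simp [h, P.ψ_equivariant]
  differential_φ X a := (differential_comp P.φ_algebraic γ X a).trans (P.differential_φ _ a)

/-- The action of `K` on `N(𝔨)` induced by the adjoint action. -/
def AdN (k : K) : StdComplex (LieAlg K) →ₐ[ℂ] StdComplex (LieAlg K) := StdComplex.map (Ad k)

/-- Equivariant `(A, K)`-complexes, i.e. `(A, K, N(𝔨))`-modules. A complex is given as the direct
sum of its components, with its grading and differential. -/
structure EqModule (P : HarishChandraPair A K) where
  carrier : Type v
  [addCommGroup : AddCommGroup carrier]
  [module : Module ℂ carrier]
  grade : ℤ → Submodule ℂ carrier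
  isInternal : DirectSum.IsInternal grade
  d : carrier →ₗ[ℂ] carrier
  d_mem : ∀ i, ∀ x ∈ grade i, d x ∈ grade (i + 1)
  d_d : ∀ x, d (d x) = 0
  /-- the action of `A` -/
  π : A →ₐ[ℂ] Module.End ℂ carrier
  /-- the action of `K` -/
  ν : Representation ℂ K carrier
  /-- the action of `N(𝔨)` -/
  ω : StdComplex (LieAlg K) →ₐ[ℂ] Module.End ℂ carrier
  π_mem : ∀ a i, ∀ x ∈ grade i, π a x ∈ grade i
  π_d : ∀ a x, π a (d x) = d (π a x)
  ν_mem : ∀ k i, ∀ x ∈ grade i, ν k x ∈ grade i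
  ν_d : ∀ k x, ν k (d x) = d (ν k x)
  ν_algebraic : IsAlgebraic ν
  ω_mem : ∀ p i, ∀ n ∈ StdComplex.deg (LieAlg K) p, ∀ x ∈ grade i, ω n x ∈ grade (p + i)
  ω_d : ∀ p, ∀ n ∈ StdComplex.deg (LieAlg K) p, ∀ x,
    d (ω n x) = ω (StdComplex.diff n) x + (-1 : ℂ) ^ p • ω n (d x)
  π_equivariant : ∀ k a x, π (P.φ k a) (ν k x) = ν k (π a x)
  ω_equivariant : ∀ k n x, ω (AdN k n) (ν k x) = ν k (ω n x)
  π_ω : ∀ a n x, π a (ω n x) = ω n (π a x)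
  π_add_ω : ∀ X x, π (P.ψ X) x + ω (StdComplex.gen0 X) x = differential ν ν_algebraic X x

attribute [instance] EqModule.addCommGroup EqModule.module

/-- Morphisms of `(A, K, N(𝔨))`-modules: chain maps which preserve all the actions. -/
@[ext]
structure EqModule.Hom {P : HarishChandraPair A K} (V W : EqModule.{u, w, v} P) where
  toLin : V.carrier →ₗ[ℂ] W.carrier
  map_mem : ∀ i, ∀ x ∈ V.grade i, toLin x ∈ W.grade i
  map_d : ∀ x, toLin (V.d x) = W.d (toLin x)
  map_π : ∀ a x, toLin (V.π a x) = W.π a (toLin x)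
  map_ν : ∀ k x, toLin (V.ν k x) = W.ν k (toLin x)
  map_ω : ∀ n x, toLin (V.ω n x) = W.ω n (toLin x)

/-- The category `M(A, K, N(𝔨))`. -/
instance (P : HarishChandraPair A K) : Category (EqModule.{u, w, v} P) where
  Hom V W := EqModule.Hom V W
  id V := ⟨LinearMap.id, fun _ _ h => h, fun _ => rfl, fun _ _ => rfl, fun _ _ => rfl,
    fun _ _ => rfl⟩
  comp f g := ⟨g.toLin ∘ₗ f.toLin,
    fun i x h => g.map_mem i _ (f.map_mem i x h),
    fun x => by simp [f.map_d, g.map_d],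
    fun a x => by simp [f.map_π, g.map_π],
    fun k x => by simp [f.map_ν, g.map_ν],
    fun n x => by simp [f.map_ω, g.map_ω]⟩

/-- The forgetful functor `M(A, K, N(𝔨)) ⥤ M(A, T, N(𝔱))` for `γ : T → K`: the `A`-action is kept,
the other actions are restricted along `γ` and along `N(𝔱) → N(𝔨)`. -/
def forgetEq (P : HarishChandraPair A K) (γ : AlgGroupHom T K) :
    EqModule.{u, w, v} P ⥤ EqModule.{t, w, v} (P.restrict γ) where
  obj V :=
    { carrier := V.carrier
      grade := V.grade
      isInternal := V.isInternal
      d := V.d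
      d_mem := V.d_mem
      d_d := V.d_d
      π := V.π
      ν := V.ν.comp γ.toHom
      ω := V.ω.comp (StdComplex.map γ.lieMap)
      π_mem := V.π_mem
      π_d := V.π_d
      ν_mem := fun x => V.ν_mem (γ.toHom x)
      ν_d := fun x => V.ν_d (γ.toHom x)
      ν_algebraic := V.ν_algebraic.comp γ
      ω_mem := fun p i n hn => V.ω_mem p i _ (StdComplex.map_mem γ.lieMap hn)
      ω_d := fun p n hn x => by
        have h := V.ω_d p _ (StdComplex.map_mem γ.lieMap hn) x
        rw [← StdComplex.map_diff] at h
        exact h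
      π_equivariant := fun x => V.π_equivariant (γ.toHom x)
      ω_equivariant := fun x n y => by
        have h := V.ω_equivariant (γ.toHom x) (StdComplex.map γ.lieMap n) y
        rw [AdN, StdComplex.map_comp_apply, ← γ.lieMap_Ad x, ← StdComplex.map_comp_apply] at h
        exact h
      π_ω := fun a n x => V.π_ω a _ x
      π_add_ω := fun X x => by
        rw [differential_comp V.ν_algebraic, ← V.π_add_ω]
        simp [HarishChandraPair.restrict] }
  map f := ⟨f.toLin, f.map_mem, f.map_d, f.map_π, fun x => f.map_ν (γ.toHom x),
    fun n => f.map_ω (StdComplex.map γ.lieMap n)⟩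

/-! ### The equivariant Zuckerman functor -/

section Zuckerman

variable (P : HarishChandraPair A K) (γ : AlgGroupHom T K)
variable (V : EqModule.{t, w, v} (P.restrict γ))

/-- The action `λ_𝔨` of `X ∈ 𝔨` on `F ∈ R(K, V)`, the tensor product of the left regular action
with the given action: `k ↦ π(X) F(k) + (d/ds) F (exp (-s X) k)` at `s = 0`. -/
def lamLie (X : LieAlg K) : RegFun K V.carrier →ₗ[ℂ] (K → V.carrier) where
  toFun F k := V.π (P.ψ X) ((F : K → V.carrier) k) - derivOne X (rightTrV k F)
  map_add' F G := by
    funext k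
    simp only [map_add, Submodule.coe_add, Pi.add_apply]
    abel
  map_smul' c F := by
    funext k
    simp only [map_smul, Submodule.coe_smul, Pi.smul_apply, RingHom.id_apply, smul_sub]

/-- The action `λ_T` of `T` on `R(K, V)`, the tensor product of the left regular action (via `γ`)
with the given action on `V`. -/
def lamGroup (x : T) : RegFun K V.carrier →ₗ[ℂ] (K → V.carrier) where
  toFun F k := V.ν x ((F : K → V.carrier) ((γ.toHom x)⁻¹ * k))
  map_add' F G := by
    funext k
    simp only [map_add, Submodule.coe_add, Pi.add_apply]
  map_smul' c F := by
    funext k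
    simp only [map_smul, Submodule.coe_smul, Pi.smul_apply, RingHom.id_apply]

/-- The action `λ_N` of `N(𝔱)` on `R(K, V)`, through the given action on `V`. -/
def lamN (m : StdComplex (LieAlg T)) : RegFun K V.carrier →ₗ[ℂ] (K → V.carrier) where
  toFun F k := V.ω m ((F : K → V.carrier) k)
  map_add' F G := by
    funext k
    simp only [map_add, Submodule.coe_add, Pi.add_apply]
  map_smul' c F := by
    funext k
    simp only [map_smul, Submodule.coe_smul, Pi.smul_apply, RingHom.id_apply]

/-- The action `ω_N(m) n = (-1) ^ (p * q) n ι(m)` of `m ∈ N^p(𝔱)` on `n ∈ N^q(𝔨)`. -/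
def omegaN (p q : ℤ) (m : StdComplex (LieAlg T)) (n : StdComplex (LieAlg K)) :
    StdComplex (LieAlg K) :=
  (-1 : ℂ) ^ (p * q) • (n * StdComplex.map γ.lieMap (StdComplex.iota m))

/-- `Hom^i_{(𝔨, T, N(𝔱))} (N(𝔨), R(K, V))`: the linear maps of degree `i` which commute with the
actions of `𝔨` (left multiplication on `N(𝔨)`) and of `T`, and which commute with the action of
`N(𝔱)` up to the usual sign. -/
def homDeg (i : ℤ) : Submodule ℂ (StdComplex (LieAlg K) →ₗ[ℂ] RegFun K V.carrier) where
  carrier := {f |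
    (∀ p, ∀ n ∈ StdComplex.deg (LieAlg K) p, ∀ k,
      (f n : K → V.carrier) k ∈ V.grade (p + i)) ∧
    (∀ X n, (f (StdComplex.gen0 X * n) : K → V.carrier) = lamLie P γ V X (f n)) ∧
    (∀ x n, (f (AdN (γ.toHom x) n) : K → V.carrier) = lamGroup P γ V x (f n)) ∧
    (∀ p, ∀ m ∈ StdComplex.deg (LieAlg T) p, ∀ q, ∀ n ∈ StdComplex.deg (LieAlg K) q,
      (f (omegaN γ p q m n) : K → V.carrier) = (-1 : ℂ) ^ (i * p) • lamN P γ V m (f n))}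
  zero_mem' := by
    refine ⟨fun p n _ k => Submodule.zero_mem _, fun X n => ?_, fun x n => ?_,
      fun p m _ q n _ => ?_⟩ <;> simp
  add_mem' := by
    rintro f g ⟨f1, f2, f3, f4⟩ ⟨g1, g2, g3, g4⟩
    refine ⟨fun p n hn k => Submodule.add_mem _ (f1 p n hn k) (g1 p n hn k), fun X n => ?_,
      fun x n => ?_, fun p m hm q n hn => ?_⟩
    · rw [LinearMap.add_apply, LinearMap.add_apply, map_add, Submodule.coe_add, f2, g2]
    · rw [LinearMap.add_apply, LinearMap.add_apply, map_add, Submodule.coe_add, f3, g3]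
    · rw [LinearMap.add_apply, LinearMap.add_apply, map_add, Submodule.coe_add, f4 p m hm q n hn,
        g4 p m hm q n hn, smul_add]
  smul_mem' := by
    rintro c f ⟨f1, f2, f3, f4⟩
    refine ⟨fun p n hn k => Submodule.smul_mem _ c (f1 p n hn k), fun X n => ?_,
      fun x n => ?_, fun p m hm q n hn => ?_⟩
    · rw [LinearMap.smul_apply, LinearMap.smul_apply, map_smul, Submodule.coe_smul, f2]
    · rw [LinearMap.smul_apply, LinearMap.smul_apply, map_smul, Submodule.coe_smul, f3]
    · rw [LinearMap.smul_apply, LinearMap.smul_apply, map_smul, Submodule.coe_smul,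
        f4 p m hm q n hn, smul_comm]

/-- The complex `Γ^eq(V) = Hom^·_{(𝔨, T, N(𝔱))} (N(𝔨), R(K, V))`, as the (direct) sum of its
components. -/
def homComplex : Submodule ℂ (StdComplex (LieAlg K) →ₗ[ℂ] RegFun K V.carrier) :=
  ⨆ i, homDeg P γ V i

/-- The value `f(n)(k)` for an element `f` of the complex. -/
def homEval (f : homComplex P γ V) (n : StdComplex (LieAlg K)) (k : K) : V.carrier :=
  (f.1 n : K → V.carrier) k

end Zuckerman

/-- The functor `Γ : M(A, T, N(𝔱)) ⥤ M(A, K, N(𝔨))` is the equivariant Zuckerman functor: through the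
identifications `e`, the object `Γ(V)` is the complex `Hom^·_{(𝔨, T, N(𝔱))} (N(𝔨), R(K, V))` with
its grading and its differential `f ↦ d ∘ f - (-1) ^ (deg f) f ∘ d`, the actions are
* `(π(a) f)(n)(k) = π_V(φ(k) a) (f(n)(k))`,
* `(ν(g) f)(n)(k) = f(n)(k g)`,
* `(ω(n) f)(m)(k) = (-1) ^ (deg n * deg f) f(Ad(k)(ι n) m)(k)`,
and `(Γ(α) f)(n)(k) = α(f(n)(k))` for morphisms `α`. -/
structure IsEquivariantZuckerman (P : HarishChandraPair A K) (γ : AlgGroupHom T K)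
    (Γ : EqModule.{t, w, max u v} (P.restrict γ) ⥤ EqModule.{u, w, max u v} P)
    (e : ∀ V, (Γ.obj V).carrier ≃ₗ[ℂ] homComplex P γ V) : Prop where
  grade_iff : ∀ V i f, f ∈ (Γ.obj V).grade i ↔ (e V f).1 ∈ homDeg P γ V i
  d_apply : ∀ V i, ∀ f ∈ (Γ.obj V).grade i, ∀ n k,
    homEval P γ V (e V ((Γ.obj V).d f)) n k =
      V.d (homEval P γ V (e V f) n k) -
        (-1 : ℂ) ^ i • homEval P γ V (e V f) (StdComplex.diff n) k
  π_apply : ∀ V a f n k,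
    homEval P γ V (e V ((Γ.obj V).π a f)) n k = V.π (P.φ k a) (homEval P γ V (e V f) n k)
  ν_apply : ∀ V g f n k,
    homEval P γ V (e V ((Γ.obj V).ν g f)) n k = homEval P γ V (e V f) n (k * g)
  ω_apply : ∀ V p, ∀ n ∈ StdComplex.deg (LieAlg K) p, ∀ i, ∀ f ∈ (Γ.obj V).grade i, ∀ m k,
    homEval P γ V (e V ((Γ.obj V).ω n f)) m k =
      (-1 : ℂ) ^ (p * i) • homEval P γ V (e V f) (AdN k (StdComplex.iota n) * m) k
  map_apply : ∀ (V W : EqModule.{t, w, max u v} (P.restrict γ)) (α : V ⟶ W) f n k,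
    homEval P γ W (e W ((Γ.map α).toLin f)) n k = α.toLin (homEval P γ V (e V f) n k)

end Pair

end EqZuckerman

end

open EqZuckerman

noncomputable section

namespace EqZuckerman

/-! ### Calculus of vector valued regular functions -/

section Calculus

variable {K : Type u} [Group K] [AffineAlgebraicGroup K]
variable {U V W : Type*} [AddCommGroup U] [Module ℂ U] [AddCommGroup V] [Module ℂ V]
  [AddCommGroup W] [Module ℂ W]

/-! An element `f` of the Zuckerman complex is a function of `n ∈ N(𝔨)` and `k ∈ K`, and both
variables can be moved to the base point `(1, 1)`. With the actions defined on the complex, the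
value at `(1, 1)` of `ω(ι n) ν(k) f` is, up to the Koszul sign, `f(ι ι n)(k) = f(n)(k)`. So `f` is
recovered from the counit together with the actions of `K` and `N(𝔨)`. This is one triangle
identity, and the formula for the unit is forced by it. The other triangle identity says that the
unit takes the value `v` at `(1, 1)`.

What remains is that the objects and maps lie in the right categories. Three points carry this.

Equivariance under `𝔨`. The condition on `f` says that the derivative of `x ↦ f(n)(x k)` along `X`
is `π(ψ X) f(n)(k) - f(X n)(k)`. The operators involve `k` twice, as the evaluation point and inside
`φ(k) a` or `Ad(k) n`, so their derivatives follow from one product rule for diagonal restrictions,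
`HasDerivOne.diagonal`. The inner derivatives are the commutators with `ψ X` in `A` and with `X` in
`N(𝔨)` (`hasDerivOne_AdN`, which rests on `hasDerivOne_Ad`).

The relation `π ∘ ψ + ω = dν`. The group acts by right translation, while equivariance concerns left
translation. `hasDerivOne_leftTr` exchanges the two at the cost of `Ad k`, which is exactly the
twist built into `π` and `ω` (`algAct_add_stdAct`).

Algebraicity of `ν`. A space of maps out of the infinite dimensional `N(𝔨)` is not obviously a union
of finite dimensional representations. But `N(𝔨)` is generated over the degree zero part by its
finite dimensional exterior part, and `f(X n)` is determined by `f(n)`. Hence the complex embeds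
equivariantly into a finite power of `R(K, V)` (`groupAct_isAlgebraic`). -/

theorem regFun_induction {C : (K → V) → Prop} (hadd : ∀ F G, C F → C G → C (F + G))
    (hsmul : ∀ (f : Reg K) (x : V), C fun k => f k • x) {F : K → V} (hF : F ∈ RegFun K V) : C F := by
  obtain ⟨z, rfl⟩ := hF
  induction z using TensorProduct.induction_on with
  | zero =>
    have : evalTensor K V 0 = fun k => (0 : Reg K) k • (0 : V) := by funext k; simp
    rw [this]
    exact hsmul 0 0
  | tmul f x =>
    have : evalTensor K V (f ⊗ₜ x) = fun k => f k • x := by funext k; simp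
    rw [this]
    exact hsmul f x
  | add a b ha hb => rw [map_add]; exact hadd _ _ ha hb

/-- The function `F : K → V` is regular and its derivative at `1` along `X` is `x`. -/
def HasDerivOne (X : LieAlg K) (F : K → V) (x : V) : Prop :=
  ∃ h : F ∈ RegFun K V, derivOne X ⟨F, h⟩ = x

theorem hasDerivOne (X : LieAlg K) (F : RegFun K V) : HasDerivOne X (F : K → V) (derivOne X F) :=
  ⟨F.2, rfl⟩

theorem HasDerivOne.mem {X : LieAlg K} {F : K → V} {x : V} (h : HasDerivOne X F x) :
    F ∈ RegFun K V := h.1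

theorem HasDerivOne.unique {X : LieAlg K} {F : K → V} {x y : V} (hx : HasDerivOne X F x)
    (hy : HasDerivOne X F y) : x = y := by
  obtain ⟨_, rfl⟩ := hx
  obtain ⟨_, rfl⟩ := hy
  rfl

theorem hasDerivOne_smul (X : LieAlg K) (f : Reg K) (x : V) :
    HasDerivOne X (fun k => f k • x) ((X.1 f) 1 • x) := by
  refine ⟨smul_mem_regFun f.mem x, ?_⟩
  have h : (⟨fun k => f k • x, smul_mem_regFun f.mem x⟩ : RegFun K V) = regEquiv K V (f ⊗ₜ x) :=
    Subtype.ext (funext fun k => by rw [regEquiv_apply, evalTensor_tmul])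
  rw [h, derivOne_regEquiv]
  simp

theorem HasDerivOne.add {X : LieAlg K} {F G : K → V} {x y : V} (hF : HasDerivOne X F x)
    (hG : HasDerivOne X G y) : HasDerivOne X (fun k => F k + G k) (x + y) := by
  obtain ⟨hF, rfl⟩ := hF
  obtain ⟨hG, rfl⟩ := hG
  exact ⟨Submodule.add_mem _ hF hG, map_add (derivOne X) ⟨F, hF⟩ ⟨G, hG⟩⟩

theorem HasDerivOne.smul {X : LieAlg K} {F : K → V} {x : V} (c : ℂ) (hF : HasDerivOne X F x) :
    HasDerivOne X (fun k => c • F k) (c • x) := by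
  obtain ⟨hF, rfl⟩ := hF
  exact ⟨Submodule.smul_mem _ c hF, map_smul (derivOne X) c ⟨F, hF⟩⟩

theorem HasDerivOne.sub {X : LieAlg K} {F G : K → V} {x y : V} (hF : HasDerivOne X F x)
    (hG : HasDerivOne X G y) : HasDerivOne X (fun k => F k - G k) (x - y) := by
  obtain ⟨hF, rfl⟩ := hF
  obtain ⟨hG, rfl⟩ := hG
  exact ⟨Submodule.sub_mem _ hF hG, map_sub (derivOne X) ⟨F, hF⟩ ⟨G, hG⟩⟩

theorem const_mem_regFun (x : V) : (fun _ : K => x) ∈ RegFun K V := by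
  simpa using smul_mem_regFun (Reg.mem (1 : Reg K)) x

theorem hasDerivOne_const (X : LieAlg K) (x : V) : HasDerivOne X (fun _ => x) 0 := by
  simpa using hasDerivOne_smul X 1 x

theorem HasDerivOne.reg_smul {X : LieAlg K} {F : K → V} {x : V} (hF : HasDerivOne X F x)
    (f : Reg K) : HasDerivOne X (fun k => f k • F k) (f 1 • x + (X.1 f) 1 • F 1) := by
  -- The induction runs over `F`, so its derivative cannot stay fixed. It is quantified
  -- existentially and identified afterwards by uniqueness.
  suffices H : ∃ y, HasDerivOne X F y ∧
      HasDerivOne X (fun k => f k • F k) (f 1 • y + (X.1 f) 1 • F 1) by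
    obtain ⟨y, hy, h⟩ := H
    rwa [hF.unique hy]
  refine regFun_induction (C := fun F => ∃ y, HasDerivOne X F y ∧
      HasDerivOne X (fun k => f k • F k) (f 1 • y + (X.1 f) 1 • F 1)) ?_ ?_ hF.mem
  · rintro F G ⟨y, hy, h⟩ ⟨z, hz, h'⟩
    refine ⟨y + z, hy.add hz, ?_⟩
    convert h.add h' using 1
    · funext k; exact smul_add _ _ _
    · rw [Pi.add_apply, smul_add, smul_add]; abel
  · intro g x
    refine ⟨_, hasDerivOne_smul X g x, ?_⟩
    convert hasDerivOne_smul X (f * g) x using 1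
    · funext k; rw [smul_smul, Reg.mul_apply]
    · rw [Derivation.leibniz, Reg.add_apply, smul_smul, smul_smul, ← add_smul]
      simp [mul_comm]

/-- The Leibniz rule for the diagonal restriction of a regular family of regular functions. -/
theorem HasDerivOne.diagonal {X : LieAlg K} {F : K → U} {x : U} (hF : HasDerivOne X F x)
    (f : U →ₗ[ℂ] RegFun K V) :
    HasDerivOne X (fun k => (f (F k) : K → V) k) ((f x : K → V) 1 + derivOne X (f (F 1))) := by
  suffices H : ∃ y, HasDerivOne X F y ∧
      HasDerivOne X (fun k => (f (F k) : K → V) k) ((f y : K → V) 1 + derivOne X (f (F 1))) by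
    obtain ⟨y, hy, h⟩ := H
    rwa [hF.unique hy]
  refine regFun_induction (C := fun F => ∃ y, HasDerivOne X F y ∧
      HasDerivOne X (fun k => (f (F k) : K → V) k) ((f y : K → V) 1 + derivOne X (f (F 1))))
    ?_ ?_ hF.mem
  · rintro F G ⟨y, hy, h⟩ ⟨z, hz, h'⟩
    refine ⟨y + z, hy.add hz, ?_⟩
    convert h.add h' using 1
    · funext k; simp
    · simp; abel
  · intro g x
    refine ⟨_, hasDerivOne_smul X g x, ?_⟩
    -- For `F = g • x` the diagonal is `k ↦ g(k) (f x)(k)`, and the scalar product rule applies.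
    convert (hasDerivOne X (f x)).reg_smul g using 1
    · funext k; simp
    · simp; abel

/-- Case of `HasDerivOne.diagonal` in which the family consists of constant functions, so that its
second term vanishes. -/
theorem HasDerivOne.linear_comp {X : LieAlg K} {F : K → V} {x : V} (hF : HasDerivOne X F x)
    (L : V →ₗ[ℂ] W) : HasDerivOne X (fun k => L (F k)) (L x) := by
  let f : V →ₗ[ℂ] RegFun K W :=
    { toFun := fun v => ⟨fun _ => L v, const_mem_regFun (L v)⟩
      map_add' := fun v v' => Subtype.ext (funext fun _ => map_add L v v')
      map_smul' := fun c v => Subtype.ext (funext fun _ => map_smul L c v) }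
  have h := hF.diagonal f
  rw [(hasDerivOne X (f (F 1))).unique (hasDerivOne_const X (L (F 1))), add_zero] at h
  exact h

/-- Case of `HasDerivOne.diagonal` for the family `u ↦ B u (G ·)`. -/
theorem HasDerivOne.bilinear_comp {X : LieAlg K} {F : K → U} {G : K → V} {x : U} {y : V}
    (hF : HasDerivOne X F x) (hG : HasDerivOne X G y) (B : U →ₗ[ℂ] V →ₗ[ℂ] W) :
    HasDerivOne X (fun k => B (F k) (G k)) (B x (G 1) + B (F 1) y) := by
  let f : U →ₗ[ℂ] RegFun K W :=
    { toFun := fun u => ⟨fun k => B u (G k), (hG.linear_comp (B u)).mem⟩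
      map_add' := fun v v' => Subtype.ext (funext fun _ => by simp)
      map_smul' := fun c v => Subtype.ext (funext fun _ => by simp) }
  have h := hF.diagonal f
  rw [(hasDerivOne X (f (F 1))).unique (hG.linear_comp (B (F 1)))] at h
  exact h

theorem linear_comp_mem_regFun (L : V →ₗ[ℂ] W) {F : K → V} (hF : F ∈ RegFun K V) :
    (fun k => L (F k)) ∈ RegFun K W :=
  ((hasDerivOne 0 ⟨F, hF⟩).linear_comp L).mem

theorem bilinear_comp_mem_regFun (B : U →ₗ[ℂ] V →ₗ[ℂ] W) {F : K → U} {G : K → V}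
    (hF : F ∈ RegFun K U) (hG : G ∈ RegFun K V) : (fun k => B (F k) (G k)) ∈ RegFun K W :=
  ((hasDerivOne 0 ⟨F, hF⟩).bilinear_comp (hasDerivOne 0 ⟨G, hG⟩) B).mem

theorem diagonal_mem_regFun {F : K → U} (hF : F ∈ RegFun K U) (f : U →ₗ[ℂ] RegFun K V) :
    (fun k => (f (F k) : K → V) k) ∈ RegFun K V :=
  ((hasDerivOne 0 ⟨F, hF⟩).diagonal f).mem

/-- Over a field an injective linear map has a linear left inverse, and composition with it
preserves regularity. Regularity can thus be tested after any linear embedding of the target. -/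
theorem mem_regFun_of_injective {j : V →ₗ[ℂ] W} (hj : Function.Injective j) {F : K → V}
    (hF : (fun k => j (F k)) ∈ RegFun K W) : F ∈ RegFun K V := by
  obtain ⟨p, hp⟩ := j.exists_leftInverse_of_injective (LinearMap.ker_eq_bot.2 hj)
  have h := linear_comp_mem_regFun p hF
  simpa only [← LinearMap.comp_apply, hp, LinearMap.id_apply] using h

theorem HasDerivOne.of_injective {X : LieAlg K} {j : V →ₗ[ℂ] W} (hj : Function.Injective j)
    {F : K → V} {x : V} (hF : HasDerivOne X (fun k => j (F k)) (j x)) : HasDerivOne X F x := by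
  have h := mem_regFun_of_injective hj hF.mem
  have h' : derivOne X ⟨F, h⟩ = x := hj (((hasDerivOne X ⟨F, h⟩).linear_comp j).unique hF)
  exact ⟨h, h'⟩

theorem pi_mem_regFun {ι : Type*} [Finite ι] {Z : ι → Type*} [∀ i, AddCommGroup (Z i)]
    [∀ i, Module ℂ (Z i)] {F : K → ∀ i, Z i} (hF : ∀ i, (fun k => F k i) ∈ RegFun K (Z i)) :
    F ∈ RegFun K (∀ i, Z i) := by
  classical
  have := Fintype.ofFinite ι
  have h : F = ∑ i, fun k => LinearMap.single ℂ Z i (F k i) := by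
    funext k
    rw [Finset.sum_apply]
    exact (Finset.univ_sum_single (F k)).symm
  rw [h]
  exact Submodule.sum_mem _ fun i _ => linear_comp_mem_regFun _ (hF i)

theorem HasDerivOne.pi {ι : Type*} [Finite ι] {Z : ι → Type*} [∀ i, AddCommGroup (Z i)]
    [∀ i, Module ℂ (Z i)] {X : LieAlg K} {F : K → ∀ i, Z i} {x : ∀ i, Z i}
    (hF : ∀ i, HasDerivOne X (fun k => F k i) (x i)) : HasDerivOne X F x := by
  refine ⟨pi_mem_regFun fun i => (hF i).mem, funext fun i => ?_⟩
  exact ((hasDerivOne X ⟨F, _⟩).linear_comp (LinearMap.proj i)).unique (hF i)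

theorem mem_regFun_scalar {f : K → ℂ} : f ∈ RegFun K ℂ ↔ f ∈ regularFns K := by
  constructor
  · intro h
    refine regFun_induction (C := fun f => f ∈ regularFns K) ?_ ?_ h
    · exact fun F G hF hG => Subalgebra.add_mem _ hF hG
    · intro f x
      have : (fun k => f k • x) = x • (f : K → ℂ) := by funext k; simp [mul_comm]
      rw [this]
      exact Subalgebra.smul_mem _ f.mem x
  · intro h
    simpa using smul_mem_regFun h (1 : ℂ)

theorem hasDerivOne_scalar (X : LieAlg K) (f : Reg K) : HasDerivOne X (f : K → ℂ) ((X.1 f) 1) := by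
  simpa using hasDerivOne_smul X f (1 : ℂ)

/-- A representation with regular orbit maps is algebraic. -/
theorem isAlgebraic_of_orbit_mem {ν : Representation ℂ K V}
    (h : ∀ x, (fun k => ν k x) ∈ RegFun K V) : IsAlgebraic ν := by
  intro x
  refine ⟨Submodule.span ℂ (Set.range fun k => ν k x), ?_, ?_, ?_, ?_⟩
  · exact Submodule.subset_span ⟨1, by simp⟩
  -- The values of a regular function lie in a finite dimensional subspace: a line for `f • y`, and
  -- the sum of two such subspaces for a sum.
  · suffices H : ∃ S : Submodule ℂ V, FiniteDimensional ℂ S ∧ ∀ k, ν k x ∈ S by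
      obtain ⟨S, hS, hk⟩ := H
      exact Submodule.finiteDimensional_of_le (S₂ := S)
        (Submodule.span_le.2 (by rintro _ ⟨k, rfl⟩; exact hk k))
    refine regFun_induction (C := fun F : K → V => ∃ S : Submodule ℂ V, FiniteDimensional ℂ S ∧
      ∀ k, F k ∈ S) ?_ ?_ (h x)
    · rintro F G ⟨S, _, hF⟩ ⟨S', _, hG⟩
      exact ⟨S ⊔ S', inferInstance, fun k => Submodule.add_mem_sup (hF k) (hG k)⟩
    · intro f y
      exact ⟨Submodule.span ℂ {y}, inferInstance,
        fun k => Submodule.smul_mem _ _ (Submodule.mem_span_singleton_self y)⟩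
  · intro k y hy
    induction hy using Submodule.span_induction with
    | zero => rw [map_zero]; exact Submodule.zero_mem _
    | add a b _ _ ha hb => rw [map_add]; exact Submodule.add_mem _ ha hb
    | smul c a _ ha => rw [map_smul]; exact Submodule.smul_mem _ c ha
    | mem z hz =>
      obtain ⟨g, rfl⟩ := hz
      exact Submodule.subset_span ⟨k * g, by simp⟩
  · exact fun y _ l => mem_regFun_scalar.1 (linear_comp_mem_regFun l (h y))

/-- The orbit maps of right translation on `R(K, V)` are regular. -/
theorem rightTrV_orbit_mem (F : RegFun K V) :
    (fun g => rightTrV g F) ∈ RegFun K (RegFun K V) := by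
  apply mem_regFun_of_injective (j := (RegFun K V).subtype) Subtype.val_injective
  refine regFun_induction (C := fun F : K → V =>
    (fun g => (fun x => F (x * g) : K → V)) ∈ RegFun K (K → V)) ?_ ?_ F.2
  · exact fun F G hF hG => Submodule.add_mem _ hF hG
  · intro f x
    -- Regularity of multiplication writes `f(y g)` as a finite sum of products `g₁(y) g₂(g)`. Each
    -- term is a regular function of `g` times a fixed function of `y`.
    suffices H : ∀ h ∈ Submodule.span ℂ {h : K × K → ℂ | ∃ g₁ ∈ regularFns K,
        ∃ g₂ ∈ regularFns K, h = fun p => g₁ p.1 * g₂ p.2},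
        (fun g => (fun y => h (y, g) • x : K → V)) ∈ RegFun K (K → V) from
      H _ (AffineAlgebraicGroup.mul_regular f f.mem)
    intro h hh
    induction hh using Submodule.span_induction with
    | mem h hh =>
      obtain ⟨g₁, h₁, g₂, h₂, rfl⟩ := hh
      have : (fun g => (fun y => (g₁ y * g₂ g) • x : K → V)) =
          fun g => g₂ g • (fun y => g₁ y • x : K → V) := by
        funext g y
        simp [smul_smul, mul_comm]
      rw [this]
      exact smul_mem_regFun h₂ _
    | zero =>
      simp only [Pi.zero_apply, zero_smul]
      exact const_mem_regFun (0 : K → V)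
    | add h₁ h₂ _ _ i₁ i₂ =>
      simp only [Pi.add_apply, add_smul]
      exact Submodule.add_mem _ i₁ i₂
    | smul c h _ i =>
      simp only [Pi.smul_apply, smul_assoc]
      exact Submodule.smul_mem _ c i

/-- Differentiation in left translates along `X` is differentiation in right translates along
`Ad k X`. -/
theorem hasDerivOne_leftTr (X : LieAlg K) (k : K) (F : RegFun K V) :
    HasDerivOne X (fun x => (F : K → V) (k * x)) (derivOne (Ad k X) (rightTrV k F)) := by
  have h : ∃ y, HasDerivOne X (fun x => (F : K → V) (k * x)) y ∧
      HasDerivOne (Ad k X) (fun x => (F : K → V) (x * k)) y := by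
    refine regFun_induction (C := fun F : K → V => ∃ y, HasDerivOne X (fun x => F (k * x)) y ∧
      HasDerivOne (Ad k X) (fun x => F (x * k)) y) ?_ ?_ F.2
    · rintro F G ⟨y, hy, h⟩ ⟨z, hz, h'⟩
      exact ⟨y + z, hy.add hz, h.add h'⟩
    · intro f x
      refine ⟨_, hasDerivOne_smul X (leftTr k f) x, ?_⟩
      -- Conjugation by right translations gives `(Ad k X)(rightTr k f) = rightTr k (X f)`, whose
      -- value at `1` is `(X f)(k)`. By left invariance this is also the value at `1` of `X` on the
      -- left translate.
      have e : ((Ad k X).1 (rightTr k f)) 1 = (X.1 (leftTr k f)) 1 := by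
        rw [Ad_apply, X.leftTr, leftTr_apply, rightTr_apply, mul_one, one_mul]
        congr 2
        apply reg_ext; intro y; simp
      have h := hasDerivOne_smul (Ad k X) (rightTr k f) x
      rw [e] at h
      exact h
  obtain ⟨y, hy, h⟩ := h
  rwa [(hasDerivOne (Ad k X) (rightTrV k F)).unique h]

end Calculus

/-! ### The adjoint representation -/

section Adjoint

variable {K : Type u} [Group K] [AffineAlgebraicGroup K]
variable {V : Type*} [AddCommGroup V] [Module ℂ V]

/-- The values at `1` of the derivatives of the functions in `s`. -/
def tangentCoord (s : Set (Reg K)) : LieAlg K →ₗ[ℂ] (s → ℂ) where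
  toFun X f := (X.1 f.1) 1
  map_add' _ _ := rfl
  map_smul' _ _ := rfl

/-- By the Leibniz rule a tangent vector at `1` is determined on algebra generators, and left
invariance recovers the derivation from its value at `1`. -/
theorem tangentCoord_injective {s : Set (Reg K)} (hs : Algebra.adjoin ℂ s = ⊤) :
    Function.Injective (tangentCoord s) := by
  intro X Y h
  apply LieAlg.ext_one
  intro f
  have hf : f ∈ Algebra.adjoin ℂ s := hs ▸ Algebra.mem_top
  induction hf using Algebra.adjoin_induction with
  | mem f hf => exact congrFun h ⟨f, hf⟩
  | algebraMap c => simp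
  | add f g _ _ hf hg => simp [hf, hg]
  | mul f g _ _ hf hg => simp [hf, hg]

variable (K) in
theorem exists_finset_adjoin : ∃ s : Finset (Reg K), Algebra.adjoin ℂ (s : Set (Reg K)) = ⊤ :=
  (AffineAlgebraicGroup.finiteType (K := K)).out

/-- The coordinate ring has finitely many generators, so tangent coordinates embed the Lie algebra
in a finite dimensional space. The algebraicity of the Zuckerman complex depends on this. -/
instance : FiniteDimensional ℂ (LieAlg K) := by
  obtain ⟨s, hs⟩ := exists_finset_adjoin K
  exact FiniteDimensional.of_injective _ (tangentCoord_injective hs)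

theorem inv_mem_regFun {F : K → V} (hF : F ∈ RegFun K V) : (fun k => F k⁻¹) ∈ RegFun K V := by
  refine regFun_induction (C := fun F : K → V => (fun k => F k⁻¹) ∈ RegFun K V) ?_ ?_ hF
  · exact fun F G hF hG => Submodule.add_mem _ hF hG
  · exact fun f x => smul_mem_regFun (AffineAlgebraicGroup.inv_regular _ f.mem) x

/-- Regular functions as scalar valued elements of `R(K, ℂ)`. -/
def regToRegFun : Reg K →ₗ[ℂ] RegFun K ℂ where
  toFun f := ⟨f, mem_regFun_scalar.2 f.mem⟩
  map_add' _ _ := rfl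
  map_smul' _ _ := rfl

@[simp] theorem regToRegFun_apply (f : Reg K) (k : K) : (regToRegFun f : K → ℂ) k = f k := rfl

theorem derivOne_regToRegFun (X : LieAlg K) (f : Reg K) :
    derivOne X (regToRegFun f) = (X.1 f) 1 :=
  (hasDerivOne X _).unique (hasDerivOne_scalar X f)

/-- Through the embedding of `R(K)` in `R(K, ℂ)` this is the statement on right translations of
vector valued functions. -/
theorem rightTr_orbit_mem (f : Reg K) : (fun k => rightTr k f) ∈ RegFun K (Reg K) :=
  mem_regFun_of_injective (j := regToRegFun)
    (fun _ _ h => reg_ext fun k => congrFun (congrArg Subtype.val h) k)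
    (rightTrV_orbit_mem (regToRegFun f))

/-- The function `k ↦ f(x k k⁻¹)` is constant. The product rule for its two occurrences of `k` shows
that the unknown derivative, evaluated at `x`, plus `(X f)(x)` is zero. -/
theorem hasDerivOne_rightTr_inv (X : LieAlg K) (f : Reg K) :
    HasDerivOne X (fun k => rightTr k⁻¹ f) (-(X.1 f)) := by
  refine ⟨inv_mem_regFun (rightTr_orbit_mem f), reg_ext fun x => ?_⟩
  have h := (hasDerivOne X ⟨_, inv_mem_regFun (rightTr_orbit_mem f)⟩).linear_comp
    (leftTr x).toLinearMap
  have h₁ := h.diagonal regToRegFun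
  have h₂ : HasDerivOne X (fun _ : K => f x) 0 := hasDerivOne_const X _
  have h₃ := h₁.unique (by simpa using h₂)
  rw [derivOne_regToRegFun] at h₃
  simp only [AlgHom.toLinearMap_apply, regToRegFun_apply, leftTr_apply, mul_one, inv_one,
    X.leftTr] at h₃
  have h₄ : rightTr (1 : K) f = f := by
    apply reg_ext; intro y; simp
  rw [h₄] at h₃
  change _ = -((X.1 f) x)
  linear_combination h₃

theorem Ad_one : Ad (1 : K) = LieHom.id := by
  ext X : 1
  apply LieAlg.ext_one
  intro f
  rw [Ad_apply_one]
  congr 2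
  apply reg_ext; intro y; simp

theorem Ad_mul (g h : K) : Ad (g * h) = (Ad g).comp (Ad h) := by
  ext X : 1
  apply LieAlg.ext_one
  intro f
  rw [LieHom.comp_apply, Ad_apply_one, Ad_apply_one, Ad_apply_one]
  congr 2
  apply reg_ext; intro y; simp [mul_assoc]

/-- The differential of `Ad` is `ad`. The tangent vector of `Ad k Y` on `f` is `Y(rightTr k⁻¹ f)`
evaluated at `k`. Differentiating the inner `k` gives `-Y X f`, differentiating the evaluation point
gives `X Y f`, both at `1`. Finitely many `f` suffice, namely generators of the coordinate ring. -/
theorem hasDerivOne_Ad (X Y : LieAlg K) : HasDerivOne X (fun k => Ad k Y) ⁅X, Y⁆ := by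
  obtain ⟨s, hs⟩ := exists_finset_adjoin K
  refine HasDerivOne.of_injective (tangentCoord_injective hs) (HasDerivOne.pi fun f => ?_)
  have h := (hasDerivOne_rightTr_inv X f.1).diagonal
    (regToRegFun ∘ₗ (Y.1 : Reg K →ₗ[ℂ] Reg K))
  simp only [LinearMap.comp_apply, derivOne_regToRegFun] at h
  convert h using 1
  · funext k
    change ((Ad k Y).1 f.1) 1 = (Y.1 (rightTr k⁻¹ f.1)) k
    rw [Ad_apply, rightTr_apply, one_mul]
  · have h₄ : rightTr (1 : K)⁻¹ f.1 = f.1 := by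
      apply reg_ext; intro y; simp
    rw [h₄]
    change ((⁅X.1, Y.1⁆ : Derivation ℂ (Reg K) (Reg K)) f.1) 1 = (Y.1 (-(X.1 f.1))) 1 + _
    rw [Derivation.commutator_apply, map_neg, Reg.sub_apply]
    change _ = -((Y.1 (X.1 f.1)) 1) + (X.1 (Y.1 f.1)) 1
    ring

theorem AdN_one (n : StdComplex (LieAlg K)) : AdN 1 n = n := by
  rw [AdN, Ad_one]
  have h : StdComplex.map LieHom.id = AlgHom.id ℂ (StdComplex (LieAlg K)) := by
    apply StdComplex.hom_ext <;> intro X <;> simp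
  rw [h, AlgHom.id_apply]

theorem AdN_mul (g h : K) (n : StdComplex (LieAlg K)) : AdN (g * h) n = AdN g (AdN h n) := by
  rw [AdN, AdN, AdN, StdComplex.map_comp_apply, Ad_mul]

/-- The differential of the adjoint action on `N(𝔨)` is the commutator. -/
theorem hasDerivOne_AdN (X : LieAlg K) (n : StdComplex (LieAlg K)) :
    HasDerivOne X (fun k => AdN k n)
      (StdComplex.gen0 X * n - n * StdComplex.gen0 X) := by
  induction n using StdComplex.induction with
  | halg c =>
    simp only [AlgHom.commutes, Algebra.commutes, sub_self]
    exact hasDerivOne_const X _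
  | h0 Y =>
    convert (hasDerivOne_Ad X Y).linear_comp StdComplex.gen0 using 1
    · funext k; simp [AdN]
    · rw [StdComplex.gen0_gen0]; abel
  | h1 Y =>
    convert (hasDerivOne_Ad X Y).linear_comp StdComplex.gen1 using 1
    · funext k; simp [AdN]
    · rw [StdComplex.gen0_gen1]; abel
  | hmul a b ha hb =>
    convert ha.bilinear_comp hb (LinearMap.mul ℂ _) using 1
    · funext k; simp
    · simp only [AdN_one, LinearMap.mul_apply']; noncomm_ring
  | hadd a b ha hb =>
    convert ha.add hb using 1
    · funext k; simp
    · noncomm_ring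

theorem AdN_orbit_mem (n : StdComplex (LieAlg K)) :
    (fun k => AdN k n) ∈ RegFun K (StdComplex (LieAlg K)) := (hasDerivOne_AdN 0 n).mem

end Adjoint

/-! ### Further properties of the standard complex -/

namespace StdComplex

variable {L : Type u} [LieRing L] [LieAlgebra ℂ L]

theorem prod_gen_mem (l : List (L ⊕ L)) : (l.map gen).prod ∈ deg L (wordDeg l) :=
  Submodule.subset_span ⟨l, rfl, rfl⟩

/-- An additive property of elements holds as soon as it holds for homogeneous elements. -/
theorem homogeneous_induction {C : StdComplex L → Prop} (hadd : ∀ a b, C a → C b → C (a + b))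
    (hdeg : ∀ p, ∀ n ∈ deg L p, C n) (n : StdComplex L) : C n := by
  -- The witness `S` plays no role. The content is that the homogeneous components span `N(L)`; no
  -- directness of the sum is needed.
  suffices H : ∃ S : Submodule ℂ (StdComplex L), n ∈ ⨆ p, deg L p from by
    obtain ⟨_, h⟩ := H
    exact Submodule.iSup_induction _ (motive := C) h hdeg (hdeg 0 0 (Submodule.zero_mem _)) hadd
  refine ⟨⊤, ?_⟩
  induction n using StdComplex.induction with
  | halg c =>
    rw [Algebra.algebraMap_eq_smul_one]
    exact Submodule.smul_mem _ _ (Submodule.mem_iSup_of_mem 0 one_mem)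
  | h0 X => exact Submodule.mem_iSup_of_mem 0 (gen0_mem X)
  | h1 X => exact Submodule.mem_iSup_of_mem (-1) (gen1_mem X)
  | hadd a b ha hb => exact Submodule.add_mem _ ha hb
  | hmul a b ha hb =>
    refine Submodule.iSup_induction _ (motive := fun a => a * b ∈ _) ha (fun p a ha => ?_)
      (by simp) (fun a a' h h' => by rw [add_mul]; exact Submodule.add_mem _ h h')
    refine Submodule.iSup_induction _ (motive := fun b => a * b ∈ _) hb (fun q b hb => ?_)
      (by simp) (fun a a' h h' => by rw [mul_add]; exact Submodule.add_mem _ h h')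
    exact Submodule.mem_iSup_of_mem _ (mul_mem ha hb)

theorem diff_one : diff (1 : StdComplex L) = 0 := by
  simpa using diff_algebraMap (L := L) 1

/-- The differential is odd. This sign makes the cross terms cancel in `diff_diff`, where `d²`
becomes an ordinary derivation that vanishes on generators. -/
theorem diff_parity (n : StdComplex L) : diff (parity n) = -parity (diff n) := by
  induction n using StdComplex.induction with
  | halg c => simp
  | h0 X => simp
  | h1 X => simp
  | hadd a b ha hb => simp only [map_add, ha, hb]; abel
  | hmul a b ha hb =>
    simp only [map_mul, diff_mul_parity, ha, hb, map_add]
    noncomm_ring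

theorem diff_diff (n : StdComplex L) : diff (diff n) = 0 := by
  induction n using StdComplex.induction with
  | halg c => simp
  | h0 X => simp
  | h1 X => simp
  | hadd a b ha hb => simp [ha, hb]
  | hmul a b ha hb =>
    simp only [map_add, diff_mul_parity, ha, hb, diff_parity]
    noncomm_ring

theorem diff_mem {p : ℤ} {n : StdComplex L} (hn : n ∈ deg L p) : diff n ∈ deg L (p + 1) := by
  induction hn using Submodule.span_induction with
  | zero => rw [map_zero]; exact Submodule.zero_mem _
  | add a b _ _ ha hb => rw [map_add]; exact Submodule.add_mem _ ha hb
  | smul c a _ ha => rw [map_smul]; exact Submodule.smul_mem _ c ha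
  | mem x hx =>
    obtain ⟨l, rfl, rfl⟩ := hx
    induction l with
    | nil => rw [List.map_nil, List.prod_nil, diff_one]; exact Submodule.zero_mem _
    | cons a l ih =>
      rw [List.map_cons, List.prod_cons]
      rcases a with X | ξ
      · rw [wordDeg_inl]
        change diff (gen0 X * _) ∈ _
        rw [diff_mul (gen0_mem X), diff_gen0, zero_mul, zero_add]
        have h := mul_mem (gen0_mem X) ih
        rw [zero_add] at h
        exact Submodule.smul_mem _ _ h
      · rw [wordDeg_inr]
        change diff (gen1 ξ * _) ∈ _
        rw [diff_mul (gen1_mem ξ), diff_gen1]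
        have h₁ := mul_mem (gen0_mem ξ) (prod_gen_mem l)
        have h₂ := mul_mem (gen1_mem ξ) ih
        rw [zero_add] at h₁
        rw [show -1 + (wordDeg l + 1) = wordDeg l by ring] at h₂
        rw [sub_add_cancel]
        exact Submodule.add_mem _ h₁ (Submodule.smul_mem _ _ h₂)

theorem neg_one_zpow_mul_self (p : ℤ) : (-1 : ℂ) ^ p * (-1 : ℂ) ^ p = 1 := by
  rw [← zpow_add₀ (by norm_num)]
  exact Even.neg_one_zpow ⟨p, rfl⟩

/-- Reversing a product twice restores its order, and the sign `(-1) ^ (p * q)` enters twice. -/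
theorem iota_iota_of_mem {p : ℤ} {n : StdComplex L} (hn : n ∈ deg L p) : iota (iota n) = n := by
  induction hn using Submodule.span_induction with
  | zero => simp
  | add a b _ _ ha hb => rw [map_add, map_add, ha, hb]
  | smul c a _ ha => rw [map_smul, map_smul, ha]
  | mem x hx =>
    obtain ⟨l, rfl, rfl⟩ := hx
    induction l with
    | nil => simp
    | cons a l ih =>
      rw [List.map_cons, List.prod_cons]
      have h : ∃ q, gen a ∈ deg L q ∧ iota (iota (gen a)) = gen a := by
        rcases a with X | ξ
        · exact ⟨0, gen0_mem X, by simp [gen]⟩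
        · exact ⟨-1, gen1_mem ξ, by simp [gen]⟩
      obtain ⟨q, hq, h⟩ := h
      have hl := prod_gen_mem l
      rw [iota_mul hq hl, map_smul, iota_mul (iota_mem hl) (iota_mem hq), h, ih, smul_smul,
        mul_comm q, neg_one_zpow_mul_self, one_smul]

theorem iota_iota (n : StdComplex L) : iota (iota n) = n := by
  induction n using homogeneous_induction with
  | hadd a b ha hb => rw [map_add, map_add, ha, hb]
  | hdeg p n hn => exact iota_iota_of_mem hn

/-- Induction on the length of a word, with the Leibniz rule and the reversal rule for `ι`. This
compatibility is what turns the actions through `ι` into DG actions. -/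
theorem iota_diff (n : StdComplex L) : iota (diff n) = diff (iota n) := by
  induction n using homogeneous_induction with
  | hadd a b ha hb => simp only [map_add, ha, hb]
  | hdeg p n hn =>
    induction hn using Submodule.span_induction with
    | zero => simp
    | add a b _ _ ha hb => simp only [map_add, ha, hb]
    | smul c a _ ha => simp only [map_smul, ha]
    | mem x hx =>
      obtain ⟨l, rfl, rfl⟩ := hx
      induction l with
      | nil => simp [diff_one]
      | cons a l ih =>
        rw [List.map_cons, List.prod_cons]
        have hl := prod_gen_mem l
        set y := (l.map gen).prod
        rcases a with X | ξ
        · change iota (diff (gen0 X * y)) = diff (iota (gen0 X * y))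
          rw [diff_mul (gen0_mem X), diff_gen0, zero_mul, zero_add, zpow_zero, one_smul,
            iota_mul (gen0_mem X) hl, iota_mul (gen0_mem X) (diff_mem hl), ih, map_smul,
            diff_mul (iota_mem hl)]
          simp
        · change iota (diff (gen1 ξ * y)) = diff (iota (gen1 ξ * y))
          rw [diff_mul (gen1_mem ξ), diff_gen1, map_add, map_smul, iota_mul (gen0_mem ξ) hl,
            iota_mul (gen1_mem ξ) hl, iota_mul (gen1_mem ξ) (diff_mem hl), ih, map_smul,
            diff_mul (iota_mem hl), iota_gen1, map_neg, diff_gen1, iota_gen0]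
          -- Both sides now consist of a multiple of `ι(y) ξ` and a multiple of `d(ι y) i_ξ`; only
          -- the signs remain to be compared.
          generalize wordDeg l = p
          have h1 : (-1 : ℂ) ^ (-1 * p) = (-1) ^ p := by
            rw [neg_one_mul, zpow_neg, ← inv_zpow]; norm_num
          have h2 : (-1 : ℂ) ^ (-1 * (p + 1)) = -(-1) ^ p := by
            rw [neg_one_mul, zpow_neg, ← inv_zpow, zpow_add₀ (by norm_num)]; norm_num
          have h3 := neg_one_zpow_mul_self p
          rw [h1, h2, smul_add, smul_smul, smul_smul, h3]
          simp
          abel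

variable {L' : Type t} [LieRing L'] [LieAlgebra ℂ L']

theorem iota_map (φ : L →ₗ⁅ℂ⁆ L') (n : StdComplex L) : iota (map φ n) = map φ (iota n) := by
  induction n using homogeneous_induction with
  | hadd a b ha hb => simp only [map_add, ha, hb]
  | hdeg p n hn =>
    induction hn using Submodule.span_induction with
    | zero => simp
    | add a b _ _ ha hb => simp only [map_add, ha, hb]
    | smul c a _ ha => simp only [map_smul, ha]
    | mem x hx =>
      obtain ⟨l, rfl, rfl⟩ := hx
      induction l with
      | nil => simp
      | cons a l ih =>
        rw [List.map_cons, List.prod_cons]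
        have h : ∃ q, gen a ∈ deg L q ∧ iota (map φ (gen a)) = map φ (iota (gen a)) := by
          rcases a with X | ξ
          · exact ⟨0, gen0_mem X, by simp [gen]⟩
          · exact ⟨-1, gen1_mem ξ, by simp [gen]⟩
        obtain ⟨q, hq, h⟩ := h
        have hl := prod_gen_mem l
        rw [map_mul, iota_mul (map_mem φ hq) (map_mem φ hl), iota_mul hq hl, map_smul, map_mul,
          ih, h]

/-- The automorphism of `N(L)` which is `(-1) ^ (i * p)` on `N^p(L)`. -/
def signTwist (i : ℤ) : StdComplex L →ₗ[ℂ] StdComplex L :=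
  (parity.toLinearMap : Module.End ℂ _) ^ i.natAbs

/-- Parity is `(-1) ^ p` in degree `p`, and `|i|` has the same parity as `i`. Using a power of the
parity automorphism gives the sign as a linear map on all of `N(L)` without projections to the
components. -/
theorem signTwist_of_mem (i : ℤ) {p : ℤ} {n : StdComplex L} (hn : n ∈ deg L p) :
    signTwist i n = (-1 : ℂ) ^ (i * p) • n := by
  have h : ∀ k : ℕ, ((parity.toLinearMap : Module.End ℂ (StdComplex L)) ^ k) n =
      (-1 : ℂ) ^ (k * p) • n := by
    intro k
    induction k with
    | zero => simp
    | succ k ih =>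
      rw [pow_succ', Module.End.mul_apply, ih, map_smul, AlgHom.toLinearMap_apply,
        parity_of_mem hn, smul_smul, ← zpow_add₀ (by norm_num)]
      congr 2
      push_cast; ring
  rw [signTwist, h]
  congr 1
  rcases Int.natAbs_eq i with hi | hi
  · rw [← hi]
  · conv_rhs => rw [hi]
    rw [neg_mul, zpow_neg, ← inv_zpow]
    norm_num

/-- The subalgebra of `N(L)` generated by the elements of degree `-1`. -/
def exteriorPart (L : Type u) [LieRing L] [LieAlgebra ℂ L] : Subalgebra ℂ (StdComplex L) :=
  Algebra.adjoin ℂ (Set.range gen1)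

/-- The degree `-1` generators anticommute, hence square to zero, so this subalgebra is contained in
the image of the exterior algebra of `L`. -/
instance exteriorPart_finite [FiniteDimensional ℂ L] :
    FiniteDimensional ℂ (exteriorPart L) := by
  have : FiniteDimensional ℂ (ExteriorAlgebra ℂ L) :=
    Module.Finite.of_basis (Module.finBasis ℂ L).ExteriorAlgebra
  have hsq : ∀ ξ : L, gen1 ξ * gen1 ξ = 0 := fun ξ => by
    have h := gen1_gen1 ξ ξ
    rwa [← two_smul ℂ, smul_eq_zero_iff_right two_ne_zero] at h
  let g := ExteriorAlgebra.lift ℂ ⟨gen1, hsq⟩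
  have hle : exteriorPart L ≤ g.range := by
    refine Algebra.adjoin_le ?_
    rintro _ ⟨ξ, rfl⟩
    exact ⟨ExteriorAlgebra.ι ℂ ξ, ExteriorAlgebra.lift_ι_apply ℂ _ hsq ξ⟩
  have hfin : FiniteDimensional ℂ g.toLinearMap.range := inferInstance
  exact Submodule.finiteDimensional_of_le (S₁ := Subalgebra.toSubmodule (exteriorPart L))
    (S₂ := g.toLinearMap.range) hle

/-- The easy half of a Poincaré–Birkhoff–Witt statement: every element is a combination of products
of degree zero generators followed by an element of the exterior part. The smallest subspace `M`
with the two properties is shown to be a left ideal; it contains `1`. -/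
theorem eq_top_of_exteriorPart_le {S : Submodule ℂ (StdComplex L)}
    (h : ∀ n ∈ exteriorPart L, n ∈ S) (hS : ∀ X, ∀ n ∈ S, gen0 X * n ∈ S) : S = ⊤ := by
  let M : Submodule ℂ (StdComplex L) :=
    sInf {S | (∀ n ∈ exteriorPart L, n ∈ S) ∧ ∀ X, ∀ n ∈ S, gen0 X * n ∈ S}
  have hM1 : ∀ n ∈ exteriorPart L, n ∈ M := fun n hn =>
    (Submodule.mem_sInf).2 fun S hS => hS.1 n hn
  have hM0 : ∀ X, ∀ n ∈ M, gen0 X * n ∈ M := fun X n hn =>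
    (Submodule.mem_sInf).2 fun S hS => hS.2 X n ((Submodule.mem_sInf).1 hn S hS)
  -- Stability under `gen1 ξ` follows from minimality. The elements of `M` that all `gen1 ξ` send
  -- into `M` form a subspace with the same two properties, because `gen1 ξ` commutes past `gen0 X`
  -- up to another `gen1`.
  have hg : ∀ n ∈ M, n ∈ M ∧ ∀ ξ, gen1 ξ * n ∈ M := by
    let M' : Submodule ℂ (StdComplex L) :=
      { carrier := {n | n ∈ M ∧ ∀ ξ, gen1 ξ * n ∈ M}
        zero_mem' := ⟨M.zero_mem, fun ξ => by simp⟩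
        add_mem' := fun ha hb => ⟨M.add_mem ha.1 hb.1, fun ξ => by
          rw [mul_add]; exact M.add_mem (ha.2 ξ) (hb.2 ξ)⟩
        smul_mem' := fun c a ha => ⟨M.smul_mem c ha.1, fun ξ => by
          rw [mul_smul_comm]; exact M.smul_mem c (ha.2 ξ)⟩ }
    have hle : M ≤ M' := sInf_le ⟨fun n hn => ⟨hM1 n hn, fun ξ => hM1 _
        (Subalgebra.mul_mem _ (Algebra.subset_adjoin ⟨ξ, rfl⟩) hn)⟩,
      fun X n hn => ⟨hM0 X n hn.1, fun ξ => by
        have e : gen1 ξ * (gen0 X * n) = gen0 X * (gen1 ξ * n) - gen1 ⁅X, ξ⁆ * n := by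
          rw [← mul_assoc, ← mul_assoc, gen0_gen1, add_mul, add_sub_cancel_right]
        rw [e]
        exact M.sub_mem (hM0 X _ (hn.2 ξ)) (hn.2 _)⟩⟩
    exact fun n hn => hle hn
  have key : ∀ m n : StdComplex L, n ∈ M → m * n ∈ M := by
    intro m
    induction m using StdComplex.induction with
    | halg c =>
      intro n hn
      rw [← Algebra.smul_def]
      exact M.smul_mem c hn
    | h0 X => exact hM0 X
    | h1 ξ => exact fun n hn => (hg n hn).2 ξ
    | hmul a b ha hb =>
      intro n hn
      rw [mul_assoc]
      exact ha _ (hb n hn)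
    | hadd a b ha hb =>
      intro n hn
      rw [add_mul]
      exact M.add_mem (ha n hn) (hb n hn)
  refine top_unique fun n _ => ?_
  have hle : M ≤ S := sInf_le ⟨h, hS⟩
  simpa using hle (key n 1 (hM1 1 (Subalgebra.one_mem _)))

end StdComplex

/-! ### Graded vector spaces -/

section Graded

variable {V U : Type*} [AddCommGroup V] [Module ℂ V] [AddCommGroup U] [Module ℂ U]
  {grade : ℤ → Submodule ℂ V}

/-- The linear map with given restrictions to the homogeneous components. -/
def ofComponents (h : DirectSum.IsInternal grade) (L : ∀ i, grade i →ₗ[ℂ] U) : V →ₗ[ℂ] U :=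
  DirectSum.toModule ℂ ℤ U L ∘ₗ
    (LinearEquiv.ofBijective (DirectSum.coeLinearMap grade) h).symm.toLinearMap

theorem ofComponents_apply (h : DirectSum.IsInternal grade) (L : ∀ i, grade i →ₗ[ℂ] U) {i : ℤ}
    {x : V} (hx : x ∈ grade i) : ofComponents h L x = L i ⟨x, hx⟩ := by
  have e : (LinearEquiv.ofBijective (DirectSum.coeLinearMap grade) h).symm x =
      DirectSum.lof ℂ ℤ (fun i => grade i) i ⟨x, hx⟩ :=
    (LinearEquiv.symm_apply_eq _).2 (DirectSum.coeLinearMap_lof grade i ⟨x, hx⟩).symm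
  rw [ofComponents, LinearMap.comp_apply, LinearEquiv.coe_coe, e, DirectSum.toModule_lof]

theorem graded_induction (h : DirectSum.IsInternal grade) {C : V → Prop}
    (hadd : ∀ x y, C x → C y → C (x + y)) (hgrade : ∀ i, ∀ x ∈ grade i, C x) (x : V) : C x := by
  have hx : x ∈ ⨆ i, grade i := h.submodule_iSup_eq_top ▸ Submodule.mem_top
  exact Submodule.iSup_induction _ (motive := C) hx hgrade (hgrade 0 0 (Submodule.zero_mem _)) hadd

theorem graded_hom_ext (h : DirectSum.IsInternal grade) {f g : V →ₗ[ℂ] U}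
    (hfg : ∀ i, ∀ x ∈ grade i, f x = g x) : f = g := by
  ext x
  induction x using graded_induction h with
  | hadd x y hx hy => rw [map_add, map_add, hx, hy]
  | hgrade i x hx => exact hfg i x hx

/-- The operator `(-1) ^ i` on the component of degree `i`. -/
def gradeSign (h : DirectSum.IsInternal grade) : V →ₗ[ℂ] V :=
  ofComponents h fun i => (-1 : ℂ) ^ i • (grade i).subtype

theorem gradeSign_apply (h : DirectSum.IsInternal grade) {i : ℤ} {x : V} (hx : x ∈ grade i) :
    gradeSign h x = (-1 : ℂ) ^ i • x := ofComponents_apply h _ hx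

end Graded

/-! ### Arithmetic of Koszul signs -/

theorem sign_mul (a b : ℤ) : (-1 : ℂ) ^ a * (-1 : ℂ) ^ b = (-1 : ℂ) ^ (a + b) :=
  (zpow_add₀ (by norm_num) a b).symm

theorem neg_sign (a : ℤ) : -(-1 : ℂ) ^ a = (-1 : ℂ) ^ (a + 1) := by
  rw [zpow_add_one₀ (by norm_num), mul_neg_one]

theorem sign_congr {a b : ℤ} (h : Even (a - b)) : (-1 : ℂ) ^ a = (-1 : ℂ) ^ b := by
  rw [← sub_add_cancel a b, ← sign_mul, h.neg_one_zpow, one_mul]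

/-! ### Composition of regular functions with linear maps -/

section Post

variable {K : Type u} [Group K] [AffineAlgebraicGroup K]
variable {V W : Type*} [AddCommGroup V] [Module ℂ V] [AddCommGroup W] [Module ℂ W]

/-- Composition of vector valued regular functions with a linear map. -/
def postComp (L : V →ₗ[ℂ] W) : RegFun K V →ₗ[ℂ] RegFun K W where
  toFun F := ⟨fun k => L (F.1 k), linear_comp_mem_regFun L F.2⟩
  map_add' F G := Subtype.ext (funext fun k => map_add L (F.1 k) (G.1 k))
  map_smul' c F := Subtype.ext (funext fun k => map_smul L c (F.1 k))

@[simp] theorem postComp_apply (L : V →ₗ[ℂ] W) (F : RegFun K V) (k : K) :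
    (postComp L F).1 k = L (F.1 k) := rfl

@[simp] theorem rightTrV_apply (g k : K) (F : RegFun K V) : (rightTrV g F).1 k = F.1 (k * g) := rfl

theorem regFun_ext {F G : RegFun K V} (h : ∀ k, F.1 k = G.1 k) : F = G :=
  Subtype.ext (funext h)

end Post

/-! ### The complex of equivariant homomorphisms -/

section HomComplex

variable {A : Type w} [Ring A] [Algebra ℂ A]
variable {K : Type u} [Group K] [AffineAlgebraicGroup K]
variable {T : Type t} [Group T] [AffineAlgebraicGroup T]
variable {P : HarishChandraPair A K} {γ : AlgGroupHom T K} {V : EqModule.{t, w, v} (P.restrict γ)}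

open StdComplex

/-- The working form of the definition. The Lie condition becomes a derivative of right translates
at `1`, the group condition loses its inverse, and the signs `(-1) ^ (p * q)` and `(-1) ^ (i * p)`
merge into that of moving `m` past `f(n)`, an element of degree `i + q`. -/
theorem mem_homDeg_iff {i : ℤ} {f : StdComplex (LieAlg K) →ₗ[ℂ] RegFun K V.carrier} :
    f ∈ homDeg P γ V i ↔
      (∀ p, ∀ n ∈ deg (LieAlg K) p, ∀ k, (f n).1 k ∈ V.grade (p + i)) ∧
      (∀ X n k, HasDerivOne X (fun x => (f n).1 (x * k))
        (V.π (P.ψ X) ((f n).1 k) - (f (gen0 X * n)).1 k)) ∧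
      (∀ x n k, (f (AdN (γ.toHom x) n)).1 (γ.toHom x * k) = V.ν x ((f n).1 k)) ∧
      (∀ p, ∀ m ∈ deg (LieAlg T) p, ∀ q, ∀ n ∈ deg (LieAlg K) q, ∀ k,
        (f (n * map γ.lieMap (iota m))).1 k = (-1 : ℂ) ^ (p * (i + q)) • V.ω m ((f n).1 k)) := by
  refine and_congr Iff.rfl (and_congr ?_ (and_congr ?_ ?_))
  · refine forall_congr' fun X => forall_congr' fun n => ⟨fun h k => ?_, fun h => funext fun k => ?_⟩
    · have h' := congrFun h k
      change (f (gen0 X * n)).1 k = V.π (P.ψ X) ((f n).1 k) - derivOne X (rightTrV k (f n)) at h'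
      rw [h', sub_sub_cancel]
      exact hasDerivOne X (rightTrV k (f n))
    · change (f (gen0 X * n)).1 k = V.π (P.ψ X) ((f n).1 k) - derivOne X (rightTrV k (f n))
      rw [(hasDerivOne X (rightTrV k (f n))).unique (h k), sub_sub_cancel]
  · refine forall_congr' fun x => forall_congr' fun n => ⟨fun h k => ?_, fun h => funext fun k => ?_⟩
    · have h' := congrFun h (γ.toHom x * k)
      change (f (AdN (γ.toHom x) n)).1 (γ.toHom x * k) =
        V.ν x ((f n).1 ((γ.toHom x)⁻¹ * (γ.toHom x * k))) at h'
      rw [h', inv_mul_cancel_left]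
    · have h' := h ((γ.toHom x)⁻¹ * k)
      rw [mul_inv_cancel_left] at h'
      exact h'
  · refine forall_congr' fun p => forall₂_congr fun m _ => forall_congr' fun q =>
      forall₂_congr fun n _ => ?_
    rw [funext_iff]
    refine forall_congr' fun k => ?_
    have e : (f (omegaN γ p q m n) : K → V.carrier) k =
        (-1 : ℂ) ^ (p * q) • (f (n * map γ.lieMap (iota m))).1 k := by
      rw [omegaN, map_smul]; rfl
    rw [e]
    change _ = (-1 : ℂ) ^ (i * p) • V.ω m ((f n).1 k) ↔ _
    constructor
    · intro h
      have h' := congrArg (fun x => (-1 : ℂ) ^ (p * q) • x) h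
      simp only [smul_smul, neg_one_zpow_mul_self, one_smul, sign_mul] at h'
      rw [h']
      congr 2
      ring
    · intro h
      rw [h, smul_smul, sign_mul]
      congr 1
      exact sign_congr ⟨p * q, by ring⟩

/-- A linear operator on `Hom(N(𝔨), R(K, V))` which preserves the complex `Γ(V)` if it does so on
homogeneous elements. -/
theorem map_mem_homComplex {W : EqModule.{t, w, v} (P.restrict γ)}
    {S : (StdComplex (LieAlg K) →ₗ[ℂ] RegFun K V.carrier) →ₗ[ℂ]
      (StdComplex (LieAlg K) →ₗ[ℂ] RegFun K W.carrier)}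
    (hS : ∀ i, ∀ f ∈ homDeg P γ V i, S f ∈ homComplex P γ W) :
    ∀ f ∈ homComplex P γ V, S f ∈ homComplex P γ W := by
  have h : homComplex P γ V ≤ (homComplex P γ W).comap S := iSup_le hS
  exact h

theorem mem_homComplex {i : ℤ} {f : StdComplex (LieAlg K) →ₗ[ℂ] RegFun K V.carrier}
    (hf : f ∈ homDeg P γ V i) : f ∈ homComplex P γ V :=
  Submodule.mem_iSup_of_mem i hf

theorem homComplex_induction {C : (StdComplex (LieAlg K) →ₗ[ℂ] RegFun K V.carrier) → Prop}
    (hadd : ∀ f g, C f → C g → C (f + g)) (hdeg : ∀ i, ∀ f ∈ homDeg P γ V i, C f)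
    {f : StdComplex (LieAlg K) →ₗ[ℂ] RegFun K V.carrier} (hf : f ∈ homComplex P γ V) : C f :=
  Submodule.iSup_induction _ (motive := C) hf hdeg (hdeg 0 0 (Submodule.zero_mem _)) hadd

/-- The conditions for `𝔨` and `T` carry no sign depending on the degree, so they hold for sums of
elements of different degrees. -/
theorem homComplex_lie {f : StdComplex (LieAlg K) →ₗ[ℂ] RegFun K V.carrier}
    (hf : f ∈ homComplex P γ V) (X : LieAlg K) (n : StdComplex (LieAlg K)) (k : K) :
    HasDerivOne X (fun x => (f n).1 (x * k))
      (V.π (P.ψ X) ((f n).1 k) - (f (gen0 X * n)).1 k) := by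
  refine homComplex_induction (C := fun f => HasDerivOne X (fun x => (f n).1 (x * k))
    (V.π (P.ψ X) ((f n).1 k) - (f (gen0 X * n)).1 k)) (fun f g hf hg => ?_)
    (fun i f hf => (mem_homDeg_iff.1 hf).2.1 X n k) hf
  · convert hf.add hg using 1
    · rfl
    · change V.π (P.ψ X) ((f n).1 k + (g n).1 k) -
        ((f (gen0 X * n)).1 k + (g (gen0 X * n)).1 k) = _
      rw [map_add]
      abel

theorem homComplex_group {f : StdComplex (LieAlg K) →ₗ[ℂ] RegFun K V.carrier}
    (hf : f ∈ homComplex P γ V) (x : T) (n : StdComplex (LieAlg K)) (k : K) :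
    (f (AdN (γ.toHom x) n)).1 (γ.toHom x * k) = V.ν x ((f n).1 k) := by
  refine homComplex_induction (C := fun f => (f (AdN (γ.toHom x) n)).1 (γ.toHom x * k) =
    V.ν x ((f n).1 k)) (fun f g hf hg => ?_) (fun i f hf => (mem_homDeg_iff.1 hf).2.2.1 x n k) hf
  · simp only [LinearMap.add_apply, Submodule.coe_add, Pi.add_apply, map_add, hf, hg]

/-! #### The operators -/

variable (P γ V) in
/-- The operator `f ↦ d ∘ f - (-1) ^ i f ∘ d`. -/
def homDiff (i : ℤ) : (StdComplex (LieAlg K) →ₗ[ℂ] RegFun K V.carrier) →ₗ[ℂ]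
    (StdComplex (LieAlg K) →ₗ[ℂ] RegFun K V.carrier) where
  toFun f := postComp V.d ∘ₗ f - (-1 : ℂ) ^ i • f ∘ₗ diff
  map_add' f g := LinearMap.ext fun n => regFun_ext fun k => by
    change V.d ((f n).1 k + (g n).1 k) - (-1 : ℂ) ^ i • ((f (diff n)).1 k + (g (diff n)).1 k) =
      (V.d ((f n).1 k) - (-1 : ℂ) ^ i • (f (diff n)).1 k) +
        (V.d ((g n).1 k) - (-1 : ℂ) ^ i • (g (diff n)).1 k)
    rw [map_add, smul_add]
    abel
  map_smul' c f := LinearMap.ext fun n => regFun_ext fun k => by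
    change V.d (c • (f n).1 k) - (-1 : ℂ) ^ i • c • (f (diff n)).1 k =
      c • (V.d ((f n).1 k) - (-1 : ℂ) ^ i • (f (diff n)).1 k)
    rw [map_smul, smul_sub, smul_comm]

theorem homDiff_apply (i : ℤ) (f : StdComplex (LieAlg K) →ₗ[ℂ] RegFun K V.carrier)
    (n : StdComplex (LieAlg K)) (k : K) : (homDiff P γ V i f n).1 k =
      V.d ((f n).1 k) - (-1 : ℂ) ^ i • (f (diff n)).1 k := rfl

theorem AdN_mem (k : K) {p : ℤ} {n : StdComplex (LieAlg K)} (hn : n ∈ deg (LieAlg K) p) :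
    AdN k n ∈ deg (LieAlg K) p := map_mem _ hn

theorem AdN_diff (k : K) (n : StdComplex (LieAlg K)) : AdN k (diff n) = diff (AdN k n) :=
  map_diff _ n

theorem iota_AdN (k : K) (n : StdComplex (LieAlg K)) : iota (AdN k n) = AdN k (iota n) :=
  iota_map _ n

/-- The generator `X` is a cycle, so `d(X n) = X dn` and the Lie condition persists. In the
condition for `N(𝔱)`, the term with `ι(dm)` in `d(n ι(m))` cancels the term `ω(dm)` that arises from
`d ω(m)`. -/
theorem homDiff_mem {i : ℤ} {f : StdComplex (LieAlg K) →ₗ[ℂ] RegFun K V.carrier}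
    (hf : f ∈ homDeg P γ V i) : homDiff P γ V i f ∈ homDeg P γ V (i + 1) := by
  obtain ⟨h1, h2, h3, h4⟩ := mem_homDeg_iff.1 hf
  refine mem_homDeg_iff.2 ⟨fun p n hn k => ?_, fun X n k => ?_, fun x n k => ?_,
    fun p m hm q n hn k => ?_⟩
  · rw [homDiff_apply]
    have e₁ := V.d_mem _ _ (h1 p n hn k)
    have e₂ := h1 _ _ (diff_mem hn) k
    rw [show p + i + 1 = p + (i + 1) by ring] at e₁
    rw [show p + 1 + i = p + (i + 1) by ring] at e₂
    exact Submodule.sub_mem _ e₁ (Submodule.smul_mem _ _ e₂)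
  · convert ((h2 X n k).linear_comp V.d).sub ((h2 X (diff n) k).smul ((-1 : ℂ) ^ i)) using 1
    · rfl
    rw [homDiff_apply, homDiff_apply, diff_mul (gen0_mem X), diff_gen0, zero_mul, zero_add,
      zpow_zero, one_smul, map_sub, map_sub, V.π_d, map_smul, smul_sub]
    abel
  · rw [homDiff_apply, homDiff_apply, ← AdN_diff, h3, h3, map_sub, map_smul, V.ν_d]
  · rw [homDiff_apply, homDiff_apply, diff_mul hn, ← map_diff, ← iota_diff, map_add, map_smul,
      Submodule.coe_add, Pi.add_apply, Submodule.coe_smul, Pi.smul_apply, h4 p m hm q n hn,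
      h4 p m hm _ _ (diff_mem hn), h4 _ _ (diff_mem hm) q n hn, map_smul, V.ω_d p m hm, map_sub,
      map_smul]
    simp only [smul_add, smul_sub, smul_smul, sign_mul]
    have e₁ : (-1 : ℂ) ^ (p * (i + q) + p) = (-1) ^ (p * (i + 1 + q)) := by congr 1; ring
    have e₂ : (-1 : ℂ) ^ (i + p * (i + (q + 1))) = (-1) ^ (p * (i + 1 + q) + i) := by
      congr 1; ring
    have e₃ : (-1 : ℂ) ^ (i + (q + (p + 1) * (i + q))) = (-1) ^ (p * (i + q)) :=
      sign_congr ⟨i + q, by ring⟩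
    rw [e₁, e₂, e₃]
    abel

variable (P γ V) in
/-- The operator `F ↦ (k ↦ π(φ(k) a) F(k))` on `R(K, V)`. -/
def twistedAction (a : A) : RegFun K V.carrier →ₗ[ℂ] RegFun K V.carrier where
  toFun F := ⟨fun k => V.π (P.φ k a) (F.1 k), bilinear_comp_mem_regFun V.π.toLinearMap
    (P.φ_algebraic.orbit_mem a) F.2⟩
  map_add' F G := regFun_ext fun k => map_add (V.π (P.φ k a)) (F.1 k) (G.1 k)
  map_smul' c F := regFun_ext fun k => map_smul (V.π (P.φ k a)) c (F.1 k)

theorem twistedAction_apply (a : A) (F : RegFun K V.carrier) (k : K) :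
    (twistedAction P γ V a F).1 k = V.π (P.φ k a) (F.1 k) := rfl

/-- The derivative of `x ↦ φ(x)(φ(k) a)` is the commutator of `ψ X` with `φ(k) a`. Added to `π(φ(k)
a) π(ψ X)`, it moves `π(ψ X)` to the left, which is the Lie condition. The twist by `φ(k)` exists
for this reason. -/
theorem twistedAction_comp_mem {i : ℤ} {f : StdComplex (LieAlg K) →ₗ[ℂ] RegFun K V.carrier}
    (hf : f ∈ homDeg P γ V i) (a : A) : twistedAction P γ V a ∘ₗ f ∈ homDeg P γ V i := by
  obtain ⟨h1, h2, h3, h4⟩ := mem_homDeg_iff.1 hf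
  refine mem_homDeg_iff.2 ⟨fun p n hn k => ?_, fun X n k => ?_, fun x n k => ?_,
    fun p m hm q n hn k => ?_⟩
  all_goals simp only [LinearMap.comp_apply, twistedAction_apply]
  · exact V.π_mem _ _ _ (h1 p n hn k)
  · have hφ : HasDerivOne X (fun x => P.φ x (P.φ k a))
        (P.ψ X * P.φ k a - P.φ k a * P.ψ X) :=
      ⟨P.φ_algebraic.orbit_mem _, P.differential_φ X (P.φ k a)⟩
    convert hφ.bilinear_comp (h2 X n k) V.π.toLinearMap using 1
    · funext x; simp
    · simp
  · have h := V.π_equivariant x (P.φ k a) ((f n).1 k)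
    rw [h3, map_mul]
    exact h
  · rw [h4 p m hm q n hn, map_smul, V.π_ω]

/-- Equivariance involves only left translations, and right translations commute with them. -/
theorem rightTrV_comp_mem {i : ℤ} {f : StdComplex (LieAlg K) →ₗ[ℂ] RegFun K V.carrier}
    (hf : f ∈ homDeg P γ V i) (g : K) : rightTrV g ∘ₗ f ∈ homDeg P γ V i := by
  obtain ⟨h1, h2, h3, h4⟩ := mem_homDeg_iff.1 hf
  refine mem_homDeg_iff.2 ⟨fun p n hn k => h1 p n hn _, fun X n k => ?_, fun x n k => ?_,
    fun p m hm q n hn k => h4 p m hm q n hn _⟩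
  all_goals simp only [LinearMap.comp_apply, rightTrV_apply]
  · simpa only [mul_assoc] using h2 X n (k * g)
  · rw [mul_assoc, h3]

variable (P γ V) in
/-- The operators `(R(n) f)(m)(k) = f(Ad(k) n m)(k)`. -/
def homRight : StdComplex (LieAlg K) →ₗ[ℂ]
    (StdComplex (LieAlg K) →ₗ[ℂ] RegFun K V.carrier) →ₗ[ℂ]
      (StdComplex (LieAlg K) →ₗ[ℂ] RegFun K V.carrier) :=
  LinearMap.mk₂ ℂ
    (fun n f =>
      { toFun := fun m => ⟨fun k => (f (AdN k n * m)).1 k, diagonal_mem_regFun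
          (linear_comp_mem_regFun (LinearMap.mulRight ℂ m) (AdN_orbit_mem n)) f⟩
        map_add' := fun a b => regFun_ext fun k => by simp [mul_add]
        map_smul' := fun c a => regFun_ext fun k => by simp })
    (fun n n' f => LinearMap.ext fun m => regFun_ext fun k => by simp [add_mul])
    (fun c n f => LinearMap.ext fun m => regFun_ext fun k => by simp)
    (fun n f g => LinearMap.ext fun m => regFun_ext fun k => by simp)
    (fun c n f => LinearMap.ext fun m => regFun_ext fun k => by simp)

theorem homRight_apply (n : StdComplex (LieAlg K))
    (f : StdComplex (LieAlg K) →ₗ[ℂ] RegFun K V.carrier) (m : StdComplex (LieAlg K)) (k : K) :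
    (homRight P γ V n f m).1 k = (f (AdN k n * m)).1 k := rfl

/-- Left multiplication by a fixed `n` would not commute with `X`. The derivative of `Ad(k) n`
contributes the commutator `X (Ad(k) n) - (Ad(k) n) X`, whose first term cancels `f(X (Ad(k) n) m)`
and whose second leaves `X` next to `m`. The algebra `N(𝔱)` acts from the other side and does not
interfere. -/
theorem homRight_mem {i p : ℤ} {f : StdComplex (LieAlg K) →ₗ[ℂ] RegFun K V.carrier}
    (hf : f ∈ homDeg P γ V i) {n : StdComplex (LieAlg K)} (hn : n ∈ deg (LieAlg K) p) :
    homRight P γ V n f ∈ homDeg P γ V (p + i) := by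
  obtain ⟨h1, h2, h3, h4⟩ := mem_homDeg_iff.1 hf
  refine mem_homDeg_iff.2 ⟨fun q m hm k => ?_, fun X m k => ?_, fun x m k => ?_,
    fun r m hm q n' hn' k => ?_⟩
  all_goals simp only [homRight_apply]
  · have h := h1 _ _ (mul_mem (AdN_mem k hn) hm) k
    rwa [show p + q + i = q + (p + i) by ring] at h
  · have h := ((hasDerivOne_AdN X (AdN k n)).linear_comp (LinearMap.mulRight ℂ m)).diagonal
      (rightTrV k ∘ₗ f)
    rw [(hasDerivOne X ((rightTrV k ∘ₗ f) _)).unique (h2 X _ k)] at h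
    convert h using 1
    · funext x; rw [AdN_mul]; rfl
    · simp [AdN_one, sub_mul, mul_assoc]
  · rw [AdN_mul, ← map_mul, h3]
  · rw [← mul_assoc, h4 r m hm _ _ (mul_mem (AdN_mem k hn) hn')]
    congr 2
    ring

/-! #### The complex as a graded vector space -/

variable (P γ V) in
/-- The underlying vector space of the complex `Γ(V)`. -/
def HomCarrier : Type (max u v) := ↥(homComplex P γ V)

instance : AddCommGroup (HomCarrier P γ V) :=
  Module.addCommMonoidToAddCommGroup ℂ (M := ↥(homComplex P γ V))

instance : Module ℂ (HomCarrier P γ V) :=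
  (inferInstance : Module ℂ ↥(homComplex P γ V))

namespace HomCarrier

/-- The value `f(n)(k)`, as a linear function of `f`. -/
def eval (n : StdComplex (LieAlg K)) (k : K) : HomCarrier P γ V →ₗ[ℂ] V.carrier where
  toFun f := (f.1 n).1 k
  map_add' _ _ := rfl
  map_smul' _ _ := rfl

theorem eval_apply (f : HomCarrier P γ V) (n : StdComplex (LieAlg K)) (k : K) :
    eval n k f = (f.1 n).1 k := rfl

theorem ext {f g : HomCarrier P γ V} (h : ∀ n k, eval n k f = eval n k g) : f = g :=
  Subtype.ext (LinearMap.ext fun n => regFun_ext fun k => h n k)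

theorem ext_homogeneous {f g : HomCarrier P γ V}
    (h : ∀ p, ∀ n ∈ deg (LieAlg K) p, ∀ k, eval n k f = eval n k g) : f = g := by
  apply Subtype.ext
  ext1 n
  induction n using homogeneous_induction with
  | hadd a b ha hb => rw [map_add, map_add, ha, hb]
  | hdeg p n hn => exact regFun_ext fun k => h p n hn k

variable (P γ V) in
/-- The homogeneous components of `Γ(V)`. -/
def grade (i : ℤ) : Submodule ℂ (HomCarrier P γ V) where
  carrier := {f | f.1 ∈ homDeg P γ V i}
  zero_mem' := Submodule.zero_mem (homDeg P γ V i)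
  add_mem' := fun {f g} hf hg => Submodule.add_mem (homDeg P γ V i) (x := f.1) (y := g.1) hf hg
  smul_mem' := fun c f hf => Submodule.smul_mem (homDeg P γ V i) (x := f.1) c hf

theorem mem_grade {i : ℤ} {f : HomCarrier P γ V} :
    f ∈ grade P γ V i ↔ f.1 ∈ homDeg P γ V i := Iff.rfl

theorem eval_mem {i p : ℤ} {f : HomCarrier P γ V} (hf : f ∈ grade P γ V i)
    {n : StdComplex (LieAlg K)} (hn : n ∈ deg (LieAlg K) p) (k : K) :
    eval n k f ∈ V.grade (p + i) := hf.1 p n hn k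

variable (P γ V) in
-- Evaluation at an `n` of degree `p` sends the component of degree `j` into degree `p + j` of `V`.
-- Independence therefore follows from that in `V`, since homogeneous `n` determine `f`.
theorem isInternal : DirectSum.IsInternal (grade P γ V) := by
  refine (DirectSum.isInternal_submodule_iff_iSupIndep_and_iSup_eq_top _).2
    ⟨fun i => ?_, top_unique fun f _ => ?_⟩
  · rw [Submodule.disjoint_def]
    intro f hf hf'
    refine ext_homogeneous fun p n hn k => ?_
    rw [map_zero]
    have hle : ⨆ j, ⨆ (_ : j ≠ i), grade P γ V j ≤
        (⨆ l, ⨆ (_ : l ≠ p + i), V.grade l).comap (eval n k) :=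
      iSup₂_le fun j hj g hg => Submodule.mem_iSup_of_mem (p + j)
        (Submodule.mem_iSup_of_mem (by simpa using hj) (eval_mem hg hn k))
    exact Submodule.disjoint_def.1 (V.isInternal.submodule_iSupIndep (p + i)) _
      (eval_mem hf hn k) (hle hf')
  -- The components span because the complex was defined as their supremum.
  · refine Submodule.iSup_induction' _
      (motive := fun f hf => (⟨f, hf⟩ : HomCarrier P γ V) ∈ ⨆ i, grade P γ V i)
      (fun i f hf => Submodule.mem_iSup_of_mem (p := grade P γ V) i hf)
      (Submodule.zero_mem (⨆ i, grade P γ V i))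
      (fun f g hf hg hf' hg' => Submodule.add_mem (⨆ i, grade P γ V i) hf' hg') f.2

/-- The operator on `Γ(V)` induced by an operator on all homomorphisms. -/
def restrictOp {W : EqModule.{t, w, v} (P.restrict γ)}
    (S : (StdComplex (LieAlg K) →ₗ[ℂ] RegFun K V.carrier) →ₗ[ℂ]
      (StdComplex (LieAlg K) →ₗ[ℂ] RegFun K W.carrier))
    (hS : ∀ i, ∀ f ∈ homDeg P γ V i, S f ∈ homComplex P γ W) :
    HomCarrier P γ V →ₗ[ℂ] HomCarrier P γ W where
  toFun f := ⟨S f.1, map_mem_homComplex hS f.1 f.2⟩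
  map_add' f g := Subtype.ext (map_add S f.1 g.1)
  map_smul' c f := Subtype.ext (map_smul S c f.1)

end HomCarrier

end HomComplex

section Object

variable {A : Type w} [Ring A] [Algebra ℂ A]
variable {K : Type u} [Group K] [AffineAlgebraicGroup K]
variable {T : Type t} [Group T] [AffineAlgebraicGroup T]
variable {P : HarishChandraPair A K} {γ : AlgGroupHom T K}
variable {V W : EqModule.{t, w, v} (P.restrict γ)}

open StdComplex

namespace HomCarrier

/-! #### The actions on the complex -/

variable (P γ V) in
/-- The differential of `Γ(V)`. -/
def diff : HomCarrier P γ V →ₗ[ℂ] HomCarrier P γ V :=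
  ofComponents (isInternal P γ V) fun i =>
    { toFun := fun f => ⟨homDiff P γ V i f.1.1, mem_homComplex (homDiff_mem f.2)⟩
      map_add' := fun f g => Subtype.ext (map_add (homDiff P γ V i) f.1.1 g.1.1)
      map_smul' := fun c f => Subtype.ext (map_smul (homDiff P γ V i) c f.1.1) }

theorem diff_val {i : ℤ} {f : HomCarrier P γ V} (hf : f ∈ grade P γ V i) :
    (diff P γ V f).1 = homDiff P γ V i f.1 := by
  rw [diff, ofComponents_apply _ _ hf]
  rfl

theorem diff_mem {i : ℤ} {f : HomCarrier P γ V} (hf : f ∈ grade P γ V i) :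
    diff P γ V f ∈ grade P γ V (i + 1) := by
  rw [mem_grade, diff_val hf]
  exact homDiff_mem hf

theorem eval_diff {i : ℤ} {f : HomCarrier P γ V} (hf : f ∈ grade P γ V i)
    (n : StdComplex (LieAlg K)) (k : K) : eval n k (diff P γ V f) =
      V.d (eval n k f) - (-1 : ℂ) ^ i • eval (StdComplex.diff n) k f := by
  rw [eval_apply, diff_val hf]
  rfl

theorem diff_diff (f : HomCarrier P γ V) : diff P γ V (diff P γ V f) = 0 := by
  induction f using graded_induction (isInternal P γ V) with
  | hadd f g hf hg => rw [map_add, map_add, hf, hg, add_zero]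
  | hgrade i f hf =>
    refine ext fun n k => ?_
    rw [eval_diff (diff_mem hf), eval_diff hf, eval_diff hf, StdComplex.diff_diff, map_sub,
      V.d_d, map_smul, ← neg_sign]
    have h : eval (0 : StdComplex (LieAlg K)) k f = 0 := by
      rw [eval_apply, map_zero]; rfl
    rw [h]
    simp

/-- Composition with an operator between spaces of regular functions. -/
def postOp (L : RegFun K V.carrier →ₗ[ℂ] RegFun K W.carrier) :
    (StdComplex (LieAlg K) →ₗ[ℂ] RegFun K V.carrier) →ₗ[ℂ]
      (StdComplex (LieAlg K) →ₗ[ℂ] RegFun K W.carrier) where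
  toFun f := L ∘ₗ f
  map_add' f g := LinearMap.comp_add f g L
  map_smul' c f := LinearMap.comp_smul L c f

variable (P γ V) in
/-- The action of `A` on `Γ(V)`. -/
def algAct : A →ₐ[ℂ] Module.End ℂ (HomCarrier P γ V) where
  toFun a := restrictOp (postOp (twistedAction P γ V a))
    fun _ _ hf => mem_homComplex (twistedAction_comp_mem hf a)
  map_one' := LinearMap.ext fun f => ext fun n k => by
    change V.π (P.φ k 1) _ = _
    rw [map_one, map_one]; rfl
  map_mul' a b := LinearMap.ext fun f => ext fun n k => by
    change V.π (P.φ k (a * b)) _ = V.π (P.φ k a) (V.π (P.φ k b) _)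
    rw [map_mul, map_mul]; rfl
  map_zero' := LinearMap.ext fun f => ext fun n k => by
    change V.π (P.φ k 0) _ = 0
    rw [map_zero, map_zero]; rfl
  map_add' a b := LinearMap.ext fun f => ext fun n k => by
    change V.π (P.φ k (a + b)) _ = V.π (P.φ k a) _ + V.π (P.φ k b) _
    rw [map_add, map_add]; rfl
  commutes' c := LinearMap.ext fun f => ext fun n k => by
    change V.π (P.φ k (algebraMap ℂ A c)) _ = c • _
    rw [AlgEquiv.commutes, AlgHom.commutes]; rfl

theorem eval_algAct (a : A) (f : HomCarrier P γ V) (n : StdComplex (LieAlg K)) (k : K) :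
    eval n k (algAct P γ V a f) = V.π (P.φ k a) (eval n k f) := rfl

theorem algAct_mem (a : A) {i : ℤ} {f : HomCarrier P γ V} (hf : f ∈ grade P γ V i) :
    algAct P γ V a f ∈ grade P γ V i := twistedAction_comp_mem hf a

variable (P γ V) in
/-- The action of `K` on `Γ(V)`. -/
def groupAct : Representation ℂ K (HomCarrier P γ V) where
  toFun g := restrictOp (postOp (rightTrV g)) fun _ _ hf => mem_homComplex (rightTrV_comp_mem hf g)
  map_one' := LinearMap.ext fun f => ext fun n k => by
    change (f.1 n).1 (k * 1) = (f.1 n).1 k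
    rw [mul_one]
  map_mul' g h := LinearMap.ext fun f => ext fun n k => by
    change (f.1 n).1 (k * (g * h)) = (f.1 n).1 (k * g * h)
    rw [mul_assoc]

theorem eval_groupAct (g : K) (f : HomCarrier P γ V) (n : StdComplex (LieAlg K)) (k : K) :
    eval n k (groupAct P γ V g f) = eval n (k * g) f := rfl

theorem groupAct_mem (g : K) {i : ℤ} {f : HomCarrier P γ V} (hf : f ∈ grade P γ V i) :
    groupAct P γ V g f ∈ grade P γ V i := rightTrV_comp_mem hf g

/-- An element of `Γ(V)` is determined by its values on the exterior part of `N(𝔨)`. -/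
theorem eq_zero_of_exteriorPart {f : HomCarrier P γ V}
    (h : ∀ n ∈ exteriorPart (LieAlg K), f.1 n = 0) : f = 0 := by
  have hker : LinearMap.ker f.1 = ⊤ := by
    -- If `f(n) = 0`, the derivative of its translates vanishes too, and the Lie condition gives
    -- `f(X n) = 0`.
    refine eq_top_of_exteriorPart_le (fun n hn => h n hn) fun X n hn => ?_
    rw [LinearMap.mem_ker] at hn ⊢
    refine regFun_ext fun k => ?_
    have h₁ := homComplex_lie f.2 X n k
    rw [hn] at h₁
    have h₂ := h₁.unique (hasDerivOne_const X 0)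
    have h₃ : ((0 : RegFun K V.carrier).1 k) = 0 := rfl
    rw [h₃, map_zero, zero_sub, neg_eq_zero] at h₂
    rw [h₂, h₃]
  exact Subtype.ext (LinearMap.ker_eq_top.1 hker)

variable (P γ V) in
-- Restriction to a basis of the exterior part embeds the complex in a finite power of `R(K, V)`,
-- compatibly with right translation. Orbit maps are regular there, and regularity descends along
-- the embedding.
theorem groupAct_isAlgebraic : IsAlgebraic (groupAct P γ V) := by
  refine isAlgebraic_of_orbit_mem fun f => ?_
  let b := Module.finBasis ℂ (exteriorPart (LieAlg K))
  let j : HomCarrier P γ V →ₗ[ℂ] (Fin (Module.finrank ℂ (exteriorPart (LieAlg K))) →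
      RegFun K V.carrier) :=
    { toFun := fun f i => f.1 (b i)
      map_add' := fun _ _ => rfl
      map_smul' := fun _ _ => rfl }
  have hj : Function.Injective j := by
    refine (injective_iff_map_eq_zero j).2 fun f hf => eq_zero_of_exteriorPart fun n hn => ?_
    have h : f.1 ∘ₗ (Subalgebra.toSubmodule (exteriorPart (LieAlg K))).subtype = 0 :=
      b.ext fun i => congrFun hf i
    exact LinearMap.congr_fun h ⟨n, hn⟩
  exact mem_regFun_of_injective hj (pi_mem_regFun fun i => rightTrV_orbit_mem (f.1 (b i)))

variable (P γ V) in
/-- The operators `(R(n) f)(m)(k) = f(Ad(k) n m)(k)` on `Γ(V)`. -/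
def right (n : StdComplex (LieAlg K)) : HomCarrier P γ V →ₗ[ℂ] HomCarrier P γ V :=
  restrictOp (homRight P γ V n) fun i f hf => by
    induction n using homogeneous_induction with
    | hadd a b ha hb =>
      rw [map_add]
      exact Submodule.add_mem _ ha hb
    | hdeg p n hn => exact mem_homComplex (homRight_mem hf hn)

theorem eval_right (n m : StdComplex (LieAlg K)) (f : HomCarrier P γ V) (k : K) :
    eval m k (right P γ V n f) = eval (AdN k n * m) k f := rfl

theorem right_mem {p i : ℤ} {n : StdComplex (LieAlg K)} (hn : n ∈ deg (LieAlg K) p)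
    {f : HomCarrier P γ V} (hf : f ∈ grade P γ V i) :
    right P γ V n f ∈ grade P γ V (p + i) := homRight_mem hf hn

theorem right_add (a b : StdComplex (LieAlg K)) :
    right P γ V (a + b) = right P γ V a + right P γ V b :=
  LinearMap.ext fun f => Subtype.ext (LinearMap.congr_fun (map_add (homRight P γ V) a b) f.1)

theorem right_smul (c : ℂ) (a : StdComplex (LieAlg K)) :
    right P γ V (c • a) = c • right P γ V a :=
  LinearMap.ext fun f => Subtype.ext (LinearMap.congr_fun (map_smul (homRight P γ V) c a) f.1)

theorem right_zero : right P γ V 0 = 0 :=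
  LinearMap.ext fun f => Subtype.ext (LinearMap.congr_fun (map_zero (homRight P γ V)) f.1)

theorem right_neg (a : StdComplex (LieAlg K)) : right P γ V (-a) = -right P γ V a := by
  rw [← neg_one_smul ℂ, right_smul, neg_one_smul]

/-- The order of the factors is reversed; the antiautomorphism `ι` turns this right action into a
left one. -/
theorem right_right (a b : StdComplex (LieAlg K)) (f : HomCarrier P γ V) :
    right P γ V a (right P γ V b f) = right P γ V (b * a) f :=
  ext fun m k => by rw [eval_right, eval_right, eval_right, map_mul, mul_assoc]

theorem right_one (f : HomCarrier P γ V) : right P γ V 1 f = f :=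
  ext fun m k => by rw [eval_right, map_one, one_mul]

variable (P γ V) in
/-- The operator `(-1) ^ i` on the component of degree `i` of `Γ(V)`. -/
def sign : HomCarrier P γ V →ₗ[ℂ] HomCarrier P γ V := gradeSign (isInternal P γ V)

theorem sign_apply {i : ℤ} {f : HomCarrier P γ V} (hf : f ∈ grade P γ V i) :
    sign P γ V f = (-1 : ℂ) ^ i • f := gradeSign_apply _ hf

theorem sign_sign (f : HomCarrier P γ V) : sign P γ V (sign P γ V f) = f := by
  induction f using graded_induction (isInternal P γ V) with
  | hadd f g hf hg => rw [map_add, map_add, hf, hg]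
  | hgrade i f hf =>
    rw [sign_apply hf, map_smul, sign_apply hf, smul_smul, neg_one_zpow_mul_self, one_smul]

theorem sign_right {p : ℤ} {n : StdComplex (LieAlg K)} (hn : n ∈ deg (LieAlg K) p)
    (f : HomCarrier P γ V) :
    sign P γ V (right P γ V n f) = (-1 : ℂ) ^ p • right P γ V n (sign P γ V f) := by
  induction f using graded_induction (isInternal P γ V) with
  | hadd f g hf hg => simp only [map_add, hf, hg, smul_add]
  | hgrade i f hf =>
    rw [sign_apply hf, sign_apply (right_mem hn hf), map_smul, smul_smul, sign_mul]

theorem sign_right_gen0 (X : LieAlg K) (f : HomCarrier P γ V) :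
    sign P γ V (right P γ V (gen0 X) f) = right P γ V (gen0 X) (sign P γ V f) := by
  rw [sign_right (gen0_mem X), zpow_zero, one_smul]

theorem sign_right_gen1 (ξ : LieAlg K) (f : HomCarrier P γ V) :
    sign P γ V (right P γ V (gen1 ξ) f) = -right P γ V (gen1 ξ) (sign P γ V f) := by
  rw [sign_right (gen1_mem ξ)]
  norm_num

variable (P γ V) in
/-- The action of `N(𝔨)` on `Γ(V)`. -/
def stdAct : StdComplex (LieAlg K) →ₐ[ℂ] Module.End ℂ (HomCarrier P γ V) :=
  -- Only generators need to be prescribed. The minus signs come from `ι`, and `sign` is the factor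
  -- `(-1) ^ (deg n * deg f)` for `deg n = -1`.
  lift
    { toFun := fun X => -right P γ V (gen0 X)
      map_add' := fun X Y => by rw [map_add, right_add, neg_add]
      map_smul' := fun c X => by rw [map_smul, right_smul, RingHom.id_apply, smul_neg] }
    { toFun := fun ξ => -(right P γ V (gen1 ξ) ∘ₗ sign P γ V)
      map_add' := fun X Y => by rw [map_add, right_add, LinearMap.add_comp, neg_add]
      map_smul' := fun c X => by
        rw [map_smul, right_smul, LinearMap.smul_comp, RingHom.id_apply, smul_neg] }
    (fun X Y => LinearMap.ext fun f => by
      change -right P γ V (gen0 X) (-right P γ V (gen0 Y) f) =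
        -right P γ V (gen0 Y) (-right P γ V (gen0 X) f) + -right P γ V (gen0 ⁅X, Y⁆) f
      rw [map_neg, map_neg, neg_neg, neg_neg, right_right, right_right, gen0_gen0 X Y, right_add,
        LinearMap.add_apply, add_neg_cancel_right])
    (fun X ξ => LinearMap.ext fun f => by
      change -right P γ V (gen0 X) (-right P γ V (gen1 ξ) (sign P γ V f)) =
        -right P γ V (gen1 ξ) (sign P γ V (-right P γ V (gen0 X) f)) +
          -right P γ V (gen1 ⁅X, ξ⁆) (sign P γ V f)
      rw [map_neg, map_neg, map_neg, neg_neg, neg_neg, sign_right_gen0, right_right, right_right,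
        gen0_gen1 X ξ, right_add, LinearMap.add_apply, add_neg_cancel_right])
    (fun ξ η => LinearMap.ext fun f => by
      change -right P γ V (gen1 ξ) (sign P γ V (-right P γ V (gen1 η) (sign P γ V f))) +
        -right P γ V (gen1 η) (sign P γ V (-right P γ V (gen1 ξ) (sign P γ V f))) = 0
      -- Moving `sign` past an odd operator costs a sign, and its square is the identity, so the
      -- relation reduces to the anticommutation of `gen1 ξ` and `gen1 η`.
      simp only [map_neg, sign_right_gen1, sign_sign, right_right, neg_neg]
      rw [← neg_add, ← LinearMap.add_apply, ← right_add, add_comm, gen1_gen1, right_zero,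
        LinearMap.zero_apply, neg_zero])

theorem stdAct_gen0 (X : LieAlg K) (f : HomCarrier P γ V) :
    stdAct P γ V (gen0 X) f = -right P γ V (gen0 X) f := by
  rw [stdAct, lift_gen0]; rfl

theorem stdAct_gen1 (ξ : LieAlg K) (f : HomCarrier P γ V) :
    stdAct P γ V (gen1 ξ) f = -right P γ V (gen1 ξ) (sign P γ V f) := by
  rw [stdAct, lift_gen1]; rfl

/-- Extends the formula from generators to words: the reversal in `iota_mul` matches that in
`right_right`. The sign operator supplies the degree shift caused by the rest of the word. -/
theorem stdAct_apply {p i : ℤ} {n : StdComplex (LieAlg K)} (hn : n ∈ deg (LieAlg K) p)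
    {f : HomCarrier P γ V} (hf : f ∈ grade P γ V i) :
    stdAct P γ V n f = (-1 : ℂ) ^ (p * i) • right P γ V (iota n) f := by
  induction hn using Submodule.span_induction with
  | zero => rw [map_zero, map_zero, right_zero, LinearMap.zero_apply, smul_zero]
  | add a b _ _ ha hb =>
    rw [map_add, map_add, right_add, LinearMap.add_apply, LinearMap.add_apply, ha, hb, smul_add]
  | smul c a _ ha =>
    rw [map_smul, map_smul, right_smul, LinearMap.smul_apply, LinearMap.smul_apply, ha, smul_comm]
  | mem x hx =>
    obtain ⟨l, rfl, rfl⟩ := hx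
    induction l with
    | nil => simp [wordDeg_nil, right_one]
    | cons a l ih =>
      have hl := prod_gen_mem l
      rw [List.map_cons, List.prod_cons, map_mul, Module.End.mul_apply, ih]
      set y := (l.map gen).prod
      rcases a with X | ξ
      · change stdAct P γ V (gen0 X) _ = _ • right P γ V (iota (gen0 X * y)) f
        rw [stdAct_gen0, wordDeg_inl, iota_mul (gen0_mem X) hl, zero_mul, zpow_zero, one_smul,
          iota_gen0, ← right_right, map_smul, right_neg, LinearMap.neg_apply, smul_neg]
      · change stdAct P γ V (gen1 ξ) _ = _ • right P γ V (iota (gen1 ξ * y)) f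
        rw [stdAct_gen1, wordDeg_inr, iota_mul (gen1_mem ξ) hl, right_smul, LinearMap.smul_apply,
          iota_gen1, ← right_right, map_smul, map_smul, sign_apply (right_mem (iota_mem hl) hf),
          map_smul, right_neg, LinearMap.neg_apply, smul_neg, smul_neg, smul_smul, smul_smul, sign_mul, sign_mul]
        congr 2
        exact sign_congr ⟨wordDeg l + i, by ring⟩

theorem eval_stdAct {p i : ℤ} {n : StdComplex (LieAlg K)} (hn : n ∈ deg (LieAlg K) p)
    {f : HomCarrier P γ V} (hf : f ∈ grade P γ V i) (m : StdComplex (LieAlg K)) (k : K) :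
    eval m k (stdAct P γ V n f) = (-1 : ℂ) ^ (p * i) • eval (AdN k (iota n) * m) k f := by
  rw [stdAct_apply hn hf, map_smul, eval_right]

theorem stdAct_mem {p i : ℤ} {n : StdComplex (LieAlg K)} (hn : n ∈ deg (LieAlg K) p)
    {f : HomCarrier P γ V} (hf : f ∈ grade P γ V i) :
    stdAct P γ V n f ∈ grade P γ V (p + i) := by
  rw [stdAct_apply hn hf]
  exact Submodule.smul_mem _ _ (right_mem (iota_mem hn) hf)

theorem eval_add_left (a b : StdComplex (LieAlg K)) (k : K) (f : HomCarrier P γ V) :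
    eval (a + b) k f = eval a k f + eval b k f := by
  rw [eval_apply, map_add]; rfl

theorem eval_smul_left (c : ℂ) (a : StdComplex (LieAlg K)) (k : K) (f : HomCarrier P γ V) :
    eval (c • a) k f = c • eval a k f := by
  rw [eval_apply, map_smul]; rfl

end HomCarrier

end Object

/-! ### Compatibility of the differential and the actions -/

section Object

variable {A : Type w} [Ring A] [Algebra ℂ A]
variable {K : Type u} [Group K] [AffineAlgebraicGroup K]
variable {T : Type t} [Group T] [AffineAlgebraicGroup T]
variable (P : HarishChandraPair A K) (γ : AlgGroupHom T K)

open StdComplex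

namespace HomCarrier

variable {P γ} {V : EqModule.{t, w, v} (P.restrict γ)}

theorem diff_algAct (a : A) (f : HomCarrier P γ V) :
    algAct P γ V a (diff P γ V f) = diff P γ V (algAct P γ V a f) := by
  induction f using graded_induction (isInternal P γ V) with
  | hadd f g hf hg => simp only [map_add, hf, hg]
  | hgrade i f hf =>
    refine ext fun n k => ?_
    rw [eval_algAct, eval_diff hf, eval_diff (algAct_mem a hf), eval_algAct, eval_algAct, map_sub,
      map_smul, V.π_d]

theorem diff_groupAct (g : K) (f : HomCarrier P γ V) :
    groupAct P γ V g (diff P γ V f) = diff P γ V (groupAct P γ V g f) := by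
  induction f using graded_induction (isInternal P γ V) with
  | hadd f g hf hg => simp only [map_add, hf, hg]
  | hgrade i f hf =>
    refine ext fun n k => ?_
    rw [eval_groupAct, eval_diff hf, eval_diff (groupAct_mem g hf), eval_groupAct, eval_groupAct]

/-- The Leibniz rule is applied to the argument `Ad(k)(ι n) m` of `f`; both `Ad k` and `ι` commute
with the differential of `N(𝔨)`. -/
theorem diff_stdAct {p : ℤ} {n : StdComplex (LieAlg K)} (hn : n ∈ deg (LieAlg K) p)
    (f : HomCarrier P γ V) : diff P γ V (stdAct P γ V n f) =
      stdAct P γ V (StdComplex.diff n) f + (-1 : ℂ) ^ p • stdAct P γ V n (diff P γ V f) := by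
  induction f using graded_induction (isInternal P γ V) with
  | hadd f g hf hg => simp only [map_add, hf, hg, smul_add]; abel
  | hgrade i f hf =>
    refine ext fun m k => ?_
    rw [eval_diff (stdAct_mem hn hf), map_add, map_smul, eval_stdAct hn hf, eval_stdAct hn hf,
      eval_stdAct (StdComplex.diff_mem hn) hf, eval_stdAct hn (diff_mem hf), eval_diff hf,
      StdComplex.diff_mul (AdN_mem k (iota_mem hn)), ← AdN_diff, ← iota_diff, eval_add_left,
      eval_smul_left, map_smul]
    simp only [smul_add, smul_sub, smul_smul, sign_mul]
    have e₁ : (-1 : ℂ) ^ ((p + 1) * i) = (-1) ^ (p * i + i) := by congr 1; ring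
    have e₂ : (-1 : ℂ) ^ (p + p * (i + 1)) = (-1) ^ (p * i) := sign_congr ⟨p, by ring⟩
    have e₃ : (-1 : ℂ) ^ (p + (p * (i + 1) + i)) = (-1) ^ (p * i + i) := sign_congr ⟨p, by ring⟩
    have e₄ : (-1 : ℂ) ^ (p + (p * (i + 1) + (i + p))) = (-1) ^ (p + i + p * i) :=
      sign_congr ⟨p, by ring⟩
    rw [e₁, e₂, e₃, e₄]
    abel

theorem algAct_groupAct (g : K) (a : A) (f : HomCarrier P γ V) :
    algAct P γ V (P.φ g a) (groupAct P γ V g f) = groupAct P γ V g (algAct P γ V a f) :=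
  ext fun n k => by
    rw [eval_algAct, eval_groupAct, eval_groupAct, eval_algAct, map_mul]; rfl

theorem stdAct_groupAct (g : K) (n : StdComplex (LieAlg K)) (f : HomCarrier P γ V) :
    stdAct P γ V (AdN g n) (groupAct P γ V g f) = groupAct P γ V g (stdAct P γ V n f) := by
  induction n using homogeneous_induction with
  | hadd a b ha hb => simp only [map_add, LinearMap.add_apply, ha, hb]
  | hdeg p n hn =>
    induction f using graded_induction (isInternal P γ V) with
    | hadd f g hf hg => simp only [map_add, hf, hg]
    | hgrade i f hf =>
      refine ext fun m k => ?_
      rw [eval_stdAct (AdN_mem g hn) (groupAct_mem g hf), eval_groupAct, eval_groupAct,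
        eval_stdAct hn hf, iota_AdN, ← AdN_mul]

theorem algAct_stdAct (a : A) (n : StdComplex (LieAlg K)) (f : HomCarrier P γ V) :
    algAct P γ V a (stdAct P γ V n f) = stdAct P γ V n (algAct P γ V a f) := by
  induction n using homogeneous_induction with
  | hadd a b ha hb => simp only [map_add, LinearMap.add_apply, ha, hb]
  | hdeg p n hn =>
    induction f using graded_induction (isInternal P γ V) with
    | hadd f g hf hg => simp only [map_add, hf, hg]
    | hgrade i f hf =>
      refine ext fun m k => ?_
      rw [eval_algAct, eval_stdAct hn hf, eval_stdAct hn (algAct_mem a hf), eval_algAct, map_smul]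

/-- The differential of `ν` at `f` is computed by differentiating `g ↦ f(n)(k g)` along `X`. This
equals the derivative of `x ↦ f(n)(x k)` along `Ad k X`, which the Lie condition evaluates.
Equivariance of `ψ` then identifies `ψ(Ad k X)` with `φ(k)(ψ X)`. -/
theorem algAct_add_stdAct (X : LieAlg K) (f : HomCarrier P γ V) :
    algAct P γ V (P.ψ X) f + stdAct P γ V (gen0 X) f =
      differential (groupAct P γ V) (groupAct_isAlgebraic P γ V) X f := by
  refine ext fun n k => ?_
  have h₁ : HasDerivOne X (fun g => eval n k (groupAct P γ V g f))
      (eval n k (differential (groupAct P γ V) (groupAct_isAlgebraic P γ V) X f)) :=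
    HasDerivOne.linear_comp ⟨(groupAct_isAlgebraic P γ V).orbit_mem f, rfl⟩ _
  have h₂ := hasDerivOne_leftTr X k (f.1 n)
  rw [(hasDerivOne (Ad k X) (rightTrV k (f.1 n))).unique (homComplex_lie f.2 (Ad k X) n k)] at h₂
  rw [h₁.unique h₂, map_add, eval_algAct, stdAct_gen0, map_neg, eval_right, ← P.ψ_equivariant,
    sub_eq_add_neg]
  have h₃ : AdN k (gen0 X) = gen0 (Ad k X) := map_gen0 _ _
  rw [h₃]
  rfl

end HomCarrier

variable (V : EqModule.{t, w, v} (P.restrict γ))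

/-- The equivariant Zuckerman functor on objects. -/
abbrev zuckermanObj : EqModule.{u, w, max u v} P where
  carrier := HomCarrier P γ V
  grade := HomCarrier.grade P γ V
  isInternal := HomCarrier.isInternal P γ V
  d := HomCarrier.diff P γ V
  d_mem _ _ hf := HomCarrier.diff_mem hf
  d_d := HomCarrier.diff_diff
  π := HomCarrier.algAct P γ V
  ν := HomCarrier.groupAct P γ V
  ω := HomCarrier.stdAct P γ V
  π_mem a _ _ hf := HomCarrier.algAct_mem a hf
  π_d := HomCarrier.diff_algAct
  ν_mem g _ _ hf := HomCarrier.groupAct_mem g hf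
  ν_d := HomCarrier.diff_groupAct
  ν_algebraic := HomCarrier.groupAct_isAlgebraic P γ V
  ω_mem _ _ _ hn _ hf := HomCarrier.stdAct_mem hn hf
  ω_d _ _ hn f := HomCarrier.diff_stdAct hn f
  π_equivariant := HomCarrier.algAct_groupAct
  ω_equivariant := HomCarrier.stdAct_groupAct
  π_ω := HomCarrier.algAct_stdAct
  π_add_ω := HomCarrier.algAct_add_stdAct

end Object

section Functor

variable {A : Type w} [Ring A] [Algebra ℂ A]
variable {K : Type u} [Group K] [AffineAlgebraicGroup K]
variable {T : Type t} [Group T] [AffineAlgebraicGroup T]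
variable (P : HarishChandraPair A K) (γ : AlgGroupHom T K)

open StdComplex

/-! ### The equivariant Zuckerman functor on morphisms -/

variable {P γ} in
theorem postComp_comp_mem {V W : EqModule.{t, w, v} (P.restrict γ)} (α : V ⟶ W) {i : ℤ}
    {f : StdComplex (LieAlg K) →ₗ[ℂ] RegFun K V.carrier} (hf : f ∈ homDeg P γ V i) :
    postComp α.toLin ∘ₗ f ∈ homDeg P γ W i := by
  obtain ⟨h1, h2, h3, h4⟩ := mem_homDeg_iff.1 hf
  refine mem_homDeg_iff.2 ⟨fun p n hn k => ?_, fun X n k => ?_, fun x n k => ?_,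
    fun p m hm q n hn k => ?_⟩
  all_goals simp only [LinearMap.comp_apply, postComp_apply]
  · exact α.map_mem _ _ (h1 p n hn k)
  · convert (h2 X n k).linear_comp α.toLin using 1
    rw [map_sub, α.map_π]
  · rw [h3, α.map_ν]
  · rw [h4 p m hm q n hn, map_smul, α.map_ω]

/-- The equivariant Zuckerman functor on morphisms, as a linear map. -/
def zuckermanMapLin {V W : EqModule.{t, w, v} (P.restrict γ)} (α : V ⟶ W) :
    HomCarrier P γ V →ₗ[ℂ] HomCarrier P γ W :=
  HomCarrier.restrictOp (HomCarrier.postOp (postComp α.toLin)) fun _ _ hf =>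
    mem_homComplex (postComp_comp_mem α hf)

variable {P γ} in
theorem eval_zuckermanMapLin {V W : EqModule.{t, w, v} (P.restrict γ)} (α : V ⟶ W)
    (f : HomCarrier P γ V) (n : StdComplex (LieAlg K)) (k : K) :
    HomCarrier.eval n k (zuckermanMapLin P γ α f) = α.toLin (HomCarrier.eval n k f) := rfl

variable {P γ} in
theorem zuckermanMapLin_mem {V W : EqModule.{t, w, v} (P.restrict γ)} (α : V ⟶ W) {i : ℤ}
    {f : HomCarrier P γ V} (hf : f ∈ HomCarrier.grade P γ V i) :
    zuckermanMapLin P γ α f ∈ HomCarrier.grade P γ W i := postComp_comp_mem α hf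

variable {P γ} in
theorem zuckermanMapLin_diff {V W : EqModule.{t, w, v} (P.restrict γ)} (α : V ⟶ W)
    (f : HomCarrier P γ V) : zuckermanMapLin P γ α (HomCarrier.diff P γ V f) =
      HomCarrier.diff P γ W (zuckermanMapLin P γ α f) := by
  induction f using graded_induction (HomCarrier.isInternal P γ V) with
  | hadd f g hf hg => simp only [map_add, hf, hg]
  | hgrade i f hf =>
    refine HomCarrier.ext fun n k => ?_
    rw [eval_zuckermanMapLin, HomCarrier.eval_diff hf,
      HomCarrier.eval_diff (zuckermanMapLin_mem α hf), eval_zuckermanMapLin,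
      eval_zuckermanMapLin, map_sub, map_smul, α.map_d]

variable {P γ} in
theorem zuckermanMapLin_stdAct {V W : EqModule.{t, w, v} (P.restrict γ)} (α : V ⟶ W)
    (n : StdComplex (LieAlg K)) (f : HomCarrier P γ V) :
    zuckermanMapLin P γ α (HomCarrier.stdAct P γ V n f) =
      HomCarrier.stdAct P γ W n (zuckermanMapLin P γ α f) := by
  induction n using homogeneous_induction with
  | hadd a b ha hb => simp only [map_add, LinearMap.add_apply, ha, hb]
  | hdeg p n hn =>
    induction f using graded_induction (HomCarrier.isInternal P γ V) with
    | hadd f g hf hg => simp only [map_add, hf, hg]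
    | hgrade i f hf =>
      refine HomCarrier.ext fun m k => ?_
      rw [eval_zuckermanMapLin, HomCarrier.eval_stdAct hn hf,
        HomCarrier.eval_stdAct hn (zuckermanMapLin_mem α hf), eval_zuckermanMapLin, map_smul]

/-- The equivariant Zuckerman functor on morphisms. -/
def zuckermanMap {V W : EqModule.{t, w, v} (P.restrict γ)} (α : V ⟶ W) :
    zuckermanObj P γ V ⟶ zuckermanObj P γ W where
  toLin := zuckermanMapLin P γ α
  map_mem _ _ hf := zuckermanMapLin_mem α hf
  map_d := zuckermanMapLin_diff α
  map_π _ _ := HomCarrier.ext fun _ _ => α.map_π _ _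
  map_ν _ _ := rfl
  map_ω := zuckermanMapLin_stdAct α

/-- The equivariant Zuckerman functor. -/
def zuckerman : EqModule.{t, w, max u v} (P.restrict γ) ⥤ EqModule.{u, w, max u v} P where
  obj V := zuckermanObj P γ V
  map α := zuckermanMap P γ α
  map_id _ := rfl
  map_comp _ _ := rfl

/-! ### The unit -/

section Unit

variable (V : EqModule.{u, w, v} P)

/-- The maps `n ↦ (k ↦ (-1) ^ (i * deg n) ω(ι(n)) ν(k) x)`. -/
def unitAux (i : ℤ) : V.carrier →ₗ[ℂ] (StdComplex (LieAlg K) →ₗ[ℂ] RegFun K V.carrier) :=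
  LinearMap.mk₂ ℂ
    (fun x n => ⟨fun k => V.ω (iota (signTwist i n)) (V.ν k x),
      linear_comp_mem_regFun _ (V.ν_algebraic.orbit_mem x)⟩)
    (fun x y n => regFun_ext fun k => by simp)
    (fun c x n => regFun_ext fun k => by simp)
    (fun x m n => regFun_ext fun k => by simp)
    (fun c x n => regFun_ext fun k => by simp)

variable {P V}

theorem unitAux_apply (i : ℤ) {p : ℤ} {n : StdComplex (LieAlg K)} (hn : n ∈ deg (LieAlg K) p)
    (x : V.carrier) (k : K) :
    (unitAux P V i x n).1 k = (-1 : ℂ) ^ (i * p) • V.ω (iota n) (V.ν k x) := by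
  change V.ω (iota (signTwist i n)) (V.ν k x) = _
  rw [signTwist_of_mem i hn, map_smul, map_smul, LinearMap.smul_apply]

variable {γ} in
-- The conditions for `𝔨` and `T` are additive in `n`. The formula for the unit has a usable sign
-- only on homogeneous `n`, so the reduction is needed there.
theorem mem_homDeg_of_homogeneous {V : EqModule.{t, w, v} (P.restrict γ)} {i : ℤ}
    {f : StdComplex (LieAlg K) →ₗ[ℂ] RegFun K V.carrier}
    (h1 : ∀ p, ∀ n ∈ deg (LieAlg K) p, ∀ k, (f n).1 k ∈ V.grade (p + i))
    (h2 : ∀ X p, ∀ n ∈ deg (LieAlg K) p, ∀ k, HasDerivOne X (fun x => (f n).1 (x * k))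
        (V.π (P.ψ X) ((f n).1 k) - (f (gen0 X * n)).1 k))
    (h3 : ∀ x p, ∀ n ∈ deg (LieAlg K) p, ∀ k,
      (f (AdN (γ.toHom x) n)).1 (γ.toHom x * k) = V.ν x ((f n).1 k))
    (h4 : ∀ p, ∀ m ∈ deg (LieAlg T) p, ∀ q, ∀ n ∈ deg (LieAlg K) q, ∀ k,
        (f (n * map γ.lieMap (iota m))).1 k = (-1 : ℂ) ^ (p * (i + q)) • V.ω m ((f n).1 k)) :
    f ∈ homDeg P γ V i := by
  refine mem_homDeg_iff.2 ⟨h1, fun X n k => ?_, fun x n k => ?_, h4⟩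
  · induction n using homogeneous_induction with
    | hdeg p n hn => exact h2 X p n hn k
    | hadd a b ha hb =>
      convert ha.add hb using 1
      · rw [map_add]; rfl
      · rw [mul_add, map_add, map_add]
        change V.π (P.ψ X) ((f a).1 k + (f b).1 k) -
          ((f (gen0 X * a)).1 k + (f (gen0 X * b)).1 k) = _
        rw [map_add]
        abel
  · induction n using homogeneous_induction with
    | hdeg p n hn => exact h3 x p n hn k
    | hadd a b ha hb =>
      rw [map_add, map_add, map_add]
      change (f (AdN (γ.toHom x) a)).1 (γ.toHom x * k) +
        (f (AdN (γ.toHom x) b)).1 (γ.toHom x * k) = V.ν x ((f a).1 k + (f b).1 k)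
      rw [map_add, ha, hb]

/-- The Lie condition is the relation `dν = π ∘ ψ + ω` in `V`: since `ι(X n) = -ι(n) X`, the summand
`ω(X)` of the derivative produces the term `-f(X n)`. The condition for `T` is the equivariance of
`ω`, and the one for `N(𝔱)` uses that `ι` is an involution. -/
theorem unitAux_mem {i : ℤ} {x : V.carrier} (hx : x ∈ V.grade i) :
    unitAux P V i x ∈ homDeg P γ ((forgetEq P γ).obj V) i := by
  refine mem_homDeg_of_homogeneous (fun p n hn k => ?_) (fun X p n hn k => ?_)
    (fun x' p n hn k => ?_) (fun p m hm q n hn k => ?_)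
  · change (unitAux P V i x n).1 k ∈ V.grade (p + i)
    rw [unitAux_apply i hn]
    exact Submodule.smul_mem _ _ (V.ω_mem _ _ _ (iota_mem hn) _ (V.ν_mem k i x hx))
  · change HasDerivOne (V := V.carrier) X (fun g => (unitAux P V i x n).1 (g * k))
      (V.π (P.ψ X) ((unitAux P V i x n).1 k) - (unitAux P V i x (gen0 X * n)).1 k)
    have hd : HasDerivOne X (fun g => V.ν g (V.ν k x))
        (differential V.ν V.ν_algebraic X (V.ν k x)) := ⟨V.ν_algebraic.orbit_mem _, rfl⟩
    rw [← V.π_add_ω] at hd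
    convert (hd.linear_comp (V.ω (iota n))).smul ((-1 : ℂ) ^ (i * p)) using 1
    · funext g
      rw [unitAux_apply i hn, map_mul]; rfl
    · have hXn := mul_mem (gen0_mem X) hn
      rw [zero_add] at hXn
      rw [unitAux_apply i hn, unitAux_apply i hXn, iota_mul (gen0_mem X) hn, zero_mul, zpow_zero,
        one_smul, iota_gen0, mul_neg, map_neg, map_mul, LinearMap.neg_apply, Module.End.mul_apply,
        smul_neg, sub_neg_eq_add, map_add, smul_add, ← V.π_ω, map_smul]
  · change (unitAux P V i x (AdN (γ.toHom x') n)).1 (γ.toHom x' * k) =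
      V.ν (γ.toHom x') ((unitAux P V i x n).1 k)
    rw [unitAux_apply i hn, unitAux_apply i (AdN_mem _ hn), iota_AdN, map_mul,
      Module.End.mul_apply, V.ω_equivariant, map_smul]
  · change (unitAux P V i x (n * StdComplex.map γ.lieMap (iota m))).1 k =
      (-1 : ℂ) ^ (p * (i + q)) • V.ω (StdComplex.map γ.lieMap m) ((unitAux P V i x n).1 k)
    rw [unitAux_apply i hn, unitAux_apply i (mul_mem hn (map_mem _ (iota_mem hm))),
      iota_mul hn (map_mem _ (iota_mem hm)), iota_map, iota_iota, map_smul, map_mul,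
      LinearMap.smul_apply, Module.End.mul_apply, smul_smul, sign_mul, map_smul, smul_smul,
      sign_mul]
    congr 1
    exact sign_congr ⟨0, by ring⟩

variable (P V) in
/-- The unit of the adjunction, as a linear map. -/
def unitLin : V.carrier →ₗ[ℂ] HomCarrier P γ ((forgetEq P γ).obj V) :=
  ofComponents V.isInternal fun i =>
    { toFun := fun x => ⟨unitAux P V i x.1, mem_homComplex (unitAux_mem γ x.2)⟩
      map_add' := fun x y => Subtype.ext (map_add (unitAux P V i) x.1 y.1)
      map_smul' := fun c x => Subtype.ext (map_smul (unitAux P V i) c x.1) }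

theorem unitLin_val {i : ℤ} {x : V.carrier} (hx : x ∈ V.grade i) :
    (unitLin P γ V x).1 = unitAux P V i x := by
  rw [unitLin, ofComponents_apply _ _ hx]
  rfl

theorem unitLin_mem {i : ℤ} {x : V.carrier} (hx : x ∈ V.grade i) :
    unitLin P γ V x ∈ HomCarrier.grade P γ ((forgetEq P γ).obj V) i := by
  rw [HomCarrier.mem_grade, unitLin_val γ hx]
  exact unitAux_mem γ hx

theorem eval_unitLin {i : ℤ} {x : V.carrier} (hx : x ∈ V.grade i) {p : ℤ}
    {n : StdComplex (LieAlg K)} (hn : n ∈ deg (LieAlg K) p) (k : K) :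
    HomCarrier.eval n k (unitLin P γ V x) = (-1 : ℂ) ^ (i * p) • V.ω (iota n) (V.ν k x) := by
  rw [HomCarrier.eval_apply, unitLin_val γ hx]
  exact unitAux_apply i hn x k

theorem unitLin_diff (x : V.carrier) : unitLin P γ V (V.d x) =
    HomCarrier.diff P γ ((forgetEq P γ).obj V) (unitLin P γ V x) := by
  induction x using graded_induction V.isInternal with
  | hadd x y hx hy => simp only [map_add, hx, hy]
  | hgrade i x hx =>
    refine HomCarrier.ext_homogeneous fun p n hn k => ?_
    rw [HomCarrier.eval_diff (unitLin_mem γ hx), eval_unitLin γ (V.d_mem i x hx) hn,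
      eval_unitLin γ hx hn, eval_unitLin γ hx (diff_mem hn)]
    change (-1 : ℂ) ^ ((i + 1) * p) • V.ω (iota n) (V.ν k (V.d x)) =
      V.d ((-1 : ℂ) ^ (i * p) • V.ω (iota n) (V.ν k x)) -
        (-1 : ℂ) ^ i • (-1 : ℂ) ^ (i * (p + 1)) • V.ω (iota (StdComplex.diff n)) (V.ν k x)
    rw [V.ν_d, iota_diff, smul_smul, sign_mul, map_smul, V.ω_d p _ (iota_mem hn), smul_add,
      smul_smul, sign_mul]
    have e₁ : (-1 : ℂ) ^ ((i + 1) * p) = (-1) ^ (i * p + p) := by congr 1; ring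
    have e₂ : (-1 : ℂ) ^ (i + i * (p + 1)) = (-1) ^ (i * p) := sign_congr ⟨i, by ring⟩
    rw [e₁, e₂]
    abel

theorem unitLin_algAct (a : A) (x : V.carrier) : unitLin P γ V (V.π a x) =
    HomCarrier.algAct P γ ((forgetEq P γ).obj V) a (unitLin P γ V x) := by
  induction x using graded_induction V.isInternal with
  | hadd x y hx hy => simp only [map_add, hx, hy]
  | hgrade i x hx =>
    refine HomCarrier.ext_homogeneous fun p n hn k => ?_
    rw [HomCarrier.eval_algAct, eval_unitLin γ (V.π_mem a i x hx) hn, eval_unitLin γ hx hn]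
    change (-1 : ℂ) ^ (i * p) • V.ω (iota n) (V.ν k (V.π a x)) =
      V.π (P.φ k a) ((-1 : ℂ) ^ (i * p) • V.ω (iota n) (V.ν k x))
    rw [← V.π_equivariant, ← V.π_ω, map_smul]

theorem unitLin_groupAct (g : K) (x : V.carrier) : unitLin P γ V (V.ν g x) =
    HomCarrier.groupAct P γ ((forgetEq P γ).obj V) g (unitLin P γ V x) := by
  induction x using graded_induction V.isInternal with
  | hadd x y hx hy => simp only [map_add, hx, hy]
  | hgrade i x hx =>
    refine HomCarrier.ext_homogeneous fun p n hn k => ?_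
    rw [HomCarrier.eval_groupAct, eval_unitLin γ (V.ν_mem g i x hx) hn, eval_unitLin γ hx hn,
      map_mul, Module.End.mul_apply]

/-- Reversal and `ι ι = 1` turn `ι(Ad(k)(ι m) n)` into `± ι(n) Ad(k) m`, and equivariance moves
`Ad(k) m` past `ν(k)`. -/
theorem unitLin_stdAct (m : StdComplex (LieAlg K)) (x : V.carrier) : unitLin P γ V (V.ω m x) =
    HomCarrier.stdAct P γ ((forgetEq P γ).obj V) m (unitLin P γ V x) := by
  induction m using homogeneous_induction with
  | hadd a b ha hb => simp only [map_add, LinearMap.add_apply, ha, hb]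
  | hdeg p m hm =>
    induction x using graded_induction V.isInternal with
    | hadd x y hx hy => simp only [map_add, hx, hy]
    | hgrade i x hx =>
      refine HomCarrier.ext_homogeneous fun q n hn k => ?_
      have hm' := AdN_mem k (iota_mem hm)
      rw [HomCarrier.eval_stdAct hm (unitLin_mem γ hx),
        eval_unitLin γ (V.ω_mem p i m hm x hx) hn, eval_unitLin γ hx (mul_mem hm' hn)]
      change (-1 : ℂ) ^ ((p + i) * q) • V.ω (iota n) (V.ν k (V.ω m x)) =
        (-1 : ℂ) ^ (p * i) • (-1 : ℂ) ^ (i * (p + q)) •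
          V.ω (iota (AdN k (iota m) * n)) (V.ν k x)
      rw [iota_mul hm' hn, iota_AdN, iota_iota, map_smul, map_mul, LinearMap.smul_apply,
        Module.End.mul_apply, V.ω_equivariant, smul_smul, smul_smul, sign_mul, sign_mul]
      congr 1
      exact sign_congr ⟨-(p * i), by ring⟩

end Unit

/-- The morphisms to `zuckermanObj P γ F`, as linear maps to the complex `HomCarrier P γ F`. -/
def zuckermanHom {V : EqModule.{u, w, max u v} P} (F : EqModule.{t, w, max u v} (P.restrict γ))
    (l : V.carrier →ₗ[ℂ] HomCarrier P γ F)
    (hl : ∀ i, ∀ x ∈ V.grade i, l x ∈ HomCarrier.grade P γ F i)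
    (hd : ∀ x, l (V.d x) = HomCarrier.diff P γ F (l x))
    (hπ : ∀ a x, l (V.π a x) = HomCarrier.algAct P γ F a (l x))
    (hν : ∀ g x, l (V.ν g x) = HomCarrier.groupAct P γ F g (l x))
    (hω : ∀ n x, l (V.ω n x) = HomCarrier.stdAct P γ F n (l x)) :
    V ⟶ zuckermanObj P γ F :=
  ⟨l, hl, hd, hπ, hν, hω⟩

/-- The unit of the adjunction. -/
def zuckermanUnit (V : EqModule.{u, w, max u v} P) :
    V ⟶ zuckermanObj P γ ((forgetEq P γ).obj V) :=
  zuckermanHom.{u, t, w, v} (P := P) γ ((forgetEq P γ).obj V) (unitLin P γ V)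
    (fun _ _ hx => unitLin_mem γ hx) (unitLin_diff (P := P) (V := V) γ)
    (unitLin_algAct (P := P) (V := V) γ) (unitLin_groupAct (P := P) (V := V) γ)
    (unitLin_stdAct (P := P) (V := V) γ)

/-! ### The counit -/

section Counit

variable {P γ} {W : EqModule.{t, w, v} (P.restrict γ)}

namespace HomCarrier

/-- The term `f ∘ d` drops out because `d 1 = 0` in `N(𝔨)`. -/
theorem eval_one_diff (f : HomCarrier P γ W) :
    eval 1 1 (diff P γ W f) = W.d (eval 1 1 f) := by
  induction f using graded_induction (isInternal P γ W) with
  | hadd f g hf hg => simp only [map_add, hf, hg]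
  | hgrade i f hf =>
    have h : eval (0 : StdComplex (LieAlg K)) 1 f = 0 := by
      rw [eval_apply, map_zero]; rfl
    rw [eval_diff hf, diff_one, h, smul_zero, sub_zero]

/-- Since `Ad` fixes `1 ∈ N(𝔨)`, equivariance under `T` relates the values of `f(1)` at `γ(x)` and
at `1`. -/
theorem eval_one_groupAct (x : T) (f : HomCarrier P γ W) :
    eval 1 1 (groupAct P γ W (γ.toHom x) f) = W.ν x (eval 1 1 f) := by
  have h := homComplex_group f.2 x 1 1
  rw [map_one, mul_one] at h
  rw [eval_groupAct, one_mul]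
  exact h

/-- At the base point the left multiplication by `ι(m)` in the action of `N(𝔨)` is also right
multiplication, as it acts on `1`. The condition for `N(𝔱)` then gives `ω(m)`, with the same sign a
second time. -/
theorem eval_one_stdAct (m : StdComplex (LieAlg T)) (f : HomCarrier P γ W) :
    eval 1 1 (stdAct P γ W (StdComplex.map γ.lieMap m) f) = W.ω m (eval 1 1 f) := by
  induction m using homogeneous_induction with
  | hadd a b ha hb => simp only [map_add, LinearMap.add_apply, ha, hb]
  | hdeg p m hm =>
    induction f using graded_induction (isInternal P γ W) with
    | hadd f g hf hg => simp only [map_add, hf, hg]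
    | hgrade i f hf =>
      have h := (mem_homDeg_iff.1 hf).2.2.2 p m hm 0 1 one_mem 1
      rw [eval_stdAct (map_mem _ hm) hf, AdN_one, iota_map, mul_one, eval_apply]
      rw [one_mul, add_zero] at h
      rw [h, smul_smul, neg_one_zpow_mul_self, one_smul, eval_apply]

end HomCarrier

end Counit

/-- The counit of the adjunction. -/
def zuckermanCounit (W : EqModule.{t, w, max u v} (P.restrict γ)) :
    (forgetEq P γ).obj (zuckermanObj P γ W) ⟶ W where
  toLin := HomCarrier.eval (P := P) (γ := γ) 1 1
  map_mem i f hf := by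
    have h := HomCarrier.eval_mem (P := P) (γ := γ) (V := W) hf one_mem 1
    rwa [zero_add] at h
  map_d := HomCarrier.eval_one_diff
  map_π a f := by
    change W.π (P.φ 1 a) _ = W.π a _
    rw [map_one]; rfl
  map_ν := HomCarrier.eval_one_groupAct
  map_ω := HomCarrier.eval_one_stdAct

/-! ### The adjunction -/

/-- The equivariant Zuckerman functor is right adjoint to the forgetful functor. -/
def zuckermanAdjunction : forgetEq.{u, t, w, max u v} P γ ⊣ zuckerman.{u, t, w, v} P γ where
  unit :=
    { app := fun V => zuckermanUnit P γ V
      naturality := fun V W α => EqModule.Hom.ext <| graded_hom_ext V.isInternal fun i x hx => by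
        refine HomCarrier.ext_homogeneous fun p n hn k => ?_
        change HomCarrier.eval n k (unitLin P γ W (α.toLin x)) =
          α.toLin (HomCarrier.eval n k (unitLin P γ V x))
        rw [eval_unitLin γ hx hn, eval_unitLin γ (α.map_mem i x hx) hn, ← α.map_ν, ← α.map_ω]
        exact (map_smul α.toLin _ _).symm }
  counit :=
    { app := fun W => zuckermanCounit P γ W
      naturality := fun _ _ _ => rfl }
  left_triangle_components V :=
    EqModule.Hom.ext <| graded_hom_ext V.isInternal fun i x hx => by
      change HomCarrier.eval 1 1 (unitLin P γ V x) = x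
      -- The element `1` has degree `0`, so the sign is trivial.
      rw [eval_unitLin γ hx one_mem, mul_zero, zpow_zero, one_smul, iota_one, map_one, map_one]
      rfl
  right_triangle_components W :=
    EqModule.Hom.ext <| graded_hom_ext (HomCarrier.isInternal P γ W) fun i f hf => by
      refine HomCarrier.ext_homogeneous fun p n hn k => ?_
      -- The unit at `f` sends `(n, k)` to `ω(ι n) ν(k) f` up to sign. Evaluating this at the base
      -- point moves `ι ι n = n` and `k` back into the arguments of `f`, and the sign occurs twice.
      change HomCarrier.eval 1 1 (HomCarrier.eval n k (unitLin P γ (zuckermanObj P γ W) f)) =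
        HomCarrier.eval n k f
      rw [eval_unitLin γ hf hn]
      change HomCarrier.eval 1 1 ((-1 : ℂ) ^ (i * p) •
        HomCarrier.stdAct P γ W (iota n) (HomCarrier.groupAct P γ W k f)) = _
      rw [map_smul, HomCarrier.eval_stdAct (iota_mem hn) (HomCarrier.groupAct_mem k hf), AdN_one,
        iota_iota, mul_one, HomCarrier.eval_groupAct, one_mul, smul_smul, mul_comm p,
        neg_one_zpow_mul_self, one_smul]

end Functor

end EqZuckerman

end

/-! ### The adjunction theorem -/

theorem mainTheorem3 {A : Type w} [Ring A] [Algebra ℂ A]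
    {K : Type u} [Group K] [AffineAlgebraicGroup K]
    {T : Type t} [Group T] [AffineAlgebraicGroup T]
    (P : HarishChandraPair A K) (γ : AlgGroupHom T K) (hγ : Function.Injective γ.lieMap) :
    ∃ (Γ : EqModule.{t, w, max u v} (P.restrict γ) ⥤ EqModule.{u, w, max u v} P)
      (e : ∀ V, (Γ.obj V).carrier ≃ₗ[ℂ] homComplex P γ V),
      IsEquivariantZuckerman P γ Γ e ∧
      ∃ adj : forgetEq P γ ⊣ Γ,
        (∀ (V : EqModule.{u, w, max u v} P) (i : ℤ), ∀ x ∈ V.grade i,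
          ∀ (p : ℤ), ∀ n ∈ StdComplex.deg (LieAlg K) p, ∀ k : K,
            homEval P γ _ (e _ ((adj.unit.app V).toLin x)) n k =
              (-1 : ℂ) ^ (i * p) • V.ω (StdComplex.iota n) (V.ν k x)) ∧
        (∀ (W : EqModule.{t, w, max u v} (P.restrict γ)) (f : (Γ.obj W).carrier),
            (adj.counit.app W).toLin f = homEval P γ W (e W f) 1 1) := by
  -- `HomCarrier` is definitionally the submodule `homComplex`, so the identification is the
  -- identity map and most of the required formulas hold by definition.
  refine ⟨zuckerman P γ, fun V =>
    { toFun := fun f => f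
      invFun := fun f => f
      left_inv := fun _ => rfl
      right_inv := fun _ => rfl
      map_add' := fun _ _ => rfl
      map_smul' := fun _ _ => rfl }, ⟨?_, ?_, ?_, ?_, ?_, ?_⟩, zuckermanAdjunction P γ, ?_, ?_⟩
  · exact fun _ _ _ => Iff.rfl
  · exact fun V i f hf n k => HomCarrier.eval_diff hf n k
  · exact fun _ _ _ _ _ => rfl
  · exact fun _ _ _ _ _ => rfl
  · exact fun V p n hn i f hf m k => HomCarrier.eval_stdAct hn hf m k
  · exact fun _ _ _ _ _ _ => rfl
  · exact fun V i x hx p n hn k => eval_unitLin γ hx hn k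
  · exact fun _ _ => rfl
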